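/- **Setting.** Identify the circle $\mathbb S^1$ with $\mathbb R/2\pi\mathbb Z$. A neighbourhood of the direction $\theta$ is a subset of $\mathbb C^*$ containing a sector $\{re^{i\eta}:0<r<\varepsilon,\ |\eta-\theta|<\delta\}$ with $\varepsilon,\delta>0$. For $X\subseteq\mathbb S^1$, a germ at $0$ along $X$ is given by a function on a set that is a neighbourhood of every $\theta\in X$; two functions define the same germ if for every $\theta\in X$ they agree on a neighbourhood of $\theta$. Let $\mathcal A$ be the sheaf on $\mathbb S^1$ whose stalk $\mathcal A_\theta$ consists of the germs of analytic functions $f$ having an asymptotic expansion $T_\theta f=\sum a_nX^n\in\mathbb C[[X]]$: there are a neighbourhood $V$ of $\theta$ and constants $c_N$ with $|f(z)-\sum_{n<N}a_nz^n|\le c_N|z|^N$ for all $z\in V$ and $N\in\mathbb N$. Let $\mathcal A_s\subseteq\mathcal A$ be the subsheaf of the germs for which one can take $c_N=A\,c^N\,\Gamma(1+sN)$ for some $A,c>0$, and, for $k>0$, let $\mathcal A^k\subseteq\mathcal A$ be the subsheaf of the germs with $|f(z)|\le Ae^{-b/|z|^k}$ on a neighbourhood of $\theta$, for some $A,b>0$.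 Let $\mathbb C[[X]]_s$ be the set of the series $\sum a_nX^n$ for which $\sum \frac{a_n}{\Gamma(1+sn)}X^n$ converges near $0$. For $k\ge1$ put $V(\theta,k)=(\theta-\frac{\pi}{2k},\theta+\frac{\pi}{2k})$ and $I(\theta,k)=[\theta-\frac{\pi}{2k},\theta+\frac{\pi}{2k}]$. For distinct non-antipodal $\xi,\zeta$ let $U(\xi,\zeta)$ be the shorter open arc between $\xi$ and $\zeta$, and $U(\xi,\zeta,k)=\bigcup_{\varphi\in U(\xi,\zeta)}V(\varphi,k)$. *Summability.* A series $G\in\mathbb C[[X]]_{1/k}$ is $k$-summable in the direction $\theta$ if there is $f\in\mathcal A_{1/k}(I(\theta,k))$ with $Tf=G$ (the $k$-sum of $G$ on $I(\theta,k)$). It is $k$-summable if this holds for all but finitely many $\theta$; the exceptional directions are its singular directions. The $k$-sum $\mathcal S_{\xi,\zeta}G$ of $G$ on $U(\xi,\zeta)$ is the element of $\mathcal A_{1/k}(U(\xi,\zeta,k))$ that restricts to the $k$-sum of $G$ on $I(\varphi,k)$ for every $\varphi\in U(\xi,\zeta)$. *Multisummability.* For $k=(k_1<\dots<k_\mu)$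 with $k_1\ge 1$, a series $G\in\mathbb C[[X]]_{1/k_1}$ is $k$-summable in the direction $\theta$ if there are $f_0\in(\mathcal A/\mathcal A^{k_1})(\mathbb S^1)$ with $Tf_0=G$, $f_\lambda\in(\mathcal A/\mathcal A^{k_{\lambda+1}})(I(\theta,k_\lambda))$ for $1\le\lambda<\mu$, and $f_\mu\in\mathcal A(I(\theta,k_\mu))$, such that $f_{\lambda-1}|_{I(\theta,k_\lambda)}=f_\lambda$ modulo $\mathcal A^{k_\lambda}$ for $1\le\lambda\le\mu$; then $f_\mu$ is called the $k$-sum of $G$ on $I(\theta,k)$. The series is $k$-summable if this holds for all but finitely many $\theta$; the exceptional directions are its singular directions. The $k$-sum $\mathcal S_{\xi,\zeta}G$ of $G$ on $U(\xi,\zeta)$ is the element of $\mathcal A(U(\xi,\zeta,k_\mu))$ that restricts to the $k$-sum of $G$ on $I(\varphi,k)$ for every $\varphi\in U(\xi,\zeta)$. **Proposition.** Let $m\ge 0$, $n\ge1$, let $F\in\mathbb C[[X,\{X_{ij}\}_{1\le i\le m,1\le j\le n}]]$ be convergent with sum $\mathcal SF$, let $l\ge1$ be real, and let $H_1,\dots,H_m\in\mathbb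 C[[X]]$ be $l$-summable with $H_i(0)=0$ and with sets of singular directions $S_1,\dots,S_m$. Let $P_1,\dots,P_n\in\mathbb C[X]$ be nonzero polynomials with $P_j(0)=0$, say $P_j=c_jX^{\nu_j}+(\text{higher order terms})$ with $c_j\ne0$ and $\nu_j\ge1$. Let $k=(k_1<\dots<k_\mu)$ be the increasing list of the elements of $\{\nu_jl: 1\le j\le n\}$, and let $$S'=\{\theta\in\mathbb S^1:\ \nu_j\theta+\arg c_j\in S_i\text{ for some } i,j\}.$$ For $\theta\in\mathbb S^1$ let $\theta^+$ (respectively $\theta^-$) be the first element of $S'\cup\{\theta+\frac\pi2\}$ (respectively $S'\cup\{\theta-\frac\pi2\}$), distinct from $\theta$, that lies after $\theta$ in the positive (respectively negative) sense. Let $\Phi(X)=F(X,\{H_i(P_j(X))\})\in\mathbb C[[X]]$. Then for every $\theta\in\mathbb S^1$ and $\ast\in\{+,-\}$: 1. $\Phi$ is $k$-summable in every direction contained in $U(\theta,\theta^\ast)$; 2. for all $i,j$ the $(\nu_jl)$-sum $\mathcal S_{\theta,\theta^\ast}(H_i\circ P_j)$ of $H_i\circ P_j$ on $U(\theta,\theta^\ast)$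 exists, and the $k$-sum of $\Phi$ on $U(\theta,\theta^\ast)$ exists, is unique as a germ along $U(\theta,\theta^\ast,k_\mu)$, and is given there by $$\mathcal S_{\theta,\theta^\ast}\Phi(z)=\mathcal SF\bigl(z,\{\mathcal S_{\theta,\theta^\ast}(H_i\circ P_j)(z)\}\bigr).$$ In particular, $\Phi$ is $k$-summable, and its singular directions belong to $S'$. -/

import Mathlib

open Filter Topology

namespace Multisum

noncomputable section

/-! ### Arcs on the circle

The circle of directions is `Real.Angle`, the reals modulo `2π`. -/

/-- The open arc `V(θ,k)` with centre `θ` and length `π/k`. -/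
def openArc (θ : Real.Angle) (k : ℝ) : Set Real.Angle :=
  {η | ∃ t : ℝ, |t| < Real.pi / (2 * k) ∧ η = θ + (t : Real.Angle)}

/-- The closed arc `I(θ,k)` with centre `θ` and length `π/k`. -/
def closedArc (θ : Real.Angle) (k : ℝ) : Set Real.Angle :=
  {η | ∃ t : ℝ, |t| ≤ Real.pi / (2 * k) ∧ η = θ + (t : Real.Angle)}

/-- The open arc `U(ξ,ζ)` with endpoints `ξ` and `ζ` whose length is the distance of `ξ` and `ζ`
(meant for non-antipodal `ξ ≠ ζ`); `(ζ - ξ).toReal` is the signed length, in `(-π, π]`. -/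
def arcBetween (ξ ζ : Real.Angle) : Set Real.Angle :=
  {η | ∃ t : ℝ, 0 < t ∧ t < 1 ∧ η = ξ + ((t * (ζ - ξ).toReal : ℝ) : Real.Angle)}

/-- The arc `U(ξ,ζ,k)`, the union of the `V(φ,k)` for `φ ∈ U(ξ,ζ)`. -/
def arcBetweenThick (ξ ζ : Real.Angle) (k : ℝ) : Set Real.Angle :=
  ⋃ φ ∈ arcBetween ξ ζ, openArc φ k

/-- The direction `θ⁺(S)` (for `σ = 1`) or `θ⁻(S)` (for `σ = -1`): the first element of
`S ∪ {θ + σ π/2}`, distinct from `θ`, that one meets starting from `θ` in the sense `σ`.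
For finite `S` the infimum is a minimum. -/
def nextDir (S : Set Real.Angle) (σ : ℤˣ) (θ : Real.Angle) : Real.Angle :=
  θ + ((((σ : ℤ) : ℝ) * sInf {t : ℝ | 0 < t ∧
    (t = Real.pi / 2 ∨ θ + ((((σ : ℤ) : ℝ) * t : ℝ) : Real.Angle) ∈ S)} : ℝ) : Real.Angle)

/-! ### Germs at `0` in a direction

A germ at `0` along a set `X` of directions is given by a function `ℂ → ℂ`, only its values on
some neighbourhood of `{0} × X` in `(0,∞) × S¹` being relevant. -/

/-- The filter of the neighbourhoods of `(0,θ)` in `ℂ* = (0,∞) × S¹`: a set belongs to it iff it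
contains a sector `{r e^{iη} : 0 < r < ε, |η - θ| < δ}` for some `ε, δ > 0`. -/
def dirNhds (θ : Real.Angle) : Filter ℂ :=
  Filter.map (fun p : ℝ × Real.Angle => (p.1 : ℂ) * (p.2.toCircle : ℂ)) (𝓝[>] (0 : ℝ) ×ˢ 𝓝 θ)

/-- `f` and `g` define the same germ at `0` along `X`. -/
def EqNear (X : Set Real.Angle) (f g : ℂ → ℂ) : Prop :=
  ∀ θ ∈ X, ∀ᶠ z in dirNhds θ, f z = g z

/-- The germ of `f` in the direction `θ` is analytic. -/
def AnalyticDir (f : ℂ → ℂ) (θ : Real.Angle) : Prop :=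
  ∀ᶠ z in dirNhds θ, AnalyticAt ℂ f z

/-- The germ of `f` in the direction `θ` is in the stalk `𝒜_θ`, with `T_θ f = F`: it is analytic and
has the asymptotic expansion `F`. -/
def HasAsymp (f : ℂ → ℂ) (F : PowerSeries ℂ) (θ : Real.Angle) : Prop :=
  AnalyticDir f θ ∧ ∃ c : ℕ → ℝ, ∀ᶠ z in dirNhds θ, ∀ N : ℕ,
    ‖f z - ∑ n ∈ Finset.range N, PowerSeries.coeff n F * z ^ n‖ ≤ c N * ‖z‖ ^ N

/-- The germ of `f` in the direction `θ` is in the stalk of `𝒜_s` at `θ`, with `T_θ f = F`: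
the asymptotic expansion `F` is Gevrey of order `s`. -/
def HasGevreyAsymp (s : ℝ) (f : ℂ → ℂ) (F : PowerSeries ℂ) (θ : Real.Angle) : Prop :=
  AnalyticDir f θ ∧ ∃ A c : ℝ, 0 < A ∧ 0 < c ∧ ∀ᶠ z in dirNhds θ, ∀ N : ℕ,
    ‖f z - ∑ n ∈ Finset.range N, PowerSeries.coeff n F * z ^ n‖
      ≤ A * c ^ N * Real.Gamma (1 + s * N) * ‖z‖ ^ N

/-- The germ of `f` in the direction `θ` is in the stalk of `𝒜^k` at `θ`: it is analytic and
exponentially flat of order at least `k`. -/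
def ExpFlat (k : ℝ) (f : ℂ → ℂ) (θ : Real.Angle) : Prop :=
  AnalyticDir f θ ∧ ∃ A b : ℝ, 0 < A ∧ 0 < b ∧
    ∀ᶠ z in dirNhds θ, ‖f z‖ ≤ A * Real.exp (-b / ‖z‖ ^ k)

/-- `f` defines an element of `𝒜(X)`. -/
def IsSection (X : Set Real.Angle) (f : ℂ → ℂ) : Prop :=
  ∀ θ ∈ X, ∃ F : PowerSeries ℂ, HasAsymp f F θ

/-- `q` defines an element of `(𝒜/𝒜^k)(X)`: the germ of `q θ` in the direction `θ` represents the
value of the section in `𝒜_θ / 𝒜^k_θ`, and these values are locally induced by sections of `𝒜`. -/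
def IsQuotSection (k : ℝ) (X : Set Real.Angle) (q : Real.Angle → ℂ → ℂ) : Prop :=
  ∀ θ ∈ X, ∃ U ∈ 𝓝 θ, ∃ g : ℂ → ℂ, IsSection U g ∧
    ∀ η ∈ U ∩ X, ExpFlat k (fun z => q η z - g z) η

/-! ### Formal and convergent series -/

/-- Gevrey series of order `s`: the series `∑ aₙ / Γ(1 + n s) Xⁿ` has a positive radius of
convergence. -/
def IsGevrey (s : ℝ) (F : PowerSeries ℂ) : Prop :=
  ∃ A C : ℝ, ∀ n : ℕ, ‖PowerSeries.coeff n F‖ ≤ A * C ^ n * Real.Gamma (1 + s * n)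

/-- The power series `F` converges absolutely in some polydisc around the origin. -/
def IsConvergent {ι : Type*} (F : MvPowerSeries ι ℂ) : Prop :=
  ∃ A C : ℝ, ∀ d : ι →₀ ℕ, ‖MvPowerSeries.coeff d F‖ ≤ A * C ^ d.degree

/-- The sum of the power series `F` at the point `v`. -/
def seriesSum {ι : Type*} (F : MvPowerSeries ι ℂ) (v : ι → ℂ) : ℂ :=
  ∑' d : ι →₀ ℕ, MvPowerSeries.coeff d F * d.prod (fun i e => v i ^ e)

/-- The formal composition `F ∘ {G_{ij}} = F(X, {G_{ij}(X)})`; the variable `X` of `F` has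
index `none` and the variable `X_{ij}` has index `some (i, j)`. -/
def formalComp {m n : ℕ} (F : MvPowerSeries (Option (Fin m × Fin n)) ℂ)
    (G : Fin m → Fin n → PowerSeries ℂ) : PowerSeries ℂ :=
  MvPowerSeries.subst
    (fun o : Option (Fin m × Fin n) =>
      (o.elim PowerSeries.X (fun p => G p.1 p.2) : PowerSeries ℂ)) F

/-- The composition `z ↦ F(z, {g_{ij}(z)})` of the sum of `F` with functions `g_{ij}`. -/
def sumComp {m n : ℕ} (F : MvPowerSeries (Option (Fin m × Fin n)) ℂ)
    (g : Fin m → Fin n → ℂ → ℂ) : ℂ → ℂ :=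
  fun z => seriesSum F (fun o => o.elim z (fun p => g p.1 p.2 z))

/-! ### Summability -/

/-- `f` is the `k`-sum of `F` on `I(θ,k)`: `f ∈ 𝒜_{1/k}(I(θ,k))` and `T f = F`. -/
def IsSumInDir (k : ℝ) (F : PowerSeries ℂ) (θ : Real.Angle) (f : ℂ → ℂ) : Prop :=
  ∀ η ∈ closedArc θ k, HasGevreyAsymp (1 / k) f F η

/-- `F` is `k`-summable in the direction `θ`. -/
def SummableInDir (k : ℝ) (F : PowerSeries ℂ) (θ : Real.Angle) : Prop :=
  IsGevrey (1 / k) F ∧ ∃ f : ℂ → ℂ, IsSumInDir k F θ f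

/-- The directions in which `F` is not `k`-summable. -/
def singularDirs (k : ℝ) (F : PowerSeries ℂ) : Set Real.Angle :=
  {θ | ¬ SummableInDir k F θ}

/-- `F` is `k`-summable: it is so in all but finitely many directions. -/
def IsSummable (k : ℝ) (F : PowerSeries ℂ) : Prop :=
  (singularDirs k F).Finite

/-- `f` is the `k`-sum of `F` on `U(ξ,ζ)`: `f ∈ 𝒜_{1/k}(U(ξ,ζ,k))`, and `f` restricts to the `k`-sum
of `F` on `I(φ,k)` for each `φ ∈ U(ξ,ζ)`. -/
def IsSumOn (k : ℝ) (F : PowerSeries ℂ) (ξ ζ : Real.Angle) (f : ℂ → ℂ) : Prop :=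
  (∀ η ∈ arcBetweenThick ξ ζ k, ∃ G : PowerSeries ℂ, HasGevreyAsymp (1 / k) f G η) ∧
    ∀ φ ∈ arcBetween ξ ζ, IsSumInDir k F φ f

/-! ### Multisummability

A tuple `k₁ < ⋯ < k_μ` with `μ = N + 1` is a function `k` on `Fin (N + 1)`, with
`k_λ = k (λ - 1)`; similarly for `I₁ ⊇ ⋯ ⊇ I_μ`. -/

/-- The family `(q 0, …, q N, f)` is `(f₀, f₁, …, f_μ)`, where `(f₁, …, f_μ)` is the `k`-sum of `F`
on `(I₁, …, I_μ)`. Thus `q 0` is an element of `(𝒜/𝒜^{k₁})(S¹)` with Taylor series `F`, `q λ` is an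
element of `(𝒜/𝒜^{k_{λ+1}})(I_λ)` for `1 ≤ λ < μ`, and `f` is one of `𝒜(I_μ)`; and
`q (λ - 1)` equals `q λ` modulo `𝒜^{k_λ}` on `I_λ` for `1 ≤ λ < μ`, and
`q (μ - 1)` equals `f` modulo `𝒜^{k_μ}` on `I_μ`. -/
structure IsMultisumTuple {N : ℕ} (k : Fin (N + 1) → ℝ) (I : Fin (N + 1) → Set Real.Angle)
    (F : PowerSeries ℂ) (q : Fin (N + 1) → Real.Angle → ℂ → ℂ) (f : ℂ → ℂ) : Prop where
  zero_section : IsQuotSection (k 0) Set.univ (q 0)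
  zero_taylor : ∀ θ, HasAsymp (q 0 θ) F θ
  mid_section : ∀ i : Fin N, IsQuotSection (k i.succ) (I i.castSucc) (q i.succ)
  mid_compat : ∀ i : Fin N, ∀ θ ∈ I i.castSucc,
    ExpFlat (k i.castSucc) (fun z => q i.castSucc θ z - q i.succ θ z) θ
  last_section : IsSection (I (Fin.last N)) f
  last_compat : ∀ θ ∈ I (Fin.last N),
    ExpFlat (k (Fin.last N)) (fun z => q (Fin.last N) θ z - f z) θ

/-- `f` is the last component `f_μ` of the `k`-sum of `F` on
`I(θ,k) = (I(θ,k₁), …, I(θ,k_μ))`. -/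
def IsMultisumInDir {N : ℕ} (k : Fin (N + 1) → ℝ) (F : PowerSeries ℂ) (θ : Real.Angle)
    (f : ℂ → ℂ) : Prop :=
  ∃ q : Fin (N + 1) → Real.Angle → ℂ → ℂ,
    IsMultisumTuple k (fun i => closedArc θ (k i)) F q f

/-- `F` is `k`-summable in the direction `θ`, for a tuple `k`. -/
def MultisummableInDir {N : ℕ} (k : Fin (N + 1) → ℝ) (F : PowerSeries ℂ) (θ : Real.Angle) : Prop :=
  IsGevrey (1 / k 0) F ∧ ∃ f : ℂ → ℂ, IsMultisumInDir k F θ f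

/-- The directions in which `F` is not `k`-summable, for a tuple `k`. -/
def multiSingularDirs {N : ℕ} (k : Fin (N + 1) → ℝ) (F : PowerSeries ℂ) : Set Real.Angle :=
  {θ | ¬ MultisummableInDir k F θ}

/-- `F` is `k`-summable, for a tuple `k`: it is so in all but finitely many directions. -/
def IsMultisummable {N : ℕ} (k : Fin (N + 1) → ℝ) (F : PowerSeries ℂ) : Prop :=
  (multiSingularDirs k F).Finite

/-- `f` is the `k`-sum of `F` on `U(ξ,ζ)`, for a tuple `k`: `f ∈ 𝒜(U(ξ,ζ,k_μ))`, and for each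
`φ ∈ U(ξ,ζ)`, `f` restricts to the last component of the `k`-sum of `F` on `I(φ,k)`. -/
def IsMultisumOn {N : ℕ} (k : Fin (N + 1) → ℝ) (F : PowerSeries ℂ) (ξ ζ : Real.Angle)
    (f : ℂ → ℂ) : Prop :=
  IsSection (arcBetweenThick ξ ζ (k (Fin.last N))) f ∧
    ∀ φ ∈ arcBetween ξ ζ, IsMultisumInDir k F φ f

/-! ### The series to be composed -/

/-- The composition `H ∘ P` of a power series with a polynomial (vanishing at `0`). -/
def compPoly (H : PowerSeries ℂ) (P : Polynomial ℂ) : PowerSeries ℂ :=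
  PowerSeries.subst (P : PowerSeries ℂ) H

/-- The directions `S'`: all `θ` such that for some `i`, `j` the direction
`ν_j θ + arg c_j`, into which `P_j(z) = c_j z^{ν_j} + ⋯` maps the direction `θ`, is a singular
direction of `H_i`. -/
def pulledSingularDirs {m n : ℕ} (l : ℝ) (H : Fin m → PowerSeries ℂ) (P : Fin n → Polynomial ℂ) :
    Set Real.Angle :=
  {θ | ∃ (i : Fin m) (j : Fin n),
    (P j).natTrailingDegree • θ + (Complex.arg (P j).trailingCoeff : Real.Angle)
      ∈ singularDirs l (H i)}

end

end Multisum

namespace Multisum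

/-! ### Polar coordinates and germs in a direction -/

/-! Flatness is easier to transport than Gevrey bounds. Composition with `P_j` or with the sum of
`F` respects plain asymptotic expansions (`HasAsymp.comp_eval`, `HasAsymp.seriesSum`). It also keeps
exponentially small differences exponentially small: under `P_j` the order `l` becomes `ν_j l`,
because `|P_j(z)| ≤ const · |z|^ν_j` (`ExpFlat.comp_eval`); under `F` the order is unchanged,
because its sum is Lipschitz (`ExpFlat.seriesSum_sub`). The Gevrey bounds are recovered afterwards
from the Ramis–Sibuya theorem (`IsQuotSection.hasGevreyAsymp`).

Since `H_i` has finitely many singular directions, every direction lies in the arc of some `l`-sum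
of `H_i`. Hence there are Gevrey germs with expansion `H_i` in all directions, and two of them in
the same direction differ by a flat germ of order `l`. Pulled back by `P_j` they form a section `Q i
j` over the whole circle modulo flat germs of order `ν_j l` (`exists_isQuotSum_compPoly`). Moreover
`P_j` maps an arc of opening `π/(ν_j l)` to one of opening `π/l`, so `l`-sums of `H_i` pull back to
sums of `H_i ∘ P_j`.

The component `f_λ` of the multisum of `Φ` is obtained by inserting into `F` the true sums of `H_i ∘
P_j` for the levels `ν_j l` below `k_{λ+1}` and the germs `Q i j` for the others (`levelComp`).
Freezing the direction in these germs changes them by order at least `k_{λ+1}`, so `f_λ` is a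
section modulo `𝒜^{k_{λ+1}}`. Passing from `f_{λ-1}` to `f_λ` only replaces the germs of level `k_λ`
by sums, a change of order `k_λ`. In `f_μ` everything is a true sum, which is the asserted formula
(`isMultisumInDir_sumComp`).

For uniqueness, two choices of `f_0` differ by `𝒜^{k_1}`, both being Gevrey with the same series.
The relative Watson lemma (`IsQuotSection.expFlat`) raises the order of flatness of the difference
from `k_λ` to `k_{λ+1}`, and Watson's lemma (`eqNear_zero_of_expFlat`) kills the last difference.

For the relative Watson lemma, a power map reduces to a function on a half disc with decay of order
`1` and jumps of order `κ > 1`. By Cauchy's theorem the Borel transform of the jumps is minus that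
of the boundary values. The former is entire because `κ > 1`; the latter grows at most exponentially
on the positive axis. So Cauchy's formula can be written with the jumps alone
(`HalfDiscData.formula`), as Cauchy integrals minus a Laplace integral. Their expansions cancel term
by term, and the remainders, of size `c^N N^{N/κ} |z|^N`, give decay of order `κ`. -/

/-- The point with polar coordinates `r`, `y`. -/
noncomputable def polar (r y : ℝ) : ℂ := r * Complex.exp (y * Complex.I)

lemma norm_polar (r y : ℝ) : ‖polar r y‖ = |r| := by
  simp [polar, Complex.norm_exp]

lemma norm_polar_of_pos {r : ℝ} (hr : 0 < r) (y : ℝ) : ‖polar r y‖ = r := by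
  rw [norm_polar, abs_of_pos hr]

lemma polar_ne_zero {r : ℝ} (hr : 0 < r) (y : ℝ) : polar r y ≠ 0 := by
  rw [← norm_pos_iff, norm_polar_of_pos hr]; exact hr

lemma polar_eq_toCircle (r y : ℝ) : polar r y = (r : ℂ) * ((y : Real.Angle).toCircle : ℂ) := by
  simp [polar, Real.Angle.toCircle_coe, Circle.coe_exp]

lemma nhds_angle (x : ℝ) : 𝓝 (x : Real.Angle) = Filter.map (fun y : ℝ => (y : Real.Angle)) (𝓝 x) :=
  QuotientAddGroup.nhds_eq _ x

/-- The projection from the real line to the circle maps `𝓝 x` onto the neighbourhoods of the class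
of `x`, so a direction can be handled through a real lift. The analytic estimates below use this
form. -/
lemma eventually_dirNhds_iff {x : ℝ} {p : ℂ → Prop} :
    (∀ᶠ z in dirNhds (x : Real.Angle), p z) ↔
      ∃ ε > 0, ∀ r y : ℝ, 0 < r → r < ε → |y - x| < ε → p (polar r y) := by
  have h1 : (∀ᶠ z in dirNhds (x : Real.Angle), p z) ↔
      ∀ᶠ q : ℝ × ℝ in 𝓝[>] (0 : ℝ) ×ˢ 𝓝 x, p (polar q.1 q.2) := by
    rw [dirNhds, nhds_angle, ← Filter.map_id (f := 𝓝[>] (0 : ℝ)), Filter.prod_map_map_eq,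
      Filter.map_map, Filter.eventually_map, Filter.map_id]
    simp only [polar_eq_toCircle, Function.comp, id]
  rw [h1, ((nhdsGT_basis (0 : ℝ)).prod (Metric.nhds_basis_ball (x := x))).eventually_iff]
  constructor
  · rintro ⟨⟨a, b⟩, ⟨ha, hb⟩, h⟩
    refine ⟨min a b, lt_min ha hb, fun r y h0 h1 h2 => ?_⟩
    exact @h (r, y) ⟨⟨h0, h1.trans_le (min_le_left _ _)⟩,
      by simpa [Real.dist_eq] using h2.trans_le (min_le_right _ _)⟩
  · rintro ⟨ε, hε, h⟩
    refine ⟨(ε, ε), ⟨hε, hε⟩, ?_⟩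
    rintro ⟨r, y⟩ ⟨⟨h0, h1⟩, h2⟩
    exact h r y h0 h1 (by simpa [Real.dist_eq] using h2)

lemma eventually_dirNhds_small (θ : Real.Angle) {ε : ℝ} (hε : 0 < ε) :
    ∀ᶠ z in dirNhds θ, 0 < ‖z‖ ∧ ‖z‖ < ε := by
  induction θ using Real.Angle.induction_on with
  | _ x =>
    rw [eventually_dirNhds_iff]
    refine ⟨ε, hε, fun r y h0 h1 _ => ?_⟩
    rw [norm_polar_of_pos h0]; exact ⟨h0, h1⟩

lemma eventually_nhds_eventually_dirNhds {θ : Real.Angle} {p : ℂ → Prop}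
    (h : ∀ᶠ z in dirNhds θ, p z) : ∀ᶠ η in 𝓝 θ, ∀ᶠ z in dirNhds η, p z := by
  induction θ using Real.Angle.induction_on with
  | _ x =>
    obtain ⟨ε, hε, h⟩ := eventually_dirNhds_iff.1 h
    rw [nhds_angle, Filter.eventually_map]
    filter_upwards [Metric.ball_mem_nhds x (half_pos hε)] with y hy
    rw [eventually_dirNhds_iff]
    refine ⟨ε / 2, half_pos hε, fun r t h0 h1 h2 => h r t h0 (by linarith) ?_⟩
    rw [Metric.mem_ball, Real.dist_eq] at hy
    calc |t - x| = |(t - y) + (y - x)| := by ring_nf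
      _ ≤ |t - y| + |y - x| := abs_add_le _ _
      _ < ε := by linarith

lemma AnalyticDir.eventually {f : ℂ → ℂ} {θ : Real.Angle} (h : AnalyticDir f θ) :
    ∀ᶠ η in 𝓝 θ, AnalyticDir f η :=
  eventually_nhds_eventually_dirNhds h

lemma HasAsymp.eventually {f : ℂ → ℂ} {F : PowerSeries ℂ} {θ : Real.Angle}
    (h : HasAsymp f F θ) : ∀ᶠ η in 𝓝 θ, HasAsymp f F η := by
  obtain ⟨h1, c, h2⟩ := h
  filter_upwards [h1.eventually, eventually_nhds_eventually_dirNhds h2] with η a b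
  exact ⟨a, c, b⟩

lemma HasGevreyAsymp.eventually {s : ℝ} {f : ℂ → ℂ} {F : PowerSeries ℂ} {θ : Real.Angle}
    (h : HasGevreyAsymp s f F θ) : ∀ᶠ η in 𝓝 θ, HasGevreyAsymp s f F η := by
  obtain ⟨h1, A, c, hA, hc, h2⟩ := h
  filter_upwards [h1.eventually, eventually_nhds_eventually_dirNhds h2] with η a b
  exact ⟨a, A, c, hA, hc, b⟩

lemma ExpFlat.eventually {k : ℝ} {f : ℂ → ℂ} {θ : Real.Angle}
    (h : ExpFlat k f θ) : ∀ᶠ η in 𝓝 θ, ExpFlat k f η := by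
  obtain ⟨h1, A, c, hA, hc, h2⟩ := h
  filter_upwards [h1.eventually, eventually_nhds_eventually_dirNhds h2] with η a b
  exact ⟨a, A, c, hA, hc, b⟩

/-- Analyticity needs agreement on a full neighbourhood in the plane. Polar coordinates are an open
map away from `0`, being `exp` composed with `(log r, y)`, so the sector of agreement provides one.
-/
lemma AnalyticDir.congr {f g : ℂ → ℂ} {θ : Real.Angle} (h : AnalyticDir f θ)
    (hfg : ∀ᶠ z in dirNhds θ, f z = g z) : AnalyticDir g θ := by
  induction θ using Real.Angle.induction_on with
  | _ x =>
    obtain ⟨ε, hε, h2⟩ := eventually_dirNhds_iff.1 (h.and hfg)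
    refine eventually_dirNhds_iff.2 ⟨ε, hε, fun r y h0 h1 hy => (h2 r y h0 h1 hy).1.congr ?_⟩
    -- near `polar r y` the polar coordinates vary continuously
    have hpol : 𝓝 (polar r y) ≤ Filter.map (fun q : ℝ × ℝ => polar q.1 q.2) (𝓝 (r, y)) := by
      have key : Filter.map (fun q : ℝ × ℝ => polar q.1 q.2) (𝓝 (r, y)) = 𝓝 (polar r y) := by
        have hexp : (fun q : ℝ × ℝ => polar q.1 q.2) =ᶠ[𝓝 (r, y)]
            fun q : ℝ × ℝ => Complex.exp ((Real.log q.1 : ℝ) + q.2 * Complex.I) := by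
          filter_upwards [(isOpen_Ioi.preimage continuous_fst).mem_nhds
            (show (r, y) ∈ Prod.fst ⁻¹' Set.Ioi (0 : ℝ) from h0)] with q hq
          rw [Complex.exp_add, ← Complex.ofReal_exp, Real.exp_log hq, polar]
        rw [Filter.map_congr hexp]
        have hlog : Filter.map Real.log (𝓝 r) = 𝓝 (Real.log r) := by
          exact (Real.hasStrictDerivAt_log h0.ne').map_nhds_eq (inv_ne_zero h0.ne')
        have : (fun q : ℝ × ℝ => Complex.exp ((Real.log q.1 : ℝ) + q.2 * Complex.I)) =
            Complex.exp ∘ Complex.equivRealProdCLM.symm ∘ (Prod.map Real.log id) := by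
          funext q
          simp [Complex.equivRealProdCLM_symm_apply]
        rw [this, ← Filter.map_map, ← Filter.map_map, nhds_prod_eq, ← Filter.prod_map_map_eq',
          hlog, Filter.map_id, ← nhds_prod_eq]
        have e := Complex.equivRealProdCLM.symm.toHomeomorph.map_nhds_eq (Real.log r, y)
        have e' : Filter.map (⇑Complex.equivRealProdCLM.symm) (𝓝 (Real.log r, y)) =
          𝓝 (Complex.equivRealProdCLM.symm (Real.log r, y)) := e
        rw [e']
        have := (Complex.hasStrictDerivAt_exp (Complex.equivRealProdCLM.symm (Real.log r, y)))
          |>.map_nhds_eq (Complex.exp_ne_zero _)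
        rw [this]
        congr 1
        simp only [Complex.equivRealProdCLM_symm_apply]
        rw [Complex.exp_add, ← Complex.ofReal_exp, Real.exp_log h0, polar]
      exact key.ge
    apply hpol
    rw [Filter.mem_map]
    have hopen : IsOpen {q : ℝ × ℝ | 0 < q.1 ∧ q.1 < ε ∧ |q.2 - x| < ε} := by
      have h3 : IsOpen {q : ℝ × ℝ | |q.2 - x| < ε} := isOpen_lt (by fun_prop) continuous_const
      exact (isOpen_lt continuous_const continuous_fst).inter
        ((isOpen_lt continuous_fst continuous_const).inter h3)
    filter_upwards [hopen.mem_nhds (show (r, y) ∈ _ from ⟨h0, h1, hy⟩)] with q hq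
    exact (h2 q.1 q.2 hq.1 hq.2.1 hq.2.2).2

/-! ### Algebra of flat, asymptotic and Gevrey germs -/

lemma AnalyticDir.add {f g : ℂ → ℂ} {θ : Real.Angle} (hf : AnalyticDir f θ)
    (hg : AnalyticDir g θ) : AnalyticDir (fun z => f z + g z) θ := by
  filter_upwards [hf, hg] with z h1 h2 using h1.add h2

lemma AnalyticDir.sub {f g : ℂ → ℂ} {θ : Real.Angle} (hf : AnalyticDir f θ)
    (hg : AnalyticDir g θ) : AnalyticDir (fun z => f z - g z) θ := by
  filter_upwards [hf, hg] with z h1 h2 using h1.sub h2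

lemma ExpFlat.add {k : ℝ} {f g : ℂ → ℂ} {θ : Real.Angle} (hf : ExpFlat k f θ)
    (hg : ExpFlat k g θ) : ExpFlat k (fun z => f z + g z) θ := by
  obtain ⟨hf0, A, a, hA, ha, hf⟩ := hf
  obtain ⟨hg0, B, b, hB, hb, hg⟩ := hg
  refine ⟨hf0.add hg0, A + B, min a b, by positivity, lt_min ha hb, ?_⟩
  filter_upwards [hf, hg] with z h1 h2
  have e1 : Real.exp (-a / ‖z‖ ^ k) ≤ Real.exp (-(min a b) / ‖z‖ ^ k) := by
    gcongr; exact min_le_left _ _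
  have e2 : Real.exp (-b / ‖z‖ ^ k) ≤ Real.exp (-(min a b) / ‖z‖ ^ k) := by
    gcongr; exact min_le_right _ _
  calc ‖f z + g z‖ ≤ ‖f z‖ + ‖g z‖ := norm_add_le _ _
    _ ≤ A * Real.exp (-(min a b) / ‖z‖ ^ k) + B * Real.exp (-(min a b) / ‖z‖ ^ k) := by
      gcongr
      · exact h1.trans (by gcongr)
      · exact h2.trans (by gcongr)
    _ = _ := by ring

lemma ExpFlat.neg {k : ℝ} {f : ℂ → ℂ} {θ : Real.Angle} (hf : ExpFlat k f θ) :
    ExpFlat k (fun z => -f z) θ := by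
  obtain ⟨hf0, A, a, hA, ha, hf⟩ := hf
  refine ⟨by filter_upwards [hf0] with z hz using hz.neg, A, a, hA, ha, ?_⟩
  simpa using hf

lemma ExpFlat.sub {k : ℝ} {f g : ℂ → ℂ} {θ : Real.Angle} (hf : ExpFlat k f θ)
    (hg : ExpFlat k g θ) : ExpFlat k (fun z => f z - g z) θ := by
  simpa only [sub_eq_add_neg] using hf.add hg.neg

lemma ExpFlat.congr {k : ℝ} {f g : ℂ → ℂ} {θ : Real.Angle} (hf : ExpFlat k f θ)
    (hfg : ∀ᶠ z in dirNhds θ, f z = g z) : ExpFlat k g θ := by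
  obtain ⟨hf0, A, a, hA, ha, hf⟩ := hf
  refine ⟨hf0.congr hfg, A, a, hA, ha, ?_⟩
  filter_upwards [hf, hfg] with z h1 h2
  rwa [← h2]

lemma expFlat_zero (k : ℝ) (θ : Real.Angle) : ExpFlat k (fun _ => 0) θ :=
  ⟨Filter.Eventually.of_forall fun _ => analyticAt_const, 1, 1, one_pos, one_pos,
    Filter.Eventually.of_forall fun _ => by simp only [norm_zero]; positivity⟩

lemma ExpFlat.mono {k k' : ℝ} (hkk : k' ≤ k) {f : ℂ → ℂ} {θ : Real.Angle}
    (hf : ExpFlat k f θ) : ExpFlat k' f θ := by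
  obtain ⟨hf0, A, a, hA, ha, hf⟩ := hf
  refine ⟨hf0, A, a, hA, ha, ?_⟩
  filter_upwards [hf, eventually_dirNhds_small θ one_pos] with z h1 h2
  refine h1.trans ?_
  have : ‖z‖ ^ k ≤ ‖z‖ ^ k' := Real.rpow_le_rpow_of_exponent_ge h2.1 h2.2.le hkk
  have h3 : 0 < ‖z‖ ^ k := Real.rpow_pos_of_pos h2.1 _
  gcongr A * Real.exp ?_
  rw [neg_div, neg_div]
  gcongr

lemma HasAsymp.sub {f g : ℂ → ℂ} {F G : PowerSeries ℂ} {θ : Real.Angle} (hf : HasAsymp f F θ)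
    (hg : HasAsymp g G θ) : HasAsymp (fun z => f z - g z) (F - G) θ := by
  obtain ⟨hf0, c, hf⟩ := hf
  obtain ⟨hg0, d, hg⟩ := hg
  refine ⟨hf0.sub hg0, c + d, ?_⟩
  filter_upwards [hf, hg] with z h1 h2 N
  have : f z - g z - ∑ n ∈ Finset.range N, PowerSeries.coeff n (F - G) * z ^ n =
      (f z - ∑ n ∈ Finset.range N, PowerSeries.coeff n F * z ^ n) -
      (g z - ∑ n ∈ Finset.range N, PowerSeries.coeff n G * z ^ n) := by
    simp only [map_sub, sub_mul, Finset.sum_sub_distrib]; ring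
  rw [this]
  refine (norm_sub_le _ _).trans ?_
  rw [Pi.add_apply, add_mul]
  exact add_le_add (h1 N) (h2 N)

lemma HasAsymp.congr {f g : ℂ → ℂ} {F : PowerSeries ℂ} {θ : Real.Angle} (hf : HasAsymp f F θ)
    (hfg : ∀ᶠ z in dirNhds θ, f z = g z) : HasAsymp g F θ := by
  obtain ⟨hf0, c, hf⟩ := hf
  refine ⟨hf0.congr hfg, c, ?_⟩
  filter_upwards [hf, hfg] with z h1 h2
  rwa [← h2]

lemma HasGevreyAsymp.congr {s : ℝ} {f g : ℂ → ℂ} {F : PowerSeries ℂ} {θ : Real.Angle}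
    (hf : HasGevreyAsymp s f F θ)
    (hfg : ∀ᶠ z in dirNhds θ, f z = g z) : HasGevreyAsymp s g F θ := by
  obtain ⟨hf0, A, c, hA, hc, hf⟩ := hf
  refine ⟨hf0.congr hfg, A, c, hA, hc, ?_⟩
  filter_upwards [hf, hfg] with z h1 h2
  rwa [← h2]

lemma HasGevreyAsymp.hasAsymp {s : ℝ} {f : ℂ → ℂ} {F : PowerSeries ℂ} {θ : Real.Angle}
    (hf : HasGevreyAsymp s f F θ) : HasAsymp f F θ := by
  obtain ⟨hf0, A, c, hA, hc, hf⟩ := hf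
  exact ⟨hf0, fun N => A * c ^ N * Real.Gamma (1 + s * N), hf⟩

lemma gamma_one_add_pos {s : ℝ} (hs : 0 ≤ s) (N : ℕ) : 0 < Real.Gamma (1 + s * N) :=
  Real.Gamma_pos_of_pos (by positivity)

lemma HasGevreyAsymp.neg {s : ℝ} {f : ℂ → ℂ} {F : PowerSeries ℂ}
    {θ : Real.Angle} (hf : HasGevreyAsymp s f F θ) :
    HasGevreyAsymp s (fun z => - f z) (-F) θ := by
  obtain ⟨hf0, A, a, hA, ha, hf⟩ := hf
  refine ⟨by filter_upwards [hf0] with z hz using hz.neg, A, a, hA, ha, ?_⟩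
  filter_upwards [hf] with z h1 N
  have : - f z - ∑ n ∈ Finset.range N, PowerSeries.coeff n (-F) * z ^ n =
      -(f z - ∑ n ∈ Finset.range N, PowerSeries.coeff n F * z ^ n) := by
    simp only [map_neg, neg_mul, Finset.sum_neg_distrib]; ring
  rw [this, norm_neg]
  exact h1 N

lemma HasGevreyAsymp.add {s : ℝ} (hs : 0 ≤ s) {f g : ℂ → ℂ} {F G : PowerSeries ℂ}
    {θ : Real.Angle} (hf : HasGevreyAsymp s f F θ) (hg : HasGevreyAsymp s g G θ) :
    HasGevreyAsymp s (fun z => f z + g z) (F + G) θ := by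
  obtain ⟨hf0, A, a, hA, ha, hf⟩ := hf
  obtain ⟨hg0, B, b, hB, hb, hg⟩ := hg
  refine ⟨hf0.add hg0, A + B, max a b, by positivity, lt_max_of_lt_left ha, ?_⟩
  filter_upwards [hf, hg] with z h1 h2 N
  have : f z + g z - ∑ n ∈ Finset.range N, PowerSeries.coeff n (F + G) * z ^ n =
      (f z - ∑ n ∈ Finset.range N, PowerSeries.coeff n F * z ^ n) +
      (g z - ∑ n ∈ Finset.range N, PowerSeries.coeff n G * z ^ n) := by
    simp only [map_add, add_mul, Finset.sum_add_distrib]; ring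
  rw [this]
  have hΓ := gamma_one_add_pos hs N
  calc _ ≤ _ := norm_add_le _ _
    _ ≤ A * a ^ N * Real.Gamma (1 + s * N) * ‖z‖ ^ N +
        B * b ^ N * Real.Gamma (1 + s * N) * ‖z‖ ^ N := add_le_add (h1 N) (h2 N)
    _ ≤ A * (max a b) ^ N * Real.Gamma (1 + s * N) * ‖z‖ ^ N +
        B * (max a b) ^ N * Real.Gamma (1 + s * N) * ‖z‖ ^ N := by
      gcongr
      · exact le_max_left _ _
      · exact le_max_right _ _
    _ = _ := by ring

lemma HasGevreyAsymp.sub {s : ℝ} (hs : 0 ≤ s) {f g : ℂ → ℂ} {F G : PowerSeries ℂ}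
    {θ : Real.Angle} (hf : HasGevreyAsymp s f F θ) (hg : HasGevreyAsymp s g G θ) :
    HasGevreyAsymp s (fun z => f z - g z) (F - G) θ := by
  simpa only [sub_eq_add_neg] using hf.add hs hg.neg

/-! ### Uniqueness of expansions -/

/-- Let `r` tend to `0`. This extracts a coefficient from two consecutive remainder estimates. -/
lemma eq_zero_of_forall_norm_le_mul {E : Type*} [NormedAddCommGroup E] {a : E} {b c ε : ℝ}
    (hε : 0 < ε) (h : ∀ r : ℝ, 0 < r → r < ε → ‖a‖ ≤ b + c * r) : ‖a‖ ≤ b := by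
  have ht : Tendsto (fun r : ℝ => b + c * r) (𝓝[>] 0) (𝓝 (b + c * 0)) :=
    ((continuous_const.add (continuous_const.mul continuous_id)).tendsto (0 : ℝ)).mono_left
      nhdsWithin_le_nhds
  rw [mul_zero, add_zero] at ht
  refine ge_of_tendsto ht ?_
  filter_upwards [Ioo_mem_nhdsGT hε] with r hr using h r hr.1 hr.2

lemma HasAsymp.eq_zero {F : PowerSeries ℂ} {θ : Real.Angle}
    (h : HasAsymp (fun _ => 0) F θ) : F = 0 := by
  induction θ using Real.Angle.induction_on with
  | _ x =>
  obtain ⟨-, c, h⟩ := h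
  obtain ⟨ε, hε, h⟩ := eventually_dirNhds_iff.1 h
  ext n
  induction n using Nat.strong_induction_on with
  | _ n ih =>
    rw [map_zero, ← norm_le_zero_iff]
    refine eq_zero_of_forall_norm_le_mul (c := c (n + 1)) hε fun r h0 h1 => ?_
    have := h r x h0 h1 (by simpa using hε) (n + 1)
    rw [Finset.sum_range_succ, Finset.sum_eq_zero, zero_add, zero_sub, norm_neg, norm_mul,
      norm_pow, norm_polar_of_pos h0, pow_succ, ← mul_assoc, mul_right_comm] at this
    · rw [zero_add]
      exact le_of_mul_le_mul_right this (by positivity)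
    · intro m hm
      rw [ih m (Finset.mem_range.1 hm)]; simp

lemma HasAsymp.unique {f : ℂ → ℂ} {F G : PowerSeries ℂ} {θ : Real.Angle} (hf : HasAsymp f F θ)
    (hg : HasAsymp f G θ) : F = G := by
  have := hf.sub hg
  simp only [sub_self] at this
  exact sub_eq_zero.1 this.eq_zero

/-- The term of index `n` is the difference of the remainders of orders `n` and `n + 1`; divide by
`r ^ n` and let `r` tend to `0`. -/
lemma HasGevreyAsymp.isGevrey {s : ℝ} {f : ℂ → ℂ} {F : PowerSeries ℂ} {θ : Real.Angle}
    (h : HasGevreyAsymp s f F θ) : IsGevrey s F := by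
  induction θ using Real.Angle.induction_on with
  | _ x =>
  obtain ⟨-, A, c, hA, hc, h⟩ := h
  obtain ⟨ε, hε, h⟩ := eventually_dirNhds_iff.1 h
  refine ⟨A, c, fun n => ?_⟩
  refine eq_zero_of_forall_norm_le_mul
    (c := A * c ^ (n + 1) * Real.Gamma (1 + s * (n + 1 : ℕ))) hε fun r h0 h1 => ?_
  have e1 := h r x h0 h1 (by simpa using hε) n
  have e2 := h r x h0 h1 (by simpa using hε) (n + 1)
  rw [norm_polar_of_pos h0] at e1 e2
  rw [Finset.sum_range_succ] at e2
  have e3 : ‖PowerSeries.coeff n F * polar r x ^ n‖ ≤ _ :=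
    calc _ = ‖_ - _‖ := by congr 1; ring
      _ ≤ _ := norm_sub_le _ _
      _ ≤ _ := add_le_add e1 e2
  rw [norm_mul, norm_pow, norm_polar_of_pos h0, pow_succ r, ← mul_assoc, mul_right_comm _ _ r,
    ← add_mul] at e3
  exact le_of_mul_le_mul_right e3 (by positivity)

/-! ### Flatness and Gevrey estimates -/

/-- The left side is the integral of `x ^ a e^{-t}` over `t > x`, where `x ^ a ≤ t ^ a`; so it is at
most a part of the Gamma integral. -/
lemma rpow_mul_exp_neg_le_Gamma {a x : ℝ} (ha : 0 ≤ a) (hx : 0 ≤ x) :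
    x ^ a * Real.exp (-x) ≤ Real.Gamma (1 + a) := by
  have hG : Real.Gamma (1 + a) = ∫ t in Set.Ioi (0 : ℝ), Real.exp (-t) * t ^ a := by
    rw [Real.Gamma_eq_integral (by positivity)]; simp
  have hint : MeasureTheory.IntegrableOn (fun t : ℝ => Real.exp (-t) * t ^ a) (Set.Ioi 0) := by
    simpa using Real.GammaIntegral_convergent (s := 1 + a) (by positivity)
  rw [hG]
  calc x ^ a * Real.exp (-x) = ∫ t in Set.Ioi x, Real.exp (-t) * x ^ a := by
        rw [MeasureTheory.integral_mul_const, integral_exp_neg_Ioi, mul_comm]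
    _ ≤ ∫ t in Set.Ioi x, Real.exp (-t) * t ^ a := by
        refine MeasureTheory.setIntegral_mono_on ?_
          (hint.mono_set (Set.Ioi_subset_Ioi hx)) measurableSet_Ioi ?_
        · exact (integrableOn_exp_neg_Ioi x).mul_const _
        · intro t ht
          have : x ≤ t := le_of_lt ht
          gcongr
    _ ≤ _ := by
        refine MeasureTheory.setIntegral_mono_set hint ?_
          (Set.Ioi_subset_Ioi hx).eventuallyLE
        filter_upwards [MeasureTheory.ae_restrict_mem measurableSet_Ioi] with t ht
        have : (0 : ℝ) < t := ht
        simp only [Pi.zero_apply]; positivity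

lemma rpow_mul_exp_neg_le {a x : ℝ} (ha : 0 ≤ a) (hx : 0 ≤ x) :
    x ^ a * Real.exp (-x) ≤ a ^ a := by
  rcases ha.eq_or_lt with rfl | ha
  · simp [hx]
  rcases hx.eq_or_lt with rfl | hx
  · rw [Real.zero_rpow ha.ne']; simp; positivity
  rw [Real.rpow_def_of_pos hx, Real.rpow_def_of_pos ha, ← Real.exp_add]
  apply Real.exp_le_exp.2
  have h1 : Real.log (x / a) ≤ x / a - 1 := Real.log_le_sub_one_of_pos (by positivity)
  rw [Real.log_div hx.ne' ha.ne'] at h1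
  have h2 : (Real.log x - Real.log a) * a ≤ (x / a - 1) * a := by gcongr
  have h3 : (x / a - 1) * a = x - a := by field_simp
  nlinarith

/-- Split `e^{-t}` into two equal factors: one bounds `t ^ a` by `(2a) ^ a`, the other has integral
`2`. This crude form of Stirling's bound suffices since geometric factors never matter. -/
lemma Gamma_one_add_le {a : ℝ} (ha : 0 ≤ a) :
    Real.Gamma (1 + a) ≤ 2 * (2 * a) ^ a := by
  have hG : Real.Gamma (1 + a) = ∫ t in Set.Ioi (0 : ℝ), Real.exp (-t) * t ^ a := by
    rw [Real.Gamma_eq_integral (by positivity)]; simp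
  have hint : MeasureTheory.IntegrableOn (fun t : ℝ => Real.exp (-t) * t ^ a) (Set.Ioi 0) := by
    simpa using Real.GammaIntegral_convergent (s := 1 + a) (by positivity)
  have hint2 : MeasureTheory.IntegrableOn (fun t : ℝ => Real.exp (-(1 / 2) * t)) (Set.Ioi 0) :=
    integrableOn_exp_mul_Ioi (by norm_num) 0
  rw [hG]
  calc _ ≤ ∫ t in Set.Ioi (0 : ℝ), (2 * a) ^ a * Real.exp (-(1 / 2) * t) := by
        refine MeasureTheory.setIntegral_mono_on hint (hint2.const_mul _) measurableSet_Ioi ?_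
        intro t ht
        have ht : 0 < t := ht
        have h1 := rpow_mul_exp_neg_le ha (half_pos ht).le
        have h2 : t ^ a = 2 ^ a * (t / 2) ^ a := by
          rw [← Real.mul_rpow (by norm_num) (by positivity)]; congr 1; ring
        have h3 : Real.exp (-t) = Real.exp (-(t / 2)) * Real.exp (-(1 / 2) * t) := by
          rw [← Real.exp_add]; congr 1; ring
        rw [h2, h3, Real.mul_rpow (by norm_num) ha]
        calc _ = 2 ^ a * ((t / 2) ^ a * Real.exp (-(t / 2))) * Real.exp (-(1 / 2) * t) := by ring
          _ ≤ _ := by gcongr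
    _ = _ := by
        rw [MeasureTheory.integral_const_mul, integral_exp_mul_Ioi (by norm_num)]
        simp; ring

/-- Put `x = b / r ^ k` in the hypothesis on `M`: exponential decay is traded for a power of `r`. -/
lemma exp_neg_div_rpow_le {b r a : ℝ} (hb : 0 < b) (hr : 0 < r) {k : ℝ} (hk : 0 < k)
    {M : ℝ} (hM : ∀ x : ℝ, 0 ≤ x → x ^ (a / k) * Real.exp (-x) ≤ M) :
    Real.exp (-b / r ^ k) ≤ (b ^ (-1 / k)) ^ a * M * r ^ a := by
  have h := hM (b / r ^ k) (by positivity)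
  have h1 : (b / r ^ k) ^ (a / k) = b ^ (a / k) / r ^ a := by
    rw [Real.div_rpow hb.le (by positivity), ← Real.rpow_mul hr.le, mul_div_cancel₀ _ hk.ne']
  have h2 : (b ^ (-1 / k)) ^ a = (b ^ (a / k))⁻¹ := by
    rw [← Real.rpow_mul hb.le, ← Real.rpow_neg hb.le]; congr 1; ring
  rw [h1, ← neg_div, div_mul_eq_mul_div, div_le_iff₀ (by positivity)] at h
  rw [h2, mul_assoc, ← div_eq_inv_mul, le_div_iff₀ (by positivity), mul_comm]
  exact h

/-- Together with the converse `HasGevreyAsymp.expFlat` this identifies the flat germs of order `k`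
with the Gevrey germs of order `1/k` whose expansion is zero. -/
lemma ExpFlat.hasGevreyAsymp {k : ℝ} (hk : 0 < k) {f : ℂ → ℂ} {θ : Real.Angle}
    (hf : ExpFlat k f θ) : HasGevreyAsymp (1 / k) f 0 θ := by
  obtain ⟨hf0, A, b, hA, hb, hf⟩ := hf
  refine ⟨hf0, A, b ^ (-1 / k), hA, by positivity, ?_⟩
  filter_upwards [hf, eventually_dirNhds_small θ one_pos] with z h1 h2 N
  have h3 := exp_neg_div_rpow_le hb h2.1 hk (a := N) (M := Real.Gamma (1 + N / k))
    fun x hx => rpow_mul_exp_neg_le_Gamma (by positivity) hx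
  rw [Real.rpow_natCast, Real.rpow_natCast] at h3
  simp only [map_zero, zero_mul, Finset.sum_const_zero, sub_zero]
  refine h1.trans ?_
  calc _ ≤ A * ((b ^ (-1 / k)) ^ N * Real.Gamma (1 + N / k) * ‖z‖ ^ N) := by gcongr
    _ = _ := by rw [one_div_mul_eq_div]; ring

/-- Bounds by `A c^N N^{sN} r^N` for all `N` give exponential decay. -/
lemma le_exp_of_forall_le_pow {A c s r x : ℝ} (hA : 0 ≤ A) (hc : 0 < c) (hs : 0 < s) (hr : 0 < r)
    (h : ∀ N : ℕ, x ≤ A * c ^ N * (N : ℝ) ^ (s * N) * r ^ N) :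
    x ≤ A * Real.exp 1 * Real.exp (-(Real.exp 1 * c) ^ (-1 / s) / r ^ (1 / s)) := by
  -- The integer part `N` of `y` is the last index known to satisfy `c N ^ s r ≤ 1/e`; the bound of
  -- index `N` is then `e^{-N} ≤ e · e^{-y}`.
  set y : ℝ := (Real.exp 1 * c * r) ^ (-1 / s) with hy
  have hy0 : 0 < y := by positivity
  set N := ⌊y⌋₊ with hN
  have hNy : (N : ℝ) ≤ y := Nat.floor_le hy0.le
  have h1 : c * (N : ℝ) ^ s * r ≤ Real.exp (-1) := by
    have : (N : ℝ) ^ s ≤ y ^ s := by gcongr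
    have e : y ^ s = (Real.exp 1 * c * r)⁻¹ := by
      rw [hy, ← Real.rpow_mul (by positivity), div_mul_cancel₀ _ hs.ne', Real.rpow_neg_one]
    rw [e] at this
    calc _ ≤ c * (Real.exp 1 * c * r)⁻¹ * r := by gcongr
      _ = _ := by rw [Real.exp_neg]; field_simp
  have h2 : c ^ N * (N : ℝ) ^ (s * N) * r ^ N = (c * (N : ℝ) ^ s * r) ^ N := by
    rw [Real.rpow_mul (Nat.cast_nonneg N), Real.rpow_natCast, mul_pow, mul_pow]
  have h3 : (c * (N : ℝ) ^ s * r) ^ N ≤ Real.exp 1 * Real.exp (-y) := by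
    calc _ ≤ (Real.exp (-1)) ^ N := by gcongr
      _ = Real.exp (-N) := by rw [← Real.exp_nat_mul]; ring_nf
      _ ≤ Real.exp (1 + -y) := by
        apply Real.exp_le_exp.2
        have := Nat.lt_floor_add_one y
        rw [← hN] at this; linarith
      _ = _ := Real.exp_add _ _
  have h4 : -(Real.exp 1 * c) ^ (-1 / s) / r ^ (1 / s) = -y := by
    rw [hy, Real.mul_rpow (by positivity) hr.le, neg_div, div_eq_mul_inv, ← Real.rpow_neg hr.le,
      neg_div]
  rw [h4]
  calc x ≤ A * (c ^ N * (N : ℝ) ^ (s * N) * r ^ N) := (h N).trans_eq (by ring)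
    _ ≤ A * (Real.exp 1 * Real.exp (-y)) := by rw [h2]; gcongr
    _ = _ := by ring

lemma Gamma_one_add_mul_le {s : ℝ} (hs : 0 < s) (N : ℕ) :
    Real.Gamma (1 + s * N) ≤ 2 * ((2 * s) ^ s) ^ N * (N : ℝ) ^ (s * N) := by
  refine (Gamma_one_add_le (by positivity)).trans_eq ?_
  rw [show 2 * (s * N) = (2 * s) * (N : ℝ) by ring, Real.mul_rpow (by positivity) (by positivity),
    Real.rpow_mul (by positivity), Real.rpow_natCast]
  ring

lemma HasGevreyAsymp.expFlat {k : ℝ} (hk : 0 < k) {f : ℂ → ℂ} {θ : Real.Angle}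
    (hf : HasGevreyAsymp (1 / k) f 0 θ) : ExpFlat k f θ := by
  obtain ⟨hf0, A, c, hA, hc, hf⟩ := hf
  have hs : 0 < 1 / k := by positivity
  refine ⟨hf0, A * 2 * Real.exp 1,
    (Real.exp 1 * (c * (2 * (1 / k)) ^ (1 / k))) ^ (-1 / (1 / k)), by positivity, by positivity, ?_⟩
  filter_upwards [hf, eventually_dirNhds_small θ one_pos] with z h1 h2
  have := le_exp_of_forall_le_pow (A := A * 2) (c := c * (2 * (1 / k)) ^ (1 / k)) (s := 1 / k)
    (r := ‖z‖) (x := ‖f z‖) (by positivity) (by positivity) hs h2.1 fun N => by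
      have h3 := h1 N
      simp only [map_zero, zero_mul, Finset.sum_const_zero, sub_zero] at h3
      refine h3.trans ?_
      calc _ ≤ A * c ^ N * (2 * ((2 * (1 / k)) ^ (1 / k)) ^ N * (N : ℝ) ^ ((1 / k) * N))
            * ‖z‖ ^ N := by
            gcongr; exact Gamma_one_add_mul_le hs N
        _ = _ := by rw [mul_pow]; ring
  simpa only [one_div_one_div] using this

/-! ### Cauchy's theorem on sectors -/

/-- The integral of `f` over the segment from `0` to `polar ρ y`. -/
noncomputable def rayInt (f : ℂ → ℂ) (ρ y : ℝ) : ℂ :=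
  ∫ r in (0 : ℝ)..ρ, f (polar r y) * Complex.exp (y * Complex.I)

/-- The integral of `f` over the arc of radius `ρ` between the arguments `α` and `β`. -/
noncomputable def arcInt (f : ℂ → ℂ) (ρ α β : ℝ) : ℂ :=
  ∫ y in α..β, f (polar ρ y) * (polar ρ y * Complex.I)

lemma continuous_polar_left (y : ℝ) : Continuous fun r => polar r y := by
  unfold polar; fun_prop

lemma continuous_polar_right (r : ℝ) : Continuous fun y => polar r y := by
  unfold polar; fun_prop

lemma polar_exp (x y : ℝ) : polar (Real.exp x) y = Complex.exp (x + y * Complex.I) := by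
  rw [polar, Complex.exp_add, Complex.ofReal_exp]

lemma intervalIntegrable_of_continuousOn_of_bounded {f : ℝ → ℂ} {ρ ρ' M : ℝ} (hρ : 0 < ρ)
    (hρ' : 0 < ρ') (hf : ContinuousOn f (Set.Ioc 0 ρ))
    (hM : ∀ r, 0 < r → r < ρ' → ‖f r‖ ≤ M) : IntervalIntegrable f MeasureTheory.volume 0 ρ := by
  set m := min (ρ' / 2) ρ with hm
  have hm0 : 0 < m := lt_min (half_pos hρ') hρ
  have h1 : IntervalIntegrable f MeasureTheory.volume 0 m := by
    rw [intervalIntegrable_iff_integrableOn_Ioc_of_le hm0.le]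
    refine MeasureTheory.Integrable.of_bound
      ((hf.mono (Set.Ioc_subset_Ioc_right (min_le_right _ _))).aestronglyMeasurable
        measurableSet_Ioc) M ?_
    filter_upwards [MeasureTheory.ae_restrict_mem measurableSet_Ioc] with r hr
    exact hM r hr.1 (hr.2.trans_lt ((min_le_left _ _).trans_lt (half_lt_self hρ')))
  refine h1.trans ?_
  apply ContinuousOn.intervalIntegrable
  rw [Set.uIcc_of_le (min_le_right _ _)]
  exact hf.mono fun r hr => ⟨hm0.trans_le hr.1, hr.2⟩

lemma continuousOn_ray_of_analyticAt {f : ℂ → ℂ} {ρ y : ℝ}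
    (hf : ∀ r, 0 < r → r ≤ ρ → AnalyticAt ℂ f (polar r y)) :
    ContinuousOn (fun r => f (polar r y)) (Set.Ioc 0 ρ) := by
  intro r hr
  exact (ContinuousAt.comp (f := fun r => polar r y) (hf r hr.1 hr.2).continuousAt
    (continuous_polar_left y).continuousAt).continuousWithinAt

/-- Cauchy's theorem for a sector with vertex `0`, for a function bounded near `0`. -/
theorem rayInt_add_arcInt {f : ℂ → ℂ} {ρ α β : ℝ} (hρ : 0 < ρ) (hαβ : α ≤ β)
    (hf : ∀ r y, 0 < r → r ≤ ρ → α ≤ y → y ≤ β → AnalyticAt ℂ f (polar r y))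
    {ρ' M : ℝ} (hρ' : 0 < ρ')
    (hM : ∀ r y, 0 < r → r < ρ' → α ≤ y → y ≤ β → ‖f (polar r y)‖ ≤ M) :
    rayInt f ρ α + arcInt f ρ α β = rayInt f ρ β := by
  have hM0 : 0 ≤ M := (norm_nonneg _).trans
    (hM (ρ' / 2) α (half_pos hρ') (half_lt_self hρ') le_rfl hαβ)
  have hcont : ∀ y, α ≤ y → y ≤ β → ContinuousOn (fun r => f (polar r y)) (Set.Ioc 0 ρ) :=
    fun y h1 h2 => continuousOn_ray_of_analyticAt fun r h3 h4 => hf r y h3 h4 h1 h2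
  have hint : ∀ y, α ≤ y → y ≤ β → IntervalIntegrable
      (fun r => f (polar r y) * Complex.exp (y * Complex.I)) MeasureTheory.volume 0 ρ := by
    intro y h1 h2
    refine intervalIntegrable_of_continuousOn_of_bounded hρ hρ'
      ((hcont y h1 h2).mul continuousOn_const) (M := M) fun r h3 h4 => ?_
    rw [norm_mul, Complex.norm_exp_ofReal_mul_I, mul_one]
    exact hM r y h3 h4 h1 h2
  -- Cut off the vertex at radius `ε`. The truncated sector contributes nothing, and the discarded
  -- segments and the small arc contribute at most a multiple of `ε`.
  rw [← sub_eq_zero, ← norm_le_zero_iff]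
  refine eq_zero_of_forall_norm_le_mul (c := M + M + M * |β - α|) (lt_min hρ hρ')
    fun ε h0 h1 => ?_
  have hερ : ε < ρ := h1.trans_le (min_le_left _ _)
  have hερ' : ε < ρ' := h1.trans_le (min_le_right _ _)
  have hlog : Real.log ε ≤ Real.log ρ := Real.log_le_log h0 hερ.le
  -- Cauchy on a rectangle in logarithmic coordinates
  have hrect := Complex.integral_boundary_rect_eq_zero_of_differentiableOn
    (fun ζ => f (Complex.exp ζ) * Complex.exp ζ)
    (⟨Real.log ε, α⟩ : ℂ) (⟨Real.log ρ, β⟩ : ℂ) (by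
      intro ζ hζ
      rw [Complex.mem_reProdIm, Set.uIcc_of_le hlog, Set.uIcc_of_le hαβ] at hζ
      have e : Complex.exp ζ = polar (Real.exp ζ.re) ζ.im := by
        rw [polar_exp, Complex.re_add_im]
      have h2 : AnalyticAt ℂ f (Complex.exp ζ) := by
        rw [e]
        refine hf _ _ (Real.exp_pos _) ?_ hζ.2.1 hζ.2.2
        rw [← Real.exp_log hρ]; exact Real.exp_le_exp.2 hζ.1.2
      exact ((h2.differentiableAt.comp ζ Complex.differentiableAt_exp).mul
        Complex.differentiableAt_exp).differentiableWithinAt)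
  have hside : ∀ y, α ≤ y → y ≤ β →
      (∫ x in Real.log ε..Real.log ρ, f (Complex.exp (x + y * Complex.I)) *
        Complex.exp (x + y * Complex.I)) =
      ∫ r in ε..ρ, f (polar r y) * Complex.exp (y * Complex.I) := by
    intro y h2 h3
    have := intervalIntegral.integral_deriv_smul_comp' (a := Real.log ε) (b := Real.log ρ)
      (f := Real.exp) (f' := Real.exp)
      (g := fun r => f (polar r y) * Complex.exp (y * Complex.I))
      (fun x _ => Real.hasDerivAt_exp x) Real.continuous_exp.continuousOn (by
        refine (((hcont y h2 h3).mul continuousOn_const)).mono ?_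
        rintro _ ⟨x, hx, rfl⟩
        rw [Set.uIcc_of_le hlog] at hx
        exact ⟨Real.exp_pos _, by rw [← Real.exp_log hρ]; exact Real.exp_le_exp.2 hx.2⟩)
    rw [Real.exp_log h0, Real.exp_log hρ] at this
    rw [← this]
    refine intervalIntegral.integral_congr fun x _ => ?_
    simp only [Function.comp, polar_exp, Complex.real_smul]
    rw [Complex.exp_add, Complex.ofReal_exp]; ring
  rw [hside α le_rfl hαβ, hside β hαβ le_rfl] at hrect
  have harc : ∀ r : ℝ, 0 < r → Complex.I • (∫ y in α..β,
      f (Complex.exp ((Real.log r : ℝ) + y * Complex.I)) *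
        Complex.exp ((Real.log r : ℝ) + y * Complex.I)) = arcInt f r α β := by
    intro r hr
    rw [smul_eq_mul, ← intervalIntegral.integral_const_mul]
    refine intervalIntegral.integral_congr fun y _ => ?_
    rw [← polar_exp, Real.exp_log hr]; ring
  rw [harc ε h0, harc ρ hρ] at hrect
  have hsplit : ∀ y, α ≤ y → y ≤ β → rayInt f ρ y =
      (∫ r in (0 : ℝ)..ε, f (polar r y) * Complex.exp (y * Complex.I)) +
      ∫ r in ε..ρ, f (polar r y) * Complex.exp (y * Complex.I) := by
    intro y h2 h3
    refine (intervalIntegral.integral_add_adjacent_intervals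
      ((hint y h2 h3).mono_set ?_) ((hint y h2 h3).mono_set ?_)).symm
    · rw [Set.uIcc_of_le h0.le, Set.uIcc_of_le hρ.le]; exact Set.Icc_subset_Icc_right hερ.le
    · rw [Set.uIcc_of_le hερ.le, Set.uIcc_of_le hρ.le]; exact Set.Icc_subset_Icc_left h0.le
  have hsmall : ∀ y, α ≤ y → y ≤ β →
      ‖∫ r in (0 : ℝ)..ε, f (polar r y) * Complex.exp (y * Complex.I)‖ ≤ M * ε := by
    intro y h2 h3
    have := intervalIntegral.norm_integral_le_of_norm_le_const (a := 0) (b := ε) (C := M)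
      (f := fun r => f (polar r y) * Complex.exp (y * Complex.I)) (by
        intro r hr
        rw [Set.uIoc_of_le h0.le] at hr
        rw [norm_mul, Complex.norm_exp_ofReal_mul_I, mul_one]
        exact hM r y hr.1 (hr.2.trans_lt hερ') h2 h3)
    rwa [sub_zero, abs_of_pos h0] at this
  have harcsmall : ‖arcInt f ε α β‖ ≤ M * ε * |β - α| := by
    refine intervalIntegral.norm_integral_le_of_norm_le_const fun y hy => ?_
    rw [Set.uIoc_of_le hαβ] at hy
    rw [norm_mul, norm_mul, Complex.norm_I, mul_one, norm_polar_of_pos h0]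
    gcongr
    exact hM ε y h0 hερ' hy.1.le hy.2
  rw [hsplit α le_rfl hαβ, hsplit β hαβ le_rfl]
  have : ∀ a b c d e g : ℂ, c - d + e - g = 0 → ((a + c) + e - (b + d)) = a - b + g := by
    intro a b c d e g h; linear_combination h
  rw [this _ _ _ _ _ _ hrect]
  calc _ ≤ M * ε + M * ε + M * ε * |β - α| := by
        refine (norm_add_le _ _).trans (add_le_add ((norm_sub_le _ _).trans
          (add_le_add (hsmall α le_rfl hαβ) (hsmall β hαβ le_rfl))) harcsmall)
    _ = _ := by ring

/-! ### Cauchy's formula for piecewise holomorphic functions -/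

lemma polar_add_two_pi (r y : ℝ) : polar r (y + 2 * Real.pi) = polar r y := by
  rw [polar, polar]; push_cast
  rw [add_mul, Complex.exp_add, Complex.exp_two_pi_mul_I, mul_one]

lemma polar_inj {r s x y : ℝ} (hr : 0 < r) (hs : 0 < s) (h : polar r x = polar s y)
    (hxy : |x - y| < 2 * Real.pi) : r = s ∧ x = y := by
  have h1 : r = s := by rw [← norm_polar_of_pos hr x, h, norm_polar_of_pos hs]
  refine ⟨h1, ?_⟩
  subst h1
  have h2 : Complex.exp (x * Complex.I) = Complex.exp (y * Complex.I) :=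
    mul_left_cancel₀ (Complex.ofReal_ne_zero.2 hr.ne') h
  obtain ⟨n, hn⟩ := Complex.exp_eq_exp_iff_exists_int.1 h2
  have h3 : x = y + n * (2 * Real.pi) := by
    have : ((x : ℂ)) * Complex.I = (y + n * (2 * Real.pi)) * Complex.I := by rw [hn]; ring
    have := mul_right_cancel₀ Complex.I_ne_zero this
    exact_mod_cast this
  have hpi := Real.pi_pos
  rw [h3, add_sub_cancel_left, abs_mul, abs_of_pos (by positivity : 0 < 2 * Real.pi)] at hxy
  have h4 : |(n : ℝ)| < 1 := by
    by_contra hcon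
    push Not at hcon
    nlinarith
  have h5 : n = 0 := by
    rw [← Int.abs_lt_one_iff]; exact_mod_cast h4
  rw [h3, h5]; simp

lemma arcInt_const_div_sum {n : ℕ} {θ : ℕ → ℝ} (hper : θ n = θ 0 + 2 * Real.pi) {ρ : ℝ}
    {z₀ : ℂ} (hz₀ : ‖z₀‖ < ρ) (c : ℂ) :
    ∑ j ∈ Finset.range n, arcInt (fun z => c / (z - z₀)) ρ (θ j) (θ (j + 1)) =
      2 * Real.pi * Complex.I * c := by
  have hρ : 0 < ρ := (norm_nonneg _).trans_lt hz₀
  have hne : ∀ y, polar ρ y - z₀ ≠ 0 := by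
    intro y h
    rw [sub_eq_zero] at h
    rw [← h, norm_polar_of_pos hρ] at hz₀
    exact lt_irrefl _ hz₀
  have hcont : Continuous fun y => c / (polar ρ y - z₀) * (polar ρ y * Complex.I) :=
    (continuous_const.div ((continuous_polar_right ρ).sub continuous_const) hne).mul
      ((continuous_polar_right ρ).mul continuous_const)
  have h1 : ∑ j ∈ Finset.range n, arcInt (fun z => c / (z - z₀)) ρ (θ j) (θ (j + 1)) =
      ∫ y in θ 0..θ n, c / (polar ρ y - z₀) * (polar ρ y * Complex.I) :=
    intervalIntegral.sum_integral_adjacent_intervals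
      fun j _ => hcont.intervalIntegrable _ _
  have hp : Function.Periodic (fun y => c / (polar ρ y - z₀) * (polar ρ y * Complex.I))
      (2 * Real.pi) := fun y => by simp only [polar_add_two_pi]
  rw [h1, hper, hp.intervalIntegral_add_eq (θ 0) 0, zero_add]
  have h2 := circleIntegral.integral_sub_inv_of_mem_ball (c := 0) (w := z₀) (R := ρ)
    (by simpa using hz₀)
  rw [← h2, circleIntegral, ← intervalIntegral.integral_mul_const]
  refine intervalIntegral.integral_congr fun y _ => ?_
  simp only [deriv_circleMap, circleMap, zero_add, smul_eq_mul, polar]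
  rw [div_eq_mul_inv]; ring

lemma analyticAt_dslope {f : ℂ → ℂ} {a z : ℂ} (hf : AnalyticAt ℂ f z) :
    AnalyticAt ℂ (dslope f a) z := by
  rcases eq_or_ne z a with rfl | hne
  · obtain ⟨p, hp⟩ := hf
    exact ⟨_, hp.has_fpower_series_dslope_fslope⟩
  · have h1 : AnalyticAt ℂ (fun w => (w - a)⁻¹ * (f w - f a)) z :=
      ((analyticAt_id.sub analyticAt_const).inv (sub_ne_zero.2 hne)).mul
        (hf.sub analyticAt_const)
    refine h1.congr ?_
    filter_upwards [isOpen_ne.mem_nhds hne] with w hw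
    rw [dslope_of_ne _ hw, slope, smul_eq_mul, vsub_eq_sub]

lemma half_norm_le_norm_sub {z z₀ : ℂ} (h : ‖z‖ ≤ ‖z₀‖ / 2) : ‖z₀‖ / 2 ≤ ‖z - z₀‖ := by
  have := norm_sub_norm_le z₀ z
  rw [norm_sub_rev] at this
  linarith

lemma intervalIntegrable_ray_div_sub {g : ℂ → ℂ} {ρ y C : ℝ} {z₀ : ℂ} (hρ : 0 < ρ)
    (hz₀ : z₀ ≠ 0) (hne : ∀ r, 0 < r → polar r y ≠ z₀)
    (h1 : ∀ r, 0 < r → r ≤ ρ → AnalyticAt ℂ g (polar r y))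
    (h2 : ∀ r, 0 < r → r ≤ ρ → ‖g (polar r y)‖ ≤ C) :
    IntervalIntegrable (fun r => g (polar r y) / (polar r y - z₀) *
      Complex.exp (y * Complex.I)) MeasureTheory.volume 0 ρ := by
  have hpos := norm_pos_iff.2 hz₀
  refine intervalIntegrable_of_continuousOn_of_bounded hρ (lt_min (half_pos hpos) hρ)
    (M := C / (‖z₀‖ / 2)) ?_ fun r h3 h4 => ?_
  · exact ((continuousOn_ray_of_analyticAt h1).div ((continuous_polar_left _).continuousOn.sub
      continuousOn_const) fun r hr => sub_ne_zero.2 (hne r hr.1)).mul continuousOn_const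
  · rw [norm_mul, Complex.norm_exp_ofReal_mul_I, mul_one, norm_div]
    have h5 := h2 r h3 (h4.le.trans (min_le_right _ _))
    gcongr
    · exact (norm_nonneg _).trans h5
    · exact half_norm_le_norm_sub
        (by rw [norm_polar_of_pos h3]; exact (h4.trans_le (min_le_left _ _)).le)

/-- The integral of `f` along the boundary of a sector with vertex `0`. -/
noncomputable def sectorInt (f : ℂ → ℂ) (ρ α β : ℝ) : ℂ :=
  rayInt f ρ α + arcInt f ρ α β - rayInt f ρ β

lemma sectorInt_congr {f g : ℂ → ℂ} {ρ α β : ℝ} (hρ : 0 < ρ) (hαβ : α ≤ β)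
    (h1 : ∀ r, 0 < r → r ≤ ρ → f (polar r α) = g (polar r α))
    (h2 : ∀ r, 0 < r → r ≤ ρ → f (polar r β) = g (polar r β))
    (h3 : ∀ y, α ≤ y → y ≤ β → f (polar ρ y) = g (polar ρ y)) :
    sectorInt f ρ α β = sectorInt g ρ α β := by
  have e1 : ∀ y, (∀ r, 0 < r → r ≤ ρ → f (polar r y) = g (polar r y)) →
      rayInt f ρ y = rayInt g ρ y := by
    intro y h
    refine intervalIntegral.integral_congr_ae (Filter.Eventually.of_forall fun r hr => ?_)
    rw [Set.uIoc_of_le hρ.le] at hr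
    rw [h r hr.1 hr.2]
  have e2 : arcInt f ρ α β = arcInt g ρ α β := by
    refine intervalIntegral.integral_congr_ae (Filter.Eventually.of_forall fun r hr => ?_)
    rw [Set.uIoc_of_le hαβ] at hr
    rw [h3 r hr.1.le hr.2]
  rw [sectorInt, sectorInt, e1 α h1, e1 β h2, e2]

lemma monotone_of_le_succ_lt {n : ℕ} {θ : ℕ → ℝ} (hθ : ∀ j < n, θ j ≤ θ (j + 1)) :
    ∀ {a b : ℕ}, a ≤ b → b ≤ n → θ a ≤ θ b := by
  intro a b hab
  induction b, hab using Nat.le_induction with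
  | base => intro _; exact le_rfl
  | succ b _ ih => intro hb; exact (ih (by omega)).trans (hθ b (by omega))

/-- Cauchy's formula for a bounded function which is holomorphic on each of the sectors
`θ j ≤ arg z ≤ θ (j + 1)` that make up a disc. -/
theorem sum_sectorInt_div {n : ℕ} {G : ℕ → ℂ → ℂ} {θ : ℕ → ℝ} {ρ M : ℝ}
    (hθ : ∀ j < n, θ j ≤ θ (j + 1)) (hper : θ n = θ 0 + 2 * Real.pi)
    (hG : ∀ j < n, ∀ r y, 0 < r → r ≤ ρ → θ j ≤ y → y ≤ θ (j + 1) →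
      AnalyticAt ℂ (G j) (polar r y))
    (hM : ∀ j < n, ∀ r y, 0 < r → r ≤ ρ → θ j ≤ y → y ≤ θ (j + 1) → ‖G j (polar r y)‖ ≤ M)
    {i : ℕ} (hi : i < n) {r₀ y₀ : ℝ} (hr₀ : 0 < r₀) (hr₀ρ : r₀ < ρ) (hy₀ : θ i < y₀)
    (hy₀' : y₀ < θ (i + 1)) :
    ∑ j ∈ Finset.range n,
        sectorInt (fun z => G j z / (z - polar r₀ y₀)) ρ (θ j) (θ (j + 1)) =
      2 * Real.pi * Complex.I * G i (polar r₀ y₀) := by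
  set z₀ := polar r₀ y₀ with hz₀
  -- Subtracting the same constant on every sector leaves the jumps unchanged and makes the
  -- singularity at `z₀` removable in sector `i`; the other sectors avoid `z₀`. The constant itself
  -- gives `2πi c` on the circle, its integrals along the rays cancelling.
  set c := G i z₀ with hc
  have hρ : 0 < ρ := hr₀.trans hr₀ρ
  have hpi := Real.pi_pos
  have hmono : ∀ {a b : ℕ}, a ≤ b → b ≤ n → θ a ≤ θ b := monotone_of_le_succ_lt hθ
  have hinj : ∀ r y, 0 < r → θ 0 ≤ y → y ≤ θ n → polar r y = z₀ → r = r₀ ∧ y = y₀ := by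
    intro r y hr h1 h2 h
    have h3 := hmono (Nat.zero_le i) hi.le
    have h4 := hmono (Nat.succ_le_of_lt hi) le_rfl
    refine polar_inj hr hr₀ h ?_
    rw [abs_lt]; constructor <;> linarith
  have hrayne : ∀ j ≤ n, ∀ r, 0 < r → polar r (θ j) ≠ z₀ := by
    intro j hj r hr h
    have := (hinj r (θ j) hr (hmono (Nat.zero_le j) hj) (hmono hj le_rfl) h).2
    rcases le_or_gt j i with hji | hji
    · have := hmono hji hi.le; linarith
    · have := hmono (Nat.succ_le_of_lt hji) hj; linarith
  have harcne : ∀ y, polar ρ y ≠ z₀ := by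
    intro y h
    have : ‖polar ρ y‖ = ‖z₀‖ := by rw [h]
    rw [hz₀, norm_polar_of_pos hρ, norm_polar_of_pos hr₀] at this
    linarith
  have hz₀n : ‖z₀‖ = r₀ := norm_polar_of_pos hr₀ _
  -- lower bound for the denominators near `0`
  have hden : ∀ r y, 0 < r → r < r₀ / 2 → r₀ / 2 ≤ ‖polar r y - z₀‖ := by
    intro r y h1 h2
    rw [← hz₀n]
    exact half_norm_le_norm_sub (by rw [norm_polar_of_pos h1, hz₀n]; exact h2.le)
  -- each sector contributes zero after subtracting the constant `c`
  have hzero : ∀ j < n, sectorInt (fun z => (G j z - c) / (z - z₀)) ρ (θ j) (θ (j + 1)) = 0 := by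
    intro j hj
    have hbd : ∀ r y, 0 < r → r < min (r₀ / 2) ρ → θ j ≤ y → y ≤ θ (j + 1) →
        ‖(G j (polar r y) - c) / (polar r y - z₀)‖ ≤ (M + ‖c‖) / (r₀ / 2) := by
      intro r y h1 h2 h3 h4
      rw [norm_div]
      have h5 := hM j hj r y h1 (h2.le.trans (min_le_right _ _)) h3 h4
      gcongr
      · exact (norm_nonneg _).trans ((norm_sub_le _ _).trans (add_le_add_left h5 _))
      · exact (norm_sub_le _ _).trans (add_le_add_left h5 _)
      · exact hden r y h1 (h2.trans_le (min_le_left _ _))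
    by_cases hji : j = i
    · subst hji
      have hd : ∀ z, z ≠ z₀ → (G j z - c) / (z - z₀) = dslope (G j) z₀ z := by
        intro z hz
        rw [dslope_of_ne _ hz, slope, smul_eq_mul, vsub_eq_sub, div_eq_inv_mul]
      rw [sectorInt_congr (g := dslope (G j) z₀) hρ (hθ j hj)
        (fun r h1 _ => hd _ (hrayne j hj.le r h1))
        (fun r h1 _ => hd _ (hrayne (j + 1) hj r h1)) (fun y _ _ => hd _ (harcne y)),
        sectorInt, sub_eq_zero]
      refine rayInt_add_arcInt hρ (hθ j hj)
        (fun r y h1 h2 h3 h4 => analyticAt_dslope (hG j hj r y h1 h2 h3 h4))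
        (lt_min (half_pos hr₀) hρ) (M := (M + ‖c‖) / (r₀ / 2)) fun r y h1 h2 h3 h4 => ?_
      rw [← hd]
      · exact hbd r y h1 h2 h3 h4
      · intro h
        have := hden r y h1 (h2.trans_le (min_le_left _ _))
        rw [h, sub_self, norm_zero] at this; linarith
    · rw [sectorInt, sub_eq_zero]
      refine rayInt_add_arcInt hρ (hθ j hj) (fun r y h1 h2 h3 h4 => ?_)
        (lt_min (half_pos hr₀) hρ) hbd
      refine ((hG j hj r y h1 h2 h3 h4).sub analyticAt_const).div
        (analyticAt_id.sub analyticAt_const) (sub_ne_zero.2 fun h => ?_)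
      have h5 := (hinj r y h1 ((hmono (Nat.zero_le j) hj.le).trans h3)
        (h4.trans (hmono (Nat.succ_le_of_lt hj) le_rfl)) h).2
      rcases lt_or_gt_of_ne hji with hji | hji
      · have := hmono (Nat.succ_le_of_lt hji) hi.le; rw [Nat.succ_eq_add_one] at this; linarith
      · have := hmono (Nat.succ_le_of_lt hji) hj.le; rw [Nat.succ_eq_add_one] at this; linarith
  -- linearity
  have hrayint : ∀ (g : ℂ → ℂ) (j : ℕ), j ≤ n → ∀ C : ℝ,
      (∀ r, 0 < r → r ≤ ρ → AnalyticAt ℂ g (polar r (θ j))) →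
      (∀ r, 0 < r → r ≤ ρ → ‖g (polar r (θ j))‖ ≤ C) →
      IntervalIntegrable (fun r => g (polar r (θ j)) / (polar r (θ j) - z₀) *
        Complex.exp (θ j * Complex.I)) MeasureTheory.volume 0 ρ := by
    intro g j hj C h1 h2
    exact intervalIntegrable_ray_div_sub hρ (polar_ne_zero hr₀ _) (hrayne j hj) h1 h2
  have harcint : ∀ (g : ℂ → ℂ) (j : ℕ), j < n →
      (∀ y, θ j ≤ y → y ≤ θ (j + 1) → AnalyticAt ℂ g (polar ρ y)) →
      IntervalIntegrable (fun y => g (polar ρ y) / (polar ρ y - z₀) *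
        (polar ρ y * Complex.I)) MeasureTheory.volume (θ j) (θ (j + 1)) := by
    intro g j hj h1
    apply ContinuousOn.intervalIntegrable
    rw [Set.uIcc_of_le (hθ j hj)]
    refine ContinuousOn.mul (ContinuousOn.div ?_ ((continuous_polar_right _).continuousOn.sub
      continuousOn_const) fun y _ => sub_ne_zero.2 (harcne y))
      ((continuous_polar_right _).mul continuous_const).continuousOn
    intro y hy
    exact (ContinuousAt.comp (f := fun y => polar ρ y) (h1 y hy.1 hy.2).continuousAt
      (continuous_polar_right ρ).continuousAt).continuousWithinAt
  have hlin : ∀ j < n, sectorInt (fun z => G j z / (z - z₀)) ρ (θ j) (θ (j + 1)) =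
      sectorInt (fun z => c / (z - z₀)) ρ (θ j) (θ (j + 1)) := by
    intro j hj
    rw [← sub_eq_zero, ← hzero j hj]
    have a1 : ∀ j' ≤ n, (∀ r, 0 < r → r ≤ ρ → AnalyticAt ℂ (G j) (polar r (θ j'))) →
        (∀ r, 0 < r → r ≤ ρ → ‖G j (polar r (θ j'))‖ ≤ M) →
        rayInt (fun z => (G j z - c) / (z - z₀)) ρ (θ j') =
          rayInt (fun z => G j z / (z - z₀)) ρ (θ j') -
          rayInt (fun z => c / (z - z₀)) ρ (θ j') := by
      intro j' hj' h1 h2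
      rw [rayInt, rayInt, rayInt, ← intervalIntegral.integral_sub (hrayint (G j) j' hj' M h1 h2)
        (hrayint (fun _ => c) j' hj' ‖c‖ (fun _ _ _ => analyticAt_const) fun _ _ _ => le_rfl)]
      refine intervalIntegral.integral_congr fun r _ => ?_
      simp only [sub_div, sub_mul]
    have a2 : arcInt (fun z => (G j z - c) / (z - z₀)) ρ (θ j) (θ (j + 1)) =
          arcInt (fun z => G j z / (z - z₀)) ρ (θ j) (θ (j + 1)) -
          arcInt (fun z => c / (z - z₀)) ρ (θ j) (θ (j + 1)) := by
      rw [arcInt, arcInt, arcInt, ← intervalIntegral.integral_sub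
        (harcint (G j) j hj fun y h1 h2 => hG j hj ρ y hρ le_rfl h1 h2)
        (harcint (fun _ => c) j hj fun _ _ _ => analyticAt_const)]
      refine intervalIntegral.integral_congr fun r _ => ?_
      simp only [sub_div, sub_mul]
    rw [sectorInt, sectorInt, sectorInt, a2,
      a1 j hj.le (fun r h1 h2 => hG j hj r _ h1 h2 le_rfl (hθ j hj))
        (fun r h1 h2 => hM j hj r _ h1 h2 le_rfl (hθ j hj)),
      a1 (j + 1) hj (fun r h1 h2 => hG j hj r _ h1 h2 (hθ j hj) le_rfl)
        (fun r h1 h2 => hM j hj r _ h1 h2 (hθ j hj) le_rfl)]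
    ring
  rw [Finset.sum_congr rfl fun j hj => hlin j (Finset.mem_range.1 hj)]
  have hsum : ∑ j ∈ Finset.range n, sectorInt (fun z => c / (z - z₀)) ρ (θ j) (θ (j + 1)) =
      ∑ j ∈ Finset.range n, arcInt (fun z => c / (z - z₀)) ρ (θ j) (θ (j + 1)) +
      (rayInt (fun z => c / (z - z₀)) ρ (θ 0) - rayInt (fun z => c / (z - z₀)) ρ (θ n)) := by
    rw [← Finset.sum_range_sub' (fun j => rayInt (fun z => c / (z - z₀)) ρ (θ j)), ← Finset.sum_add_distrib]
    exact Finset.sum_congr rfl fun j _ => by rw [sectorInt]; ring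
  have hray : rayInt (fun z => c / (z - z₀)) ρ (θ 0) = rayInt (fun z => c / (z - z₀)) ρ (θ n) := by
    rw [hper, rayInt, rayInt]
    refine intervalIntegral.integral_congr fun r _ => ?_
    rw [polar_add_two_pi]
    congr 1
    have := polar_add_two_pi 1 (θ 0)
    simpa [polar] using this.symm
  rw [hsum, hray, sub_self, add_zero, arcInt_const_div_sum hper (by rw [hz₀n]; exact hr₀ρ)]

/-! ### Uniformity on closed sectors and partitions of arcs -/

/-- Compactness in the direction only: finitely many local constants are replaced by their maximum
and the radii by their minimum. -/
lemma exists_uniform_of_isCompact {Q : ℝ → ℝ → ℝ → Prop}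
    (hmono : ∀ C C' r y, C ≤ C' → Q C r y → Q C' r y) {K : Set ℝ} (hK : IsCompact K)
    (h : ∀ x ∈ K, ∃ C, ∃ ε > 0, ∀ r y : ℝ, 0 < r → r < ε → |y - x| < ε → Q C r y) :
    ∃ C, ∃ ρ > 0, ∀ r y : ℝ, 0 < r → r ≤ ρ → y ∈ K → Q C r y := by
  refine hK.induction_on (p := fun S => ∃ C, ∃ ρ > 0, ∀ r y : ℝ, 0 < r → r ≤ ρ → y ∈ S → Q C r y)
    ⟨0, 1, one_pos, fun _ _ _ _ h => h.elim⟩ ?_ ?_ ?_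
  · rintro S T hST ⟨C, ρ, hρ, h⟩
    exact ⟨C, ρ, hρ, fun r y h0 h1 h2 => h r y h0 h1 (hST h2)⟩
  · rintro S T ⟨C, ρ, hρ, h⟩ ⟨C', ρ', hρ', h'⟩
    refine ⟨max C C', min ρ ρ', lt_min hρ hρ', fun r y h0 h1 h2 => ?_⟩
    rcases h2 with h2 | h2
    · exact hmono _ _ _ _ (le_max_left _ _) (h r y h0 (h1.trans (min_le_left _ _)) h2)
    · exact hmono _ _ _ _ (le_max_right _ _) (h' r y h0 (h1.trans (min_le_right _ _)) h2)
  · intro x hx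
    obtain ⟨C, ε, hε, h⟩ := h x hx
    refine ⟨Metric.ball x ε, mem_nhdsWithin_of_mem_nhds (Metric.ball_mem_nhds x hε), C, ε / 2,
      half_pos hε, fun r y h0 h1 h2 => h r y h0 (by linarith) ?_⟩
    rwa [Metric.mem_ball, Real.dist_eq] at h2

lemma exists_uniform_finite {Q : ℕ → ℝ → ℝ → Prop}
    (hmono : ∀ j C C' r, C ≤ C' → Q j C r → Q j C' r) (n : ℕ)
    (h : ∀ j < n, ∃ C, ∃ ρ > 0, ∀ r : ℝ, 0 < r → r ≤ ρ → Q j C r) :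
    ∃ C, ∃ ρ > 0, ∀ j < n, ∀ r : ℝ, 0 < r → r ≤ ρ → Q j C r := by
  induction n with
  | zero => exact ⟨0, 1, one_pos, fun j hj => by omega⟩
  | succ n ih =>
    obtain ⟨C, ρ, hρ, h1⟩ := ih fun j hj => h j (by omega)
    obtain ⟨C', ρ', hρ', h2⟩ := h n (by omega)
    refine ⟨max C C', min ρ ρ', lt_min hρ hρ', fun j hj r h3 h4 => ?_⟩
    rcases Nat.lt_succ_iff_lt_or_eq.1 hj with hj | rfl
    · exact hmono _ _ _ _ (le_max_left _ _) (h1 j hj r h3 (h4.trans (min_le_left _ _)))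
    · exact hmono _ _ _ _ (le_max_right _ _) (h2 r h3 (h4.trans (min_le_right _ _)))

/-- Taking `C⁻¹` as the rate of decay makes a flatness bound monotone in a single constant, as the
uniformity lemmas require. -/
lemma mul_exp_neg_inv_div_mono {C C' x : ℝ} (hC : 0 < C) (hCC : C ≤ C') (hx : 0 ≤ x) :
    C * Real.exp (-C⁻¹ / x) ≤ C' * Real.exp (-C'⁻¹ / x) := by
  have := hC.le.trans hCC
  gcongr

lemma exists_uniform_expFlat {k : ℝ} {f : ℂ → ℂ} {α β : ℝ}
    (h : ∀ y : ℝ, α ≤ y → y ≤ β → ExpFlat k f y) :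
    ∃ C, ∃ ρ > 0, ∀ r y : ℝ, 0 < r → r ≤ ρ → α ≤ y → y ≤ β →
      0 < C ∧ AnalyticAt ℂ f (polar r y) ∧
        ‖f (polar r y)‖ ≤ C * Real.exp (-C⁻¹ / r ^ k) := by
  -- The repeated guard `0 < r` is needed because monotonicity in `C` has to hold for every real
  -- `r`.
  have key : ∃ C, ∃ ρ > 0, ∀ r y : ℝ, 0 < r → r ≤ ρ → y ∈ Set.Icc α β →
      0 < C ∧ AnalyticAt ℂ f (polar r y) ∧ (0 < r →
      ‖f (polar r y)‖ ≤ C * Real.exp (-C⁻¹ / r ^ k)) := by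
    refine exists_uniform_of_isCompact ?_ isCompact_Icc ?_
    · rintro C C' r y hCC ⟨h1, h2, h3⟩
      exact ⟨h1.trans_le hCC, h2, fun hr =>
        (h3 hr).trans (mul_exp_neg_inv_div_mono h1 hCC (by positivity))⟩
    · intro x hx
      obtain ⟨h0, A, b, hA, hb, h1⟩ := h x hx.1 hx.2
      obtain ⟨ε, hε, h2⟩ := eventually_dirNhds_iff.1 (h0.and h1)
      refine ⟨max A b⁻¹, ε, hε, fun r y h3 h4 h5 => ⟨lt_max_of_lt_left hA, (h2 r y h3 h4 h5).1,
        fun _ => (h2 r y h3 h4 h5).2.trans ?_⟩⟩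
      rw [norm_polar_of_pos h3]
      have hb' : (max A b⁻¹)⁻¹ ≤ b := by
        rw [inv_le_comm₀ (lt_max_of_lt_left hA) hb]; exact le_max_right _ _
      gcongr
      exact le_max_left _ _
  obtain ⟨C, ρ, hρ, h⟩ := key
  exact ⟨C, ρ, hρ, fun r y h0 h1 h2 h3 =>
    ⟨(h r y h0 h1 ⟨h2, h3⟩).1, (h r y h0 h1 ⟨h2, h3⟩).2.1, (h r y h0 h1 ⟨h2, h3⟩).2.2 h0⟩⟩

lemma exists_uniform_bounded {f : ℂ → ℂ} {α β : ℝ}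
    (h : ∀ y : ℝ, α ≤ y → y ≤ β → ∃ F, HasAsymp f F y) :
    ∃ C, ∃ ρ > 0, ∀ r y : ℝ, 0 < r → r ≤ ρ → α ≤ y → y ≤ β →
      AnalyticAt ℂ f (polar r y) ∧ ‖f (polar r y)‖ ≤ C := by
  have key : ∃ C, ∃ ρ > 0, ∀ r y : ℝ, 0 < r → r ≤ ρ → y ∈ Set.Icc α β →
      AnalyticAt ℂ f (polar r y) ∧ ‖f (polar r y)‖ ≤ C := by
    refine exists_uniform_of_isCompact ?_ isCompact_Icc ?_
    · rintro C C' r y hCC ⟨h2, h3⟩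
      exact ⟨h2, h3.trans hCC⟩
    · intro x hx
      obtain ⟨F, h0, c, h1⟩ := h x hx.1 hx.2
      obtain ⟨ε, hε, h2⟩ := eventually_dirNhds_iff.1 (h0.and h1)
      refine ⟨c 0, ε, hε, fun r y h3 h4 h5 => ⟨(h2 r y h3 h4 h5).1, ?_⟩⟩
      simpa using (h2 r y h3 h4 h5).2 0
  obtain ⟨C, ρ, hρ, h⟩ := key
  exact ⟨C, ρ, hρ, fun r y h0 h1 h2 h3 => h r y h0 h1 ⟨h2, h3⟩⟩

/-- An interval on which a property holds locally can be divided into equal parts, after a small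
shift, such that the property holds on each of them and a given point is the midpoint of one. -/
lemma exists_partition {L φ η : ℝ} (hL : 0 < L) (hη : |η - φ| ≤ L) {ι : Type*}
    {P : ι → ℝ → Prop} (h : ∀ y, |y - φ| ≤ L → ∃ a, ∀ᶠ y' in 𝓝 y, P a y') :
    ∃ (n i : ℕ) (s : ℝ) (a : ℕ → ι), i < n ∧ |s| ≤ L / n ∧
      η = φ - L + s + (i + 1 / 2) * (2 * L / n) ∧
      ∀ j < n, ∀ y, φ - L + s + j * (2 * L / n) ≤ y → y ≤ φ - L + s + (j + 1 : ℕ) * (2 * L / n) →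
        P (a j) y := by
  obtain ⟨δ, hδ, hleb⟩ := lebesgue_number_lemma_of_metric
    (s := Set.Icc (φ - L) (φ + L)) (c := fun a => interior {y | P a y}) isCompact_Icc
    (fun _ => isOpen_interior) (by
      intro y hy
      obtain ⟨a, ha⟩ := h y (by rw [abs_le]; constructor <;> linarith [hy.1, hy.2])
      exact Set.mem_iUnion.2 ⟨a, mem_interior_iff_mem_nhds.2 ha⟩)
  -- The width `w` is below `δ / 2` and the shift is at most `w / 2`, so each shifted piece stays in
  -- the `δ`-ball about its unshifted left end. That point lies in the interval, where the Lebesgue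
  -- number applies.
  obtain ⟨n, hn⟩ := exists_nat_gt (4 * L / δ)
  have hn0 : (0 : ℝ) < n := lt_of_le_of_lt (by positivity) hn
  have hn1 : 0 < n := by exact_mod_cast hn0
  set w := 2 * L / n with hw
  have hw0 : 0 < w := by positivity
  have hnw : n * w = 2 * L := by rw [hw]; field_simp
  have hwδ : w < δ / 2 := by
    rw [div_lt_iff₀ hδ] at hn
    rw [hw, div_lt_iff₀ hn0]; linarith
  rw [abs_le] at hη
  set p := (η - (φ - L)) / w with hp
  have hpw : p * w = η - (φ - L) := by rw [hp]; field_simp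
  have hp0 : 0 ≤ p := by rw [hp]; apply div_nonneg _ hw0.le; linarith
  have hpn : p ≤ n := by rw [hp, div_le_iff₀ hw0, hnw]; linarith
  -- If `η` is the right end point, then `p = n` and the floor would be out of range; the last piece
  -- is used instead.
  obtain ⟨i, hin, hi1, hi2⟩ : ∃ i : ℕ, i < n ∧ (i : ℝ) ≤ p ∧ p ≤ i + 1 := by
    rcases hpn.eq_or_lt with h1 | h1
    · refine ⟨n - 1, by omega, ?_, ?_⟩ <;> rw [h1, Nat.cast_sub (by omega)] <;> simp
    · refine ⟨⌊p⌋₊, (Nat.floor_lt hp0).2 h1, Nat.floor_le hp0, (Nat.lt_floor_add_one p).le⟩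
  have hj : ∀ j : ℕ, j < n → ∃ a, Metric.ball (φ - L + j * w) δ ⊆ {y | P a y} := by
    intro j hj
    have h3 : (j : ℝ) * w ≤ n * w := by gcongr
    obtain ⟨a, ha⟩ := hleb (φ - L + j * w) ⟨by nlinarith [(Nat.cast_nonneg j : (0 : ℝ) ≤ j)],
      by linarith⟩
    exact ⟨a, ha.trans interior_subset⟩
  have hι : Nonempty ι := (h φ (by simpa using hL.le)).nonempty
  choose! a ha using hj
  have hs : |(p - i - 1 / 2) * w| ≤ w / 2 := by
    rw [abs_mul, abs_of_pos hw0]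
    have : |p - i - 1 / 2| ≤ 1 / 2 := by rw [abs_le]; constructor <;> linarith
    nlinarith
  refine ⟨n, i, (p - i - 1 / 2) * w, a, hin, hs.trans_eq (by rw [hw]; ring), by linarith,
    fun j hjn y h1 h2 => ha j hjn ?_⟩
  rw [abs_le] at hs
  rw [Metric.mem_ball, Real.dist_eq, abs_lt]
  push_cast at h2
  constructor <;> linarith

/-! ### Distance from a ray -/

lemma norm_sq_polar_sub (r s x y : ℝ) :
    ‖polar r x - polar s y‖ ^ 2 = r ^ 2 + s ^ 2 - 2 * r * s * Real.cos (x - y) := by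
  rw [← Complex.normSq_eq_norm_sq, Complex.normSq_apply, Real.cos_sub]
  simp only [polar, Complex.sub_re, Complex.sub_im, Complex.re_ofReal_mul, Complex.im_ofReal_mul,
    Complex.exp_ofReal_mul_I_re, Complex.exp_ofReal_mul_I_im]
  have h1 := Real.sin_sq_add_cos_sq x
  have h2 := Real.sin_sq_add_cos_sq y
  linear_combination (r ^ 2) * h1 + (s ^ 2) * h2

/-- By the law of cosines, the distance from a point of modulus `r` to another ray is at least `r`
times the sine of the angle. If `c ^ 2 > 1` the square root is `0` and nothing is claimed. -/
lemma mul_le_norm_polar_sub {r s x y c : ℝ} (hr : 0 < r) (hs : 0 < s)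
    (hc : Real.cos (x - y) ≤ c) : Real.sqrt (1 - c ^ 2) * r ≤ ‖polar r x - polar s y‖ := by
  refine abs_le_of_sq_le_sq' ?_ (norm_nonneg _) |>.2
  rw [norm_sq_polar_sub, mul_pow]
  rcases le_or_gt 0 (1 - c ^ 2) with h | h
  · rw [Real.sq_sqrt h]
    nlinarith [mul_pos hr hs, sq_nonneg (s - c * r), mul_le_mul_of_nonneg_left hc (mul_pos hr hs).le]
  · rw [Real.sqrt_eq_zero_of_nonpos h.le]
    have := Real.cos_le_one (x - y)
    nlinarith [sq_nonneg (r - s), mul_pos hr hs]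

lemma cos_le_cos_of_abs_mem {x d : ℝ} (hd : 0 ≤ d) (h1 : d ≤ |x|) (h2 : |x| ≤ 2 * Real.pi - d) :
    Real.cos x ≤ Real.cos d := by
  rw [← Real.cos_abs x]
  rcases le_total |x| Real.pi with h | h
  · exact Real.cos_le_cos_of_nonneg_of_le_pi hd h h1
  · rw [← Real.cos_two_pi_sub]
    exact Real.cos_le_cos_of_nonneg_of_le_pi hd (by linarith) (by linarith)

/-! ### Expansion of Cauchy integrals -/

/-- Expand the Cauchy kernel as a finite geometric series in `z₀ / γ`; the remainder is `D z₀ ^ N /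
(γ ^ N (γ - z₀))`. The exponent `m + 1` in the bound on `D` pays for the denominators. -/
lemma norm_integral_div_sub_sum_le {a b : ℝ} (hab : a ≤ b) {D γ : ℝ → ℂ} {z₀ : ℂ} {c₀ : ℝ}
    (hc₀ : 0 < c₀) (hDc : ContinuousOn D (Set.Ioc a b)) (hγc : ContinuousOn γ (Set.Ioc a b))
    (hγ : ∀ s ∈ Set.Ioc a b, γ s ≠ 0) (hz₀ : ∀ s ∈ Set.Ioc a b, c₀ * ‖γ s‖ ≤ ‖γ s - z₀‖)
    (B : ℕ → ℝ) (hB : ∀ m, ∀ s ∈ Set.Ioc a b, ‖D s‖ ≤ B m * ‖γ s‖ ^ (m + 1)) (N : ℕ) :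
    ‖(∫ s in a..b, D s / (γ s - z₀)) -
        ∑ m ∈ Finset.range N, z₀ ^ m * ∫ s in a..b, D s / γ s ^ (m + 1)‖ ≤
      (b - a) * (B N / c₀) * ‖z₀‖ ^ N := by
  have hpos : ∀ s ∈ Set.Ioc a b, 0 < ‖γ s‖ := fun s hs => norm_pos_iff.2 (hγ s hs)
  have hne : ∀ s ∈ Set.Ioc a b, γ s - z₀ ≠ 0 := fun s hs =>
    norm_pos_iff.1 ((mul_pos hc₀ (hpos s hs)).trans_le (hz₀ s hs))
  have hint : ∀ (g : ℝ → ℂ) (C : ℝ), ContinuousOn g (Set.Ioc a b) →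
      (∀ s ∈ Set.Ioc a b, ‖g s‖ ≤ C) → IntervalIntegrable g MeasureTheory.volume a b := by
    intro g C h1 h2
    rw [intervalIntegrable_iff_integrableOn_Ioc_of_le hab]
    refine MeasureTheory.Integrable.of_bound (h1.aestronglyMeasurable measurableSet_Ioc) C ?_
    filter_upwards [MeasureTheory.ae_restrict_mem measurableSet_Ioc] with s hs using h2 s hs
  have hi1 : IntervalIntegrable (fun s => D s / (γ s - z₀)) MeasureTheory.volume a b := by
    refine hint _ (B 0 / c₀) (hDc.div (hγc.sub continuousOn_const) hne) fun s hs => ?_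
    have h1 := hB 0 s hs
    rw [zero_add, pow_one] at h1
    rw [norm_div, div_le_div_iff₀ (norm_pos_iff.2 (hne s hs)) hc₀]
    have h3 : 0 ≤ B 0 := le_of_mul_le_mul_right
      (by rw [zero_mul]; exact (norm_nonneg _).trans h1) (hpos s hs)
    calc _ ≤ B 0 * ‖γ s‖ * c₀ := by gcongr
      _ = B 0 * (c₀ * ‖γ s‖) := by ring
      _ ≤ _ := by gcongr; exact hz₀ s hs
  have hi2 : ∀ m : ℕ, IntervalIntegrable (fun s => z₀ ^ m * (D s / γ s ^ (m + 1)))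
      MeasureTheory.volume a b := by
    intro m
    refine (hint (fun s => D s / γ s ^ (m + 1)) (B m) (hDc.div (hγc.pow _) fun s hs => pow_ne_zero _ (hγ s hs))
      fun s hs => ?_).const_mul _
    have := pow_pos (hpos s hs) (m + 1)
    rw [norm_div, norm_pow, div_le_iff₀ this]
    exact hB m s hs
  simp_rw [← intervalIntegral.integral_const_mul]
  rw [← intervalIntegral.integral_finsetSum fun m _ => hi2 m,
    ← intervalIntegral.integral_sub hi1 (by
      simpa only [Finset.sum_fn] using IntervalIntegrable.sum _ fun m _ => hi2 m)]
  calc _ ≤ (B N / c₀ * ‖z₀‖ ^ N) * |b - a| := by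
        refine intervalIntegral.norm_integral_le_of_norm_le_const fun s hs => ?_
        rw [Set.uIoc_of_le hab] at hs
        have hγs := hγ s hs
        have hnes := hne s hs
        have e : D s / (γ s - z₀) - ∑ m ∈ Finset.range N, z₀ ^ m * (D s / γ s ^ (m + 1)) =
            D s * z₀ ^ N / (γ s ^ N * (γ s - z₀)) := by
          clear hB hi1 hi2
          induction N with
          | zero => simp
          | succ N ih =>
            rw [Finset.sum_range_succ, ← sub_sub, ih]
            field_simp
            ring
        rw [e, norm_div, norm_mul, norm_mul, norm_pow, norm_pow]
        have h5 := hpos s hs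
        have h1 := hB N s hs
        have h2 := hz₀ s hs
        rw [div_le_iff₀ (mul_pos (pow_pos h5 _) (norm_pos_iff.2 hnes))]
        have h3 : 0 ≤ B N := le_of_mul_le_mul_right
          (by rw [zero_mul]; exact (norm_nonneg _).trans h1) (pow_pos h5 (N + 1))
        calc _ ≤ B N * ‖γ s‖ ^ (N + 1) * ‖z₀‖ ^ N := by gcongr
          _ = B N / c₀ * ‖z₀‖ ^ N * (‖γ s‖ ^ N * (c₀ * ‖γ s‖)) := by
            field_simp; ring
          _ ≤ _ := by gcongr
    _ = _ := by rw [abs_of_nonneg (by linarith)]; ring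

/-! ### The Ramis–Sibuya theorem -/

/-- Half of the exponent yields `r ^ m` and the Gamma factor, the other half the one extra power of
`r` that the Cauchy kernel consumes. -/
lemma exists_exp_le_Gamma_mul_pow {b k : ℝ} (hb : 0 < b) (hk : 0 < k) :
    ∃ B > 0, ∃ c > 0, ∀ (m : ℕ) (r : ℝ), 0 < r →
      Real.exp (-b / r ^ k) ≤ B * c ^ m * Real.Gamma (1 + 1 / k * m) * r ^ (m + 1) := by
  refine ⟨(b / 2) ^ (-1 / k) * Real.Gamma (1 + 1 / k), ?_, (b / 2) ^ (-1 / k), by positivity,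
    fun m r hr => ?_⟩
  · have := Real.Gamma_pos_of_pos (show 0 < 1 + 1 / k by positivity)
    positivity
  · have h1 := exp_neg_div_rpow_le (half_pos hb) hr hk (a := (m : ℝ))
      (M := Real.Gamma (1 + m / k)) fun x hx => rpow_mul_exp_neg_le_Gamma (by positivity) hx
    have h2 := exp_neg_div_rpow_le (half_pos hb) hr hk (a := 1)
      (M := Real.Gamma (1 + 1 / k)) fun x hx => rpow_mul_exp_neg_le_Gamma (by positivity) hx
    rw [Real.rpow_one, Real.rpow_one] at h2
    rw [Real.rpow_natCast, Real.rpow_natCast] at h1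
    have e : Real.exp (-b / r ^ k) =
        Real.exp (-(b / 2) / r ^ k) * Real.exp (-(b / 2) / r ^ k) := by
      rw [← Real.exp_add]; congr 1; ring
    rw [e]
    calc _ ≤ _ := mul_le_mul h2 h1 (Real.exp_pos _).le ((Real.exp_pos _).le.trans h2)
      _ = _ := by rw [one_div_mul_eq_div]; ring

/-- The Gamma values are bounded below, so the purely geometric bounds coming from the outer circle
are also Gevrey bounds. -/
lemma exp_neg_one_le_Gamma {a : ℝ} (ha : 0 ≤ a) : 1 ≤ Real.exp 1 * Real.Gamma (1 + a) := by
  have := rpow_mul_exp_neg_le_Gamma ha zero_le_one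
  rw [Real.one_rpow, one_mul, Real.exp_neg, inv_le_iff_one_le_mul₀' (Real.exp_pos _)] at this
  exact this

/-- Each ray is traversed once in each sense by its two adjacent sectors. The index is cyclic: the
sector preceding sector `0` is sector `n - 1`, whose last ray is ray `0` turned by `2π`. -/
lemma sum_sectorInt_eq {n : ℕ} {K : ℕ → ℂ → ℂ} {θ : ℕ → ℝ} {ρ : ℝ}
    (hper : θ n = θ 0 + 2 * Real.pi) :
    ∑ j ∈ Finset.range n, sectorInt (K j) ρ (θ j) (θ (j + 1)) =
      ∑ j ∈ Finset.range n, (arcInt (K j) ρ (θ j) (θ (j + 1)) +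
        (rayInt (K j) ρ (θ j) - rayInt (K (if j = 0 then n - 1 else j - 1)) ρ (θ j))) := by
  rcases Nat.eq_zero_or_pos n with rfl | hn
  · simp
  obtain ⟨p, rfl⟩ : ∃ p, n = p + 1 := ⟨n - 1, by omega⟩
  have hray : ∀ f, rayInt f ρ (θ (p + 1)) = rayInt f ρ (θ 0) := by
    intro f
    rw [hper, rayInt, rayInt]
    refine intervalIntegral.integral_congr fun r _ => ?_
    have := polar_add_two_pi 1 (θ 0)
    simp only [polar, Complex.ofReal_one, one_mul] at this
    simp only [polar_add_two_pi, this]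
  simp only [sectorInt, Finset.sum_add_distrib, Finset.sum_sub_distrib]
  have h1 : ∑ j ∈ Finset.range (p + 1), rayInt (K j) ρ (θ (j + 1)) =
      ∑ j ∈ Finset.range (p + 1),
        rayInt (K (if j = 0 then p + 1 - 1 else j - 1)) ρ (θ j) := by
    rw [Finset.sum_range_succ, Finset.sum_range_succ', hray]
    simp
  rw [h1]; ring

/-- Let a bounded function on a punctured disc be holomorphic on `n` equal sectors and have
exponentially small jumps across the rays between them. Then it has a Gevrey expansion in the
middle of each of the sectors. -/
theorem exists_gevrey_expansion_of_sectors {n : ℕ} {G : ℕ → ℂ → ℂ} {α w ρ M C k : ℝ}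
    (hk : 0 < k) (hρ : 0 < ρ) (hw : n * w = 2 * Real.pi)
    (hG : ∀ j < n, ∀ r y, 0 < r → r ≤ ρ → α + j * w ≤ y → y ≤ α + (j + 1 : ℕ) * w →
      AnalyticAt ℂ (G j) (polar r y) ∧ ‖G j (polar r y)‖ ≤ M)
    (hC : 0 < C)
    (hD : ∀ j < n, ∀ r, 0 < r → r ≤ ρ → ‖G j (polar r (α + j * w)) -
      G (if j = 0 then n - 1 else j - 1) (polar r (α + j * w))‖ ≤ C * Real.exp (-C⁻¹ / r ^ k))
    {i : ℕ} (hi : i < n) :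
    ∃ (e : ℕ → ℂ) (A c : ℝ), 0 < A ∧ 0 < c ∧ ∀ r₀ y₀, 0 < r₀ → r₀ < ρ / 2 →
      |y₀ - (α + (i + 1 / 2) * w)| < w / 4 → ∀ N : ℕ,
        ‖G i (polar r₀ y₀) - ∑ m ∈ Finset.range N, e m * polar r₀ y₀ ^ m‖ ≤
          A * c ^ N * Real.Gamma (1 + 1 / k * N) * r₀ ^ N := by
  have hpi := Real.pi_pos
  have hn0 : (1 : ℝ) ≤ n := by exact_mod_cast (Nat.one_le_of_lt hi)
  have hw0 : 0 < w := by
    by_contra h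
    push Not at h
    nlinarith
  have hwpi : w ≤ 2 * Real.pi := by nlinarith
  set θ : ℕ → ℝ := fun j => α + j * w with hθdef
  have hθ : ∀ j, θ j ≤ θ (j + 1) := by
    intro j; simp only [hθdef]; push_cast; linarith
  have hper : θ n = θ 0 + 2 * Real.pi := by simp only [hθdef]; push_cast; linarith
  have hM0 : 0 ≤ M := (norm_nonneg _).trans
    (hG i hi ρ (θ i) hρ le_rfl le_rfl (hθ i)).2
  obtain ⟨B, hB, c₁, hc₁, hexp⟩ := exists_exp_le_Gamma_mul_pow (inv_pos.2 hC) hk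
  -- This is `sin (w / 4)`: a point within `w / 4` of the middle of a sector of opening `w` makes an
  -- angle of at least `w / 4` with every ray.
  set c₀ := Real.sqrt (1 - Real.cos (w / 4) ^ 2) with hc₀
  have hc₀pos : 0 < c₀ := by
    apply Real.sqrt_pos.2
    rw [← Real.sin_sq]
    have := Real.sin_pos_of_pos_of_lt_pi (x := w / 4) (by linarith) (by linarith)
    positivity
  set prev : ℕ → ℕ := fun j => if j = 0 then n - 1 else j - 1 with hprev
  have hprevlt : ∀ j < n, prev j < n := by
    intro j hj; simp only [hprev]; split_ifs <;> omega
  -- the functions on the ray `θ j` from both sides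
  have hprevray : ∀ j < n, ∀ r, 0 < r → r ≤ ρ → AnalyticAt ℂ (G (prev j)) (polar r (θ j)) ∧
      ‖G (prev j) (polar r (θ j))‖ ≤ M := by
    intro j hj r h1 h2
    by_cases hj0 : j = 0
    · have e : polar r (θ j) = polar r (θ n) := by
        rw [hper, polar_add_two_pi, hj0]
      have e2 : prev j + 1 = n := by simp only [hprev, hj0, if_true]; omega
      rw [e]
      refine hG (prev j) (hprevlt j hj) r (θ n) h1 h2 ?_ ?_
      · rw [← e2]; exact hθ _
      · rw [e2]
    · have e2 : prev j + 1 = j := by simp only [hprev, hj0, if_false]; omega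
      refine hG (prev j) (hprevlt j hj) r (θ j) h1 h2 ?_ ?_
      · conv_rhs => rw [← e2]
        exact hθ _
      · rw [e2]
  set Da : ℕ → ℝ → ℂ := fun j y => G j (polar ρ y) * (polar ρ y * Complex.I) with hDa
  set Dr : ℕ → ℝ → ℂ := fun j r => (G j (polar r (θ j)) - G (prev j) (polar r (θ j))) *
    Complex.exp (θ j * Complex.I) with hDr
  -- These are the coefficients produced by the geometric series in Cauchy's formula. They do not
  -- depend on `i`, so all sectors have the same expansion.
  set e : ℕ → ℂ := fun m => (2 * Real.pi * Complex.I)⁻¹ * ∑ j ∈ Finset.range n,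
    ((∫ y in θ j..θ (j + 1), Da j y / polar ρ y ^ (m + 1)) +
      ∫ r in (0 : ℝ)..ρ, Dr j r / polar r (θ j) ^ (m + 1)) with he
  set c := max ρ⁻¹ c₁ with hc
  have hc' : 0 < c := lt_max_of_lt_right hc₁
  set A := 1 + n * (w * (M * Real.exp 1 / (1 / 2)) + ρ * (C * B / c₀)) with hA
  have hAp : 0 < A := by positivity
  refine ⟨e, A, c, hAp, hc', fun r₀ y₀ hr₀ hr₀ρ hy₀ N => ?_⟩
  set z₀ := polar r₀ y₀ with hz₀
  have hz₀n : ‖z₀‖ = r₀ := norm_polar_of_pos hr₀ _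
  have hz₀0 : z₀ ≠ 0 := polar_ne_zero hr₀ _
  rw [abs_lt] at hy₀
  have hCF := sum_sectorInt_div (G := G) (θ := θ) (ρ := ρ) (M := M) (fun j _ => hθ j) hper
    (fun j hj r y h1 h2 h3 h4 => (hG j hj r y h1 h2 h3 h4).1)
    (fun j hj r y h1 h2 h3 h4 => (hG j hj r y h1 h2 h3 h4).2) hi hr₀ (by linarith : r₀ < ρ)
    (y₀ := y₀) (by simp only [hθdef]; linarith)
    (by simp only [hθdef]; push_cast; linarith)
  rw [sum_sectorInt_eq hper] at hCF
  -- distance of `z₀` from the rays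
  have hdist : ∀ j < n, ∀ r, 0 < r → c₀ * ‖polar r (θ j)‖ ≤ ‖polar r (θ j) - z₀‖ := by
    intro j hj r hr
    rw [norm_polar_of_pos hr]
    refine mul_le_norm_polar_sub hr hr₀ (cos_le_cos_of_abs_mem (by linarith) ?_ ?_)
    · rcases le_or_gt j i with h | h
      · have h' : (j : ℝ) * w ≤ i * w := by gcongr
        rw [le_abs]; right; simp only [hθdef]; linarith
      · have h' : ((i + 1 : ℕ) : ℝ) * w ≤ j * w := by gcongr; exact h
        push_cast at h'
        rw [le_abs]; left; simp only [hθdef]; linarith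
    · have h1 : ((j + 1 : ℕ) : ℝ) * w ≤ n * w := by gcongr; exact hj
      have h2 : ((i + 1 : ℕ) : ℝ) * w ≤ n * w := by gcongr; exact hi
      have h3 : (0 : ℝ) ≤ j * w := by positivity
      have h4 : (0 : ℝ) ≤ i * w := by positivity
      push_cast at h1 h2
      rw [abs_le]; simp only [hθdef]; constructor <;> linarith
  have hne : ∀ j < n, ∀ r, 0 < r → polar r (θ j) ≠ z₀ := by
    intro j hj r hr h
    have := hdist j hj r hr
    rw [h, sub_self, norm_zero, hz₀n] at this
    nlinarith
  have hterm : ∀ j ∈ Finset.range n,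
      arcInt (fun z => G j z / (z - z₀)) ρ (θ j) (θ (j + 1)) +
        (rayInt (fun z => G j z / (z - z₀)) ρ (θ j) -
          rayInt (fun z => G (prev j) z / (z - z₀)) ρ (θ j)) =
      (∫ y in θ j..θ (j + 1), Da j y / (polar ρ y - z₀)) +
        ∫ r in (0 : ℝ)..ρ, Dr j r / (polar r (θ j) - z₀) := by
    intro j hj
    have hj := Finset.mem_range.1 hj
    congr 1
    · rw [arcInt]
      refine intervalIntegral.integral_congr fun y _ => ?_
      simp only [hDa]; ring
    · rw [rayInt, rayInt, ← intervalIntegral.integral_sub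
        (intervalIntegrable_ray_div_sub hρ hz₀0 (hne j hj)
          (fun r h1 h2 => (hG j hj r _ h1 h2 le_rfl (hθ j)).1)
          (fun r h1 h2 => (hG j hj r _ h1 h2 le_rfl (hθ j)).2))
        (intervalIntegrable_ray_div_sub hρ hz₀0 (hne j hj)
          (fun r h1 h2 => (hprevray j hj r h1 h2).1) (fun r h1 h2 => (hprevray j hj r h1 h2).2))]
      refine intervalIntegral.integral_congr fun y _ => ?_
      simp only [hDr]; ring
  rw [Finset.sum_congr rfl hterm] at hCF
  have hΓ := gamma_one_add_pos (s := 1 / k) (by positivity) N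
  -- the two estimates
  have harc : ∀ j < n, ‖(∫ y in θ j..θ (j + 1), Da j y / (polar ρ y - z₀)) -
      ∑ m ∈ Finset.range N, z₀ ^ m * ∫ y in θ j..θ (j + 1), Da j y / polar ρ y ^ (m + 1)‖ ≤
      w * (M * Real.exp 1 / (1 / 2)) * (c ^ N * Real.Gamma (1 + 1 / k * N) * r₀ ^ N) := by
    intro j hj
    have hcont : ContinuousOn (Da j) (Set.Ioc (θ j) (θ (j + 1))) := by
      refine ContinuousOn.mul (fun y hy => ?_)
        ((continuous_polar_right ρ).mul continuous_const).continuousOn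
      exact (ContinuousAt.comp (f := fun y => polar ρ y)
        (hG j hj ρ y hρ le_rfl hy.1.le hy.2).1.continuousAt
        (continuous_polar_right ρ).continuousAt).continuousWithinAt
    have := norm_integral_div_sub_sum_le (D := Da j) (γ := fun y => polar ρ y) (z₀ := z₀)
      (hθ j) (c₀ := 1 / 2) (by norm_num) hcont (continuous_polar_right ρ).continuousOn
      (fun y _ => polar_ne_zero hρ y) (fun y _ => by
        have := norm_sub_norm_le (polar ρ y) z₀
        rw [norm_polar_of_pos hρ, hz₀n] at this
        rw [norm_polar_of_pos hρ]; linarith)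
      (fun m => M * (ρ⁻¹) ^ m) (fun m y hy => by
        simp only [hDa]
        rw [norm_mul, norm_mul, Complex.norm_I, mul_one, norm_polar_of_pos hρ, pow_succ,
          ← mul_assoc, mul_assoc M, ← mul_pow, inv_mul_cancel₀ hρ.ne', one_pow, mul_one]
        gcongr
        exact (hG j hj ρ y hρ le_rfl hy.1.le hy.2).2) N
    rw [hz₀n] at this
    refine this.trans ?_
    have e1 : θ (j + 1) - θ j = w := by simp only [hθdef]; push_cast; ring
    rw [e1]
    have h1 := exp_neg_one_le_Gamma (a := 1 / k * N) (by positivity)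
    have h2 : (ρ⁻¹) ^ N ≤ c ^ N := by gcongr; exact le_max_left _ _
    calc _ = w * (M * 1 / (1 / 2)) * ((ρ⁻¹) ^ N * r₀ ^ N) := by ring
      _ ≤ w * (M * (Real.exp 1 * Real.Gamma (1 + 1 / k * N)) / (1 / 2)) *
          (c ^ N * r₀ ^ N) := by gcongr
      _ = _ := by ring
  have hray : ∀ j < n, ‖(∫ r in (0 : ℝ)..ρ, Dr j r / (polar r (θ j) - z₀)) -
      ∑ m ∈ Finset.range N, z₀ ^ m * ∫ r in (0 : ℝ)..ρ, Dr j r / polar r (θ j) ^ (m + 1)‖ ≤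
      ρ * (C * B / c₀) * (c ^ N * Real.Gamma (1 + 1 / k * N) * r₀ ^ N) := by
    intro j hj
    have hcont : ContinuousOn (Dr j) (Set.Ioc 0 ρ) :=
      ((continuousOn_ray_of_analyticAt fun r h1 h2 => (hG j hj r _ h1 h2 le_rfl (hθ j)).1).sub
        (continuousOn_ray_of_analyticAt fun r h1 h2 => (hprevray j hj r h1 h2).1)).mul
        continuousOn_const
    have := norm_integral_div_sub_sum_le (D := Dr j) (γ := fun r => polar r (θ j)) (z₀ := z₀)
      hρ.le hc₀pos hcont (continuous_polar_left _).continuousOn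
      (fun r hr => polar_ne_zero hr.1 _) (fun r hr => hdist j hj r hr.1)
      (fun m => C * (B * c₁ ^ m * Real.Gamma (1 + 1 / k * m))) (fun m r hr => by
        simp only [hDr]
        rw [norm_mul, Complex.norm_exp_ofReal_mul_I, mul_one, norm_polar_of_pos hr.1]
        refine (hD j hj r hr.1 hr.2).trans ?_
        rw [mul_assoc C]
        gcongr
        exact hexp m r hr.1) N
    rw [hz₀n, sub_zero] at this
    refine this.trans ?_
    have h2 : c₁ ^ N ≤ c ^ N := by gcongr; exact le_max_right _ _
    calc _ = ρ * (C * B / c₀) * (c₁ ^ N * Real.Gamma (1 + 1 / k * N) * r₀ ^ N) := by ring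
      _ ≤ _ := by gcongr
  have hfinal : G i z₀ - ∑ m ∈ Finset.range N, e m * z₀ ^ m = (2 * Real.pi * Complex.I)⁻¹ *
      ∑ j ∈ Finset.range n,
        (((∫ y in θ j..θ (j + 1), Da j y / (polar ρ y - z₀)) -
          ∑ m ∈ Finset.range N, z₀ ^ m * ∫ y in θ j..θ (j + 1), Da j y / polar ρ y ^ (m + 1)) +
        ((∫ r in (0 : ℝ)..ρ, Dr j r / (polar r (θ j) - z₀)) -
          ∑ m ∈ Finset.range N, z₀ ^ m *
            ∫ r in (0 : ℝ)..ρ, Dr j r / polar r (θ j) ^ (m + 1))) := by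
    have h1 : G i z₀ = (2 * Real.pi * Complex.I)⁻¹ * (2 * Real.pi * Complex.I * G i z₀) := by
      rw [inv_mul_cancel_left₀ Complex.two_pi_I_ne_zero]
    have h2 : ∑ m ∈ Finset.range N, e m * z₀ ^ m = (2 * Real.pi * Complex.I)⁻¹ *
        ∑ j ∈ Finset.range n, ((∑ m ∈ Finset.range N, z₀ ^ m *
          ∫ y in θ j..θ (j + 1), Da j y / polar ρ y ^ (m + 1)) +
          ∑ m ∈ Finset.range N, z₀ ^ m *
            ∫ r in (0 : ℝ)..ρ, Dr j r / polar r (θ j) ^ (m + 1)) := by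
      simp only [he, ← Finset.sum_add_distrib]
      rw [Finset.sum_comm, Finset.mul_sum]
      refine Finset.sum_congr rfl fun m _ => ?_
      rw [mul_assoc, Finset.sum_mul]
      congr 1
      refine Finset.sum_congr rfl fun j _ => ?_
      ring
    rw [h2, h1, ← hCF, ← mul_sub, ← Finset.sum_sub_distrib]
    congr 1
    refine Finset.sum_congr rfl fun j _ => ?_
    ring
  rw [hfinal, norm_mul, norm_inv]
  have h2pi : ‖(2 * Real.pi * Complex.I : ℂ)‖⁻¹ ≤ 1 := by
    apply inv_le_one_of_one_le₀
    rw [norm_mul, Complex.norm_I, norm_mul, Complex.norm_real, Real.norm_eq_abs, abs_of_pos hpi]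
    simp only [Complex.norm_ofNat, mul_one]
    linarith [Real.pi_gt_three]
  set X := c ^ N * Real.Gamma (1 + 1 / k * N) * r₀ ^ N with hX
  have hX0 : 0 ≤ X := by positivity
  calc _ ≤ 1 * ∑ j ∈ Finset.range n, (w * (M * Real.exp 1 / (1 / 2)) * X +
        ρ * (C * B / c₀) * X) := by
        gcongr ?_ * ?_
        refine (norm_sum_le _ _).trans (Finset.sum_le_sum fun j hj => ?_)
        have hj := Finset.mem_range.1 hj
        exact (norm_add_le _ _).trans (add_le_add (harc j hj) (hray j hj))
    _ = (A - 1) * X := by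
        rw [Finset.sum_const, Finset.card_range, nsmul_eq_mul, hA]; ring
    _ ≤ A * X := by gcongr; linarith
    _ = _ := by rw [hX]; ring

lemma coe_add_two_pi (x : ℝ) : ((x + 2 * Real.pi : ℝ) : Real.Angle) = x := by
  rw [Real.Angle.coe_add, Real.Angle.coe_two_pi, add_zero]

/-- **Ramis–Sibuya theorem**: a section of `𝒜/𝒜^k` over the whole circle has Gevrey
expansions. -/
theorem IsQuotSection.hasGevreyAsymp {k : ℝ} (hk : 0 < k) {q : Real.Angle → ℂ → ℂ}
    (hq : IsQuotSection k Set.univ q) {F : PowerSeries ℂ} {η : Real.Angle}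
    (hF : HasAsymp (q η) F η) : HasGevreyAsymp (1 / k) (q η) F η := by
  induction η using Real.Angle.induction_on with
  | _ x =>
  have hpi := Real.pi_pos
  -- An interval of half length `π` covers the circle exactly once. The direction is made the
  -- midpoint of a sector, where the sector estimate applies.
  obtain ⟨n, i, s, a, hin, -, hx, ha⟩ := exists_partition (φ := x) (η := x) hpi
    (by simpa using hpi.le)
    (P := fun (g : ℂ → ℂ) (y : ℝ) => (∃ F, HasAsymp g F (y : Real.Angle)) ∧
      ExpFlat k (fun z => q (y : Real.Angle) z - g z) (y : Real.Angle)) (by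
      intro y _
      obtain ⟨U, hU, g, hg, hflat⟩ := hq (y : Real.Angle) trivial
      refine ⟨g, ?_⟩
      filter_upwards [Real.Angle.continuous_coe.continuousAt.preimage_mem_nhds hU] with y' hy'
      exact ⟨hg _ hy', hflat _ ⟨hy', trivial⟩⟩)
  have hn0 : (0 : ℝ) < n := by exact_mod_cast (Nat.zero_le i).trans_lt hin
  set w := 2 * Real.pi / n with hw
  have hw0 : 0 < w := by positivity
  have hnw : n * w = 2 * Real.pi := by rw [hw]; field_simp
  set α := x - Real.pi + s with hα
  -- uniform bounds
  have hbd : ∃ M, ∃ ρ > 0, ∀ j < n, ∀ r, 0 < r → r ≤ ρ → ∀ y, α + j * w ≤ y →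
      y ≤ α + (j + 1 : ℕ) * w → AnalyticAt ℂ (a j) (polar r y) ∧ ‖a j (polar r y)‖ ≤ M := by
    refine exists_uniform_finite (Q := fun j M r => ∀ y, α + j * w ≤ y →
      y ≤ α + (j + 1 : ℕ) * w → AnalyticAt ℂ (a j) (polar r y) ∧ ‖a j (polar r y)‖ ≤ M)
      (fun j C C' r hC h y h1 h2 => ⟨(h y h1 h2).1, (h y h1 h2).2.trans hC⟩) n fun j hj => ?_
    obtain ⟨C, ρ, hρ, h⟩ := exists_uniform_bounded (f := a j) (α := α + j * w)
      (β := α + (j + 1 : ℕ) * w) fun y h1 h2 => (ha j hj y h1 h2).1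
    exact ⟨C, ρ, hρ, fun r h1 h2 y h3 h4 => h r y h1 h2 h3 h4⟩
  have hjump : ∃ C, ∃ ρ > 0, ∀ j < n, ∀ r, 0 < r → r ≤ ρ → 0 < C ∧
      (0 < r → ‖a j (polar r (α + j * w)) -
        a (if j = 0 then n - 1 else j - 1) (polar r (α + j * w))‖ ≤
        C * Real.exp (-C⁻¹ / r ^ k)) := by
    refine exists_uniform_finite (Q := fun j C r => 0 < C ∧
      (0 < r → ‖a j (polar r (α + j * w)) -
        a (if j = 0 then n - 1 else j - 1) (polar r (α + j * w))‖ ≤ C * Real.exp (-C⁻¹ / r ^ k)))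
      (fun j C C' r hC h => ⟨h.1.trans_le hC, fun hr =>
        (h.2 hr).trans (mul_exp_neg_inv_div_mono h.1 hC (by positivity))⟩) n fun j hj => ?_
    have h1 := (ha j hj (α + j * w) le_rfl (by push_cast; linarith)).2
    have h2 : ExpFlat k (fun z => q ((α + j * w : ℝ) : Real.Angle) z -
        a (if j = 0 then n - 1 else j - 1) z) ((α + j * w : ℝ) : Real.Angle) := by
      -- Ray `0` is also the closing ray of sector `n - 1`, seen with argument larger by `2π`.
      by_cases hj0 : j = 0
      · have := (ha (n - 1) (by omega) (α + n * w) (by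
          rw [Nat.cast_sub (by omega)]; push_cast; linarith)
          (by rw [Nat.sub_add_cancel (by omega)])).2
        rw [hnw, coe_add_two_pi] at this
        simpa [hj0] using this
      · have := (ha (j - 1) (by omega) (α + j * w) (by
          rw [Nat.cast_sub (by omega)]; push_cast; linarith)
          (by rw [Nat.sub_add_cancel (by omega)])).2
        simpa [hj0] using this
    have h3 := h2.sub h1
    simp only [sub_sub_sub_cancel_left] at h3
    obtain ⟨C, ρ, hρ, h⟩ := exists_uniform_expFlat (α := α + j * w) (β := α + j * w)
      (k := k) (fun y h4 h5 => by rw [le_antisymm h5 h4]; exact h3)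
    exact ⟨C, ρ, hρ, fun r h4 h5 => ⟨(h r _ h4 h5 le_rfl le_rfl).1,
      fun _ => (h r _ h4 h5 le_rfl le_rfl).2.2⟩⟩
  obtain ⟨M, ρ₁, hρ₁, hG⟩ := hbd
  obtain ⟨C, ρ₂, hρ₂, hD⟩ := hjump
  have hρ : 0 < min ρ₁ ρ₂ := lt_min hρ₁ hρ₂
  obtain ⟨e, A, c, hA, hc, hest⟩ := exists_gevrey_expansion_of_sectors (G := a) (α := α) (w := w)
    (M := M) (C := C) hk hρ hnw
    (fun j hj r y h1 h2 h3 h4 => hG j hj r h1 (h2.trans (min_le_left _ _)) y h3 h4)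
    (hD i hin _ hρ (min_le_right _ _)).1
    (fun j hj r h1 h2 => (hD j hj r h1 (h2.trans (min_le_right _ _))).2 h1) hin
  have hxi := ha i hin x (by rw [hx]; nlinarith) (by rw [hx]; push_cast; nlinarith)
  have hgev : HasGevreyAsymp (1 / k) (a i) (PowerSeries.mk e) (x : Real.Angle) := by
    obtain ⟨F', hF'⟩ := hxi.1
    refine ⟨hF'.1, A, c, hA, hc, eventually_dirNhds_iff.2 ⟨min (min ρ₁ ρ₂ / 2) (w / 4),
      lt_min (half_pos hρ) (by positivity), fun r y h1 h2 h3 N => ?_⟩⟩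
    simp only [PowerSeries.coeff_mk]
    rw [norm_polar_of_pos h1]
    refine hest r y h1 (h2.trans_le (min_le_left _ _)) ?_ N
    have e1 : α + (i + 1 / 2) * w = x := by rw [hα, ← hx]
    rw [e1]
    exact h3.trans_le (min_le_right _ _)
  -- The germ differs from its local representative by a flat germ, which is Gevrey with zero
  -- series; uniqueness of expansions then identifies the series with `F`.
  have hflat := hxi.2.hasGevreyAsymp hk
  have hsum := hflat.add (by positivity) hgev
  rw [zero_add] at hsum
  have hsum' : HasGevreyAsymp (1 / k) (q x) (PowerSeries.mk e) (x : Real.Angle) :=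
    hsum.congr (Filter.Eventually.of_forall fun z => by ring)
  rwa [← hF.unique hsum'.hasAsymp] at hsum'

/-! ### Borel and Laplace transforms along segments -/

/-- `∫ D(s) e^{t W(s)} ds`. -/
noncomputable def expInt (D W : ℝ → ℂ) (a b : ℝ) (t : ℂ) : ℂ :=
  ∫ s in a..b, D s * Complex.exp (t * W s)

lemma norm_expInt_le {D W : ℝ → ℂ} {a b M R : ℝ} (hab : a ≤ b)
    (hD : ∀ s ∈ Set.Ioc a b, ‖D s‖ ≤ M) (hW : ∀ s ∈ Set.Ioc a b, (W s).re ≤ R) {t : ℝ}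
    (ht : 0 ≤ t) : ‖expInt D W a b t‖ ≤ (b - a) * M * Real.exp (R * t) := by
  have := intervalIntegral.norm_integral_le_of_norm_le_const (a := a) (b := b)
    (C := M * Real.exp (R * t)) (f := fun s => D s * Complex.exp (t * W s)) (by
      intro s hs
      rw [Set.uIoc_of_le hab] at hs
      rw [norm_mul, Complex.norm_exp, Complex.re_ofReal_mul]
      have h1 := hD s hs
      have h2 : t * (W s).re ≤ R * t := by rw [mul_comm]; gcongr; exact hW s hs
      gcongr
      exact (norm_nonneg _).trans h1)
  rw [abs_of_nonneg (by linarith)] at this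
  exact this.trans_eq (by ring)

/-- The Laplace transform of `expInt D W a b` is a Cauchy integral. -/
lemma integral_exp_mul_expInt {D W : ℝ → ℂ} {a b M R : ℝ} (hab : a ≤ b)
    (hDc : ContinuousOn D (Set.Ioc a b)) (hWc : ContinuousOn W (Set.Ioc a b))
    (hD : ∀ s ∈ Set.Ioc a b, ‖D s‖ ≤ M) (hW : ∀ s ∈ Set.Ioc a b, (W s).re ≤ R) {w₀ : ℂ}
    (hw₀ : R < w₀.re) :
    MeasureTheory.IntegrableOn (fun t : ℝ => Complex.exp (-(w₀ * t)) * expInt D W a b t)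
      (Set.Ioi 0) ∧
    ∫ t in Set.Ioi (0 : ℝ), Complex.exp (-(w₀ * t)) * expInt D W a b t =
      ∫ s in a..b, D s / (w₀ - W s) := by
  -- Fubini is justified by the dominating function `M e^{(R - Re w₀) t}`; the inner integral in `t`
  -- is `1 / (w₀ - W s)`.
  have hM : MeasureTheory.Integrable (Function.uncurry fun s t : ℝ =>
      D s * Complex.exp ((W s - w₀) * t))
      ((MeasureTheory.volume.restrict (Set.uIoc a b)).prod
        (MeasureTheory.volume.restrict (Set.Ioi (0 : ℝ)))) := by
    rw [Set.uIoc_of_le hab]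
    have h1 : MeasureTheory.Integrable (fun z : ℝ × ℝ => M * Real.exp ((R - w₀.re) * z.2))
        ((MeasureTheory.volume.restrict (Set.Ioc a b)).prod
        (MeasureTheory.volume.restrict (Set.Ioi (0 : ℝ)))) :=
      MeasureTheory.Integrable.mul_prod (f := fun _ : ℝ => M)
        (g := fun t => Real.exp ((R - w₀.re) * t)) (MeasureTheory.integrable_const _)
        (integrableOn_exp_mul_Ioi (by linarith) 0)
    refine h1.mono' ?_ ?_
    · have m1 : MeasureTheory.AEStronglyMeasurable D
          (MeasureTheory.volume.restrict (Set.Ioc a b)) :=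
        hDc.aestronglyMeasurable measurableSet_Ioc
      have m2 : MeasureTheory.AEStronglyMeasurable W
          (MeasureTheory.volume.restrict (Set.Ioc a b)) :=
        hWc.aestronglyMeasurable measurableSet_Ioc
      refine m1.comp_fst.mul (Complex.continuous_exp.comp_aestronglyMeasurable ?_)
      refine (m2.comp_fst.sub MeasureTheory.aestronglyMeasurable_const).mul ?_
      exact (Complex.continuous_ofReal.measurable.comp measurable_snd).aestronglyMeasurable
    · rw [MeasureTheory.Measure.prod_restrict]
      filter_upwards [MeasureTheory.ae_restrict_mem (measurableSet_Ioc.prod measurableSet_Ioi)]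
        with z hz
      have ht : 0 < z.2 := hz.2
      simp only [Function.uncurry]
      rw [norm_mul, Complex.norm_exp, Complex.re_mul_ofReal, Complex.sub_re]
      have h2 := hD z.1 hz.1
      have h3 := hW z.1 hz.1
      gcongr
      exact (norm_nonneg _).trans h2
  have e : ∀ t : ℝ, (∫ s in a..b, D s * Complex.exp ((W s - w₀) * t)) =
      Complex.exp (-(w₀ * t)) * expInt D W a b t := by
    intro t
    rw [expInt, ← intervalIntegral.integral_const_mul]
    refine intervalIntegral.integral_congr fun s _ => ?_
    rw [sub_mul, sub_eq_add_neg, Complex.exp_add, mul_comm (t : ℂ)]; ring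
  constructor
  · have := hM.integral_prod_right
    refine this.congr (Filter.Eventually.of_forall fun t => ?_)
    simp only [Function.uncurry]
    rw [← e, intervalIntegral.integral_of_le hab, Set.uIoc_of_le hab]
  · have h := MeasureTheory.intervalIntegral_integral_swap hM
    rw [MeasureTheory.setIntegral_congr_fun measurableSet_Ioi fun t _ => (e t).symm, ← h]
    refine intervalIntegral.integral_congr_ae (Filter.Eventually.of_forall fun s hs => ?_)
    rw [Set.uIoc_of_le hab] at hs
    have h1 := hW s hs
    rw [MeasureTheory.integral_const_mul, integral_exp_mul_complex_Ioi (by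
      rw [Complex.sub_re]; linarith)]
    rw [Complex.ofReal_zero, mul_zero, Complex.exp_zero, ← neg_div_neg_eq, neg_neg, neg_sub,
      mul_one_div]

/-- In the applications `W` may be unbounded as the path approaches `0`. The slack `ε ‖W s‖` in the
exponent covers both the variation of `t` and the factor `W s` of the derivative. -/
lemma differentiableAt_expInt {D W : ℝ → ℂ} {a b M ε : ℝ} (hab : a ≤ b)
    (hDc : ContinuousOn D (Set.Ioc a b)) (hWc : ContinuousOn W (Set.Ioc a b)) (hε : 0 < ε)
    {t₀ : ℂ} (h : ∀ s ∈ Set.Ioc a b,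
      ‖D s‖ * Real.exp ((t₀ * W s).re + ε * ‖W s‖) ≤ M) :
    DifferentiableAt ℂ (expInt D W a b) t₀ := by
  have m1 : MeasureTheory.AEStronglyMeasurable D
      (MeasureTheory.volume.restrict (Set.uIoc a b)) := by
    rw [Set.uIoc_of_le hab]; exact hDc.aestronglyMeasurable measurableSet_Ioc
  have m2 : MeasureTheory.AEStronglyMeasurable W
      (MeasureTheory.volume.restrict (Set.uIoc a b)) := by
    rw [Set.uIoc_of_le hab]; exact hWc.aestronglyMeasurable measurableSet_Ioc
  have m3 : ∀ t : ℂ, MeasureTheory.AEStronglyMeasurable (fun s => D s * Complex.exp (t * W s))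
      (MeasureTheory.volume.restrict (Set.uIoc a b)) := fun t =>
    m1.mul (Complex.continuous_exp.comp_aestronglyMeasurable
      (MeasureTheory.aestronglyMeasurable_const.mul m2))
  have key : ∀ t ∈ Metric.ball t₀ (ε / 2), ∀ s ∈ Set.Ioc a b,
      ‖D s‖ * Real.exp ((t * W s).re) * Real.exp (ε / 2 * ‖W s‖) ≤ M := by
    intro t ht s hs
    refine le_trans ?_ (h s hs)
    rw [mul_assoc, ← Real.exp_add]
    gcongr ?_ * Real.exp ?_
    have h1 : (t * W s).re = (t₀ * W s).re + ((t - t₀) * W s).re := by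
      rw [← Complex.add_re]; congr 1; ring
    have h2 : ((t - t₀) * W s).re ≤ ε / 2 * ‖W s‖ := by
      refine (Complex.re_le_norm _).trans ?_
      rw [norm_mul]
      gcongr
      rw [Metric.mem_ball, dist_eq_norm] at ht
      exact ht.le
    linarith
  have hb0 : ∀ t ∈ Metric.ball t₀ (ε / 2), ∀ s ∈ Set.Ioc a b,
      ‖D s * Complex.exp (t * W s)‖ ≤ M := by
    intro t ht s hs
    rw [norm_mul, Complex.norm_exp]
    refine le_trans ?_ (key t ht s hs)
    apply le_mul_of_one_le_right (by positivity)
    exact Real.one_le_exp (by positivity)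
  refine (intervalIntegral.hasDerivAt_integral_of_dominated_loc_of_deriv_le
    (F := fun t s => D s * Complex.exp (t * W s))
    (F' := fun t s => D s * (Complex.exp (t * W s) * W s)) (bound := fun _ => 2 / ε * M)
    (Metric.ball_mem_nhds t₀ (half_pos hε)) (Filter.Eventually.of_forall m3) ?_ ?_ ?_
    (intervalIntegrable_const) ?_).2.differentiableAt
  · have m4 := m3 t₀
    rw [Set.uIoc_of_le hab] at m4
    rw [intervalIntegrable_iff, Set.uIoc_of_le hab]
    refine MeasureTheory.Integrable.of_bound m4 M ?_
    filter_upwards [MeasureTheory.ae_restrict_mem measurableSet_Ioc] with s hs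
    exact hb0 t₀ (Metric.mem_ball_self (half_pos hε)) s hs
  · refine ((m3 t₀).mul m2).congr (Filter.Eventually.of_forall fun s => ?_)
    simp only [Pi.mul_apply]; ring
  · refine Filter.Eventually.of_forall fun s hs t ht => ?_
    rw [Set.uIoc_of_le hab] at hs
    rw [norm_mul, norm_mul, Complex.norm_exp]
    have h1 : ‖W s‖ ≤ 2 / ε * Real.exp (ε / 2 * ‖W s‖) := by
      have := Real.add_one_le_exp (ε / 2 * ‖W s‖)
      calc ‖W s‖ = 2 / ε * (ε / 2 * ‖W s‖) := by field_simp
        _ ≤ _ := by gcongr; linarith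
    calc _ ≤ ‖D s‖ * (Real.exp (t * W s).re * (2 / ε * Real.exp (ε / 2 * ‖W s‖))) := by gcongr
      _ = 2 / ε * (‖D s‖ * Real.exp (t * W s).re * Real.exp (ε / 2 * ‖W s‖)) := by ring
      _ ≤ _ := by gcongr; exact key t ht s hs
  · refine Filter.Eventually.of_forall fun s _ t _ => ?_
    have h1 : HasDerivAt (fun t : ℂ => t * W s) (W s) t := by
      simpa using (hasDerivAt_id t).mul_const (W s)
    exact (h1.cexp).const_mul (D s)

/-! ### Elementary bounds -/

/-- A form of Young's inequality. -/
lemma mul_le_mul_rpow_add {b κ t x : ℝ} (hb : 0 < b) (hκ : 1 < κ) (ht : 0 ≤ t) (hx : 0 < x) :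
    t * x ≤ b * x ^ κ + t * (t / b) ^ (1 / (κ - 1)) := by
  have hκ' : 0 < κ - 1 := by linarith
  have hxκ : x ^ κ = x ^ (κ - 1) * x := by
    rw [Real.rpow_sub_one hx.ne', div_mul_cancel₀ _ hx.ne']
  rcases le_total t (b * x ^ (κ - 1)) with h | h
  · have : t * x ≤ b * x ^ κ := by
      rw [hxκ, ← mul_assoc]; gcongr
    have h2 : 0 ≤ t * (t / b) ^ (1 / (κ - 1)) := by positivity
    linarith
  · have h1 : x ≤ (t / b) ^ (1 / (κ - 1)) := by
      have h3 : x ^ (κ - 1) ≤ t / b := by rw [le_div_iff₀ hb]; linarith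
      calc x = (x ^ (κ - 1)) ^ (1 / (κ - 1)) := by
            rw [← Real.rpow_mul hx.le, mul_one_div_cancel hκ'.ne', Real.rpow_one]
        _ ≤ _ := by gcongr
    have h2 : 0 ≤ b * x ^ κ := by positivity
    nlinarith [mul_le_mul_of_nonneg_left h1 ht]

/-- For `κ > 1` decay of order `κ` beats `e^{T/r}` for every `T`. This makes the Borel transform of
the jumps entire. -/
lemma exists_exp_rpow_bound {b κ T : ℝ} (hb : 0 < b) (hκ : 1 < κ) (hT : 0 ≤ T) :
    ∃ M, ∀ r : ℝ, 0 < r → Real.exp (-b / r ^ κ) / r * Real.exp (T / r) ≤ M := by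
  -- Young's inequality is used with `T + 1` because `1 / r ≤ e^{1/r}` absorbs the factor `1 / r`.
  refine ⟨Real.exp ((T + 1) * ((T + 1) / b) ^ (1 / (κ - 1))), fun r hr => ?_⟩
  have h1 := mul_le_mul_rpow_add hb hκ (t := T + 1) (by linarith) (inv_pos.2 hr)
  have h2 : r⁻¹ ≤ Real.exp r⁻¹ := by linarith [Real.add_one_le_exp r⁻¹]
  rw [Real.inv_rpow hr.le, ← div_eq_mul_inv, ← div_eq_mul_inv, add_div] at h1
  rw [div_eq_mul_inv (Real.exp _)]
  calc _ ≤ Real.exp (-b / r ^ κ) * Real.exp r⁻¹ * Real.exp (T / r) := by gcongr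
    _ = Real.exp (-b / r ^ κ + r⁻¹ + T / r) := by rw [Real.exp_add, Real.exp_add]
    _ ≤ _ := by
      apply Real.exp_le_exp.2
      rw [neg_div, inv_eq_one_div]; linarith

lemma exp_neg_div_div_le {b r : ℝ} (hb : 0 < b) (hr : 0 < r) :
    Real.exp (-b / r) / r ≤ 1 / b := by
  rw [div_le_div_iff₀ hr hb, one_mul]
  have h1 := Real.add_one_le_exp (b / r)
  rw [neg_div, Real.exp_neg, inv_mul_le_iff₀ (Real.exp_pos _)]
  calc b = b / r * r := by field_simp
    _ ≤ _ := by gcongr; linarith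

/-! ### Piecewise holomorphic functions on a half disc -/

/-- The argument of the `j`-th of the rays that divide the right half plane into `n` equal
sectors. -/
noncomputable def halfRay (n j : ℕ) : ℝ := -(Real.pi / 2) + j * (Real.pi / n)

/-- Functions `G 0, …, G (n - 1)` on the `n` equal sectors of a half disc with exponential decay of
order `1`, whose jumps across the rays between them have exponential decay of order `κ`. -/
structure HalfDiscData (n : ℕ) (G : ℕ → ℂ → ℂ) (ρ C κ : ℝ) : Prop where
  n_pos : 0 < n
  ρ_pos : 0 < ρ
  C_pos : 0 < C
  analytic : ∀ j < n, ∀ r y, 0 < r → r ≤ ρ → halfRay n j ≤ y → y ≤ halfRay n (j + 1) →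
    AnalyticAt ℂ (G j) (polar r y)
  bound : ∀ j < n, ∀ r y, 0 < r → r ≤ ρ → halfRay n j ≤ y → y ≤ halfRay n (j + 1) →
    ‖G j (polar r y)‖ ≤ C * Real.exp (-C⁻¹ / r)
  jump : ∀ j < n - 1, ∀ r, 0 < r → r ≤ ρ → ‖G (j + 1) (polar r (halfRay n (j + 1))) -
    G j (polar r (halfRay n (j + 1)))‖ ≤ C * Real.exp (-C⁻¹ / r ^ κ)

/-- The jump across the ray `j + 1`, times the direction of the ray. -/
noncomputable def jumpOn (n : ℕ) (G : ℕ → ℂ → ℂ) (j : ℕ) (r : ℝ) : ℂ :=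
  (G (j + 1) (polar r (halfRay n (j + 1))) - G j (polar r (halfRay n (j + 1)))) *
    Complex.exp (halfRay n (j + 1) * Complex.I)

/-- The Borel transform of the jumps. -/
noncomputable def jumpBorel (n : ℕ) (G : ℕ → ℂ → ℂ) (ρ : ℝ) (t : ℂ) : ℂ :=
  ∑ j ∈ Finset.range (n - 1), expInt (fun r => jumpOn n G j r * (polar r (halfRay n (j + 1)))⁻¹)
    (fun r => (polar r (halfRay n (j + 1)))⁻¹) 0 ρ t

/-- The Borel transform of the values on the boundary of the half disc. -/
noncomputable def bdryBorel (n : ℕ) (G : ℕ → ℂ → ℂ) (ρ : ℝ) (t : ℂ) : ℂ :=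
  ∑ j ∈ Finset.range n, expInt
      (fun y => G j (polar ρ y) * (polar ρ y * Complex.I) * (polar ρ y)⁻¹)
      (fun y => (polar ρ y)⁻¹) (halfRay n j) (halfRay n (j + 1)) t +
    expInt (fun r => G 0 (polar r (halfRay n 0)) * Complex.exp (halfRay n 0 * Complex.I) *
      (polar r (halfRay n 0))⁻¹) (fun r => (polar r (halfRay n 0))⁻¹) 0 ρ t -
    expInt (fun r => G (n - 1) (polar r (halfRay n n)) * Complex.exp (halfRay n n * Complex.I) *
      (polar r (halfRay n n))⁻¹) (fun r => (polar r (halfRay n n))⁻¹) 0 ρ t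

lemma re_inv_polar (r y : ℝ) : ((polar r y)⁻¹).re = Real.cos y / r := by
  rw [polar, mul_inv, ← Complex.exp_neg, ← Complex.ofReal_inv, Complex.re_ofReal_mul, ← neg_mul,
    ← Complex.ofReal_neg, Complex.exp_ofReal_mul_I_re, Real.cos_neg, div_eq_inv_mul]

lemma im_inv_polar (r y : ℝ) : ((polar r y)⁻¹).im = -Real.sin y / r := by
  rw [polar, mul_inv, ← Complex.exp_neg, ← Complex.ofReal_inv, Complex.im_ofReal_mul, ← neg_mul,
    ← Complex.ofReal_neg, Complex.exp_ofReal_mul_I_im, Real.sin_neg, div_eq_inv_mul]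

lemma norm_inv_polar {r : ℝ} (hr : 0 < r) (y : ℝ) : ‖(polar r y)⁻¹‖ = r⁻¹ := by
  rw [norm_inv, norm_polar_of_pos hr]

lemma halfRay_zero (n : ℕ) : halfRay n 0 = -(Real.pi / 2) := by simp [halfRay]

lemma halfRay_self {n : ℕ} (hn : 0 < n) : halfRay n n = Real.pi / 2 := by
  have : (n : ℝ) ≠ 0 := by exact_mod_cast hn.ne'
  rw [halfRay]; field_simp; ring

lemma halfRay_succ (n j : ℕ) : halfRay n (j + 1) = halfRay n j + Real.pi / n := by
  simp only [halfRay]; push_cast; ring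

lemma halfRay_le_succ (n j : ℕ) : halfRay n j ≤ halfRay n (j + 1) := by
  rw [halfRay_succ]
  have := Real.pi_pos
  have : 0 ≤ Real.pi / n := by positivity
  linarith

lemma sum_sectorInt_eq' {n : ℕ} (hn : 0 < n) (K : ℕ → ℂ → ℂ) (θ : ℕ → ℝ) (ρ : ℝ) :
    ∑ j ∈ Finset.range n, sectorInt (K j) ρ (θ j) (θ (j + 1)) =
      (∑ j ∈ Finset.range n, arcInt (K j) ρ (θ j) (θ (j + 1)) + rayInt (K 0) ρ (θ 0) -
        rayInt (K (n - 1)) ρ (θ n)) +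
      ∑ j ∈ Finset.range (n - 1), (rayInt (K (j + 1)) ρ (θ (j + 1)) -
        rayInt (K j) ρ (θ (j + 1))) := by
  obtain ⟨p, rfl⟩ : ∃ p, n = p + 1 := ⟨n - 1, by omega⟩
  simp only [sectorInt, Finset.sum_add_distrib, Finset.sum_sub_distrib, Nat.add_sub_cancel]
  rw [Finset.sum_range_succ (fun j => rayInt (K j) ρ (θ (j + 1))) p,
    Finset.sum_range_succ' (fun j => rayInt (K j) ρ (θ j)) p]
  ring

namespace HalfDiscData

variable {n : ℕ} {G : ℕ → ℂ → ℂ} {ρ C κ : ℝ}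

lemma continuousOn_ray (H : HalfDiscData n G ρ C κ) {j : ℕ} (hj : j < n) {y : ℝ}
    (h1 : halfRay n j ≤ y) (h2 : y ≤ halfRay n (j + 1)) :
    ContinuousOn (fun r => G j (polar r y)) (Set.Ioc 0 ρ) :=
  continuousOn_ray_of_analyticAt fun r h3 h4 => H.analytic j hj r y h3 h4 h1 h2

lemma continuousOn_arc (H : HalfDiscData n G ρ C κ) {j : ℕ} (hj : j < n) :
    ContinuousOn (fun y => G j (polar ρ y)) (Set.Ioc (halfRay n j) (halfRay n (j + 1))) :=
  fun y hy => (ContinuousAt.comp (f := fun y => polar ρ y)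
    (H.analytic j hj ρ y H.ρ_pos le_rfl hy.1.le hy.2).continuousAt
    (continuous_polar_right ρ).continuousAt).continuousWithinAt

lemma continuousOn_inv_ray (ρ y : ℝ) :
    ContinuousOn (fun r => (polar r y)⁻¹) (Set.Ioc 0 ρ) :=
  (continuous_polar_left y).continuousOn.inv₀ fun _ hr => polar_ne_zero hr.1 y

lemma continuous_inv_arc (hρ : 0 < ρ) : Continuous fun y => (polar ρ y)⁻¹ :=
  (continuous_polar_right ρ).inv₀ fun y => polar_ne_zero hρ y

lemma continuousOn_jumpOn (H : HalfDiscData n G ρ C κ) {j : ℕ} (hj : j < n - 1) :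
    ContinuousOn (jumpOn n G j) (Set.Ioc 0 ρ) :=
  ((H.continuousOn_ray (j := j + 1) (by omega) le_rfl (halfRay_le_succ _ _)).sub
    (H.continuousOn_ray (j := j) (by omega) (halfRay_le_succ _ _) le_rfl)).mul continuousOn_const

lemma norm_jumpOn_le (H : HalfDiscData n G ρ C κ) {j : ℕ} (hj : j < n - 1) {r : ℝ} (h1 : 0 < r)
    (h2 : r ≤ ρ) : ‖jumpOn n G j r‖ ≤ C * Real.exp (-C⁻¹ / r ^ κ) := by
  rw [jumpOn, norm_mul, Complex.norm_exp_ofReal_mul_I, mul_one]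
  exact H.jump j hj r h1 h2

lemma bound_mul (H : HalfDiscData n G ρ C κ) {j : ℕ} (hj : j < n) {r y T b : ℝ} (h1 : 0 < r)
    (h2 : r ≤ ρ) (h3 : halfRay n j ≤ y) (h4 : y ≤ halfRay n (j + 1)) (hb : 0 < b)
    (hT : T + b ≤ C⁻¹) :
    ‖G j (polar r y)‖ * ‖(polar r y)⁻¹‖ * Real.exp (T * r⁻¹) ≤ C * (1 / b) := by
  rw [norm_inv_polar h1]
  have hC := H.C_pos
  calc _ ≤ C * Real.exp (-C⁻¹ / r) * r⁻¹ * Real.exp (T * r⁻¹) := by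
        gcongr; exact H.bound j hj r y h1 h2 h3 h4
    _ = C * (Real.exp ((T - C⁻¹) * r⁻¹) / r) := by
        rw [show (T - C⁻¹) * r⁻¹ = -C⁻¹ / r + T * r⁻¹ by ring, Real.exp_add]; ring
    _ ≤ C * (Real.exp (-b / r) / r) := by
        rw [div_eq_mul_inv (-b)]
        gcongr
        linarith
    _ ≤ _ := mul_le_mul_of_nonneg_left (exp_neg_div_div_le hb h1) hC.le

/-- For small `t` the Borel transforms cancel, by Cauchy's theorem. -/
lemma bdryBorel_add_jumpBorel_of_small (H : HalfDiscData n G ρ C κ) {t : ℂ}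
    (ht : ‖t‖ ≤ C⁻¹ / 2) : bdryBorel n G ρ t + jumpBorel n G ρ t = 0 := by
  have hC := H.C_pos
  have hρ := H.ρ_pos
  have hn := H.n_pos
  -- For such `t` the factor `e^{t/z}` uses at most half of the decay of `G`, and the other half
  -- absorbs `1/z`. So `K` is bounded near `0` and Cauchy's theorem applies on each sector.
  set K : ℕ → ℂ → ℂ := fun j z => G j z * (z⁻¹ * Complex.exp (t * z⁻¹)) with hK
  have hKan : ∀ j < n, ∀ r y, 0 < r → r ≤ ρ → halfRay n j ≤ y → y ≤ halfRay n (j + 1) →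
      AnalyticAt ℂ (K j) (polar r y) := by
    intro j hj r y h1 h2 h3 h4
    have hinv : AnalyticAt ℂ (fun z : ℂ => z⁻¹) (polar r y) :=
      analyticAt_id.inv (polar_ne_zero h1 y)
    exact (H.analytic j hj r y h1 h2 h3 h4).mul (hinv.mul (analyticAt_const.mul hinv).cexp)
  have hKbd : ∀ j < n, ∀ r y, 0 < r → r ≤ ρ → halfRay n j ≤ y → y ≤ halfRay n (j + 1) →
      ‖K j (polar r y)‖ ≤ C * (1 / (C⁻¹ / 2)) := by
    intro j hj r y h1 h2 h3 h4
    refine le_trans ?_ (H.bound_mul hj (T := C⁻¹ / 2) h1 h2 h3 h4 (by positivity : 0 < C⁻¹ / 2)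
      (by linarith))
    simp only [hK]
    rw [norm_mul, norm_mul, ← mul_assoc, Complex.norm_exp]
    gcongr
    refine (Complex.re_le_norm _).trans ?_
    rw [norm_mul, norm_inv_polar h1]
    gcongr
  have hzero : ∑ j ∈ Finset.range n, sectorInt (K j) ρ (halfRay n j) (halfRay n (j + 1)) = 0 := by
    refine Finset.sum_eq_zero fun j hj => ?_
    have hj := Finset.mem_range.1 hj
    rw [sectorInt, sub_eq_zero]
    exact rayInt_add_arcInt hρ (halfRay_le_succ n j) (hKan j hj) hρ
      (fun r y h1 h2 => hKbd j hj r y h1 h2.le)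
  rw [sum_sectorInt_eq' hn] at hzero
  rw [← hzero, bdryBorel, jumpBorel]
  have hray : ∀ j y, rayInt (K j) ρ y = expInt (fun r => G j (polar r y) *
      Complex.exp (y * Complex.I) * (polar r y)⁻¹) (fun r => (polar r y)⁻¹) 0 ρ t := by
    intro j y
    rw [rayInt, expInt]
    refine intervalIntegral.integral_congr fun r _ => ?_
    simp only [hK]; ring
  congr 1
  · rw [hray, hray]
    congr 2
    refine Finset.sum_congr rfl fun j _ => ?_
    rw [arcInt, expInt]
    refine intervalIntegral.integral_congr fun r _ => ?_
    simp only [hK]; ring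
  · refine Finset.sum_congr rfl fun j hj => ?_
    have hj := Finset.mem_range.1 hj
    have hint : ∀ j' < n, ∀ y, halfRay n j' ≤ y → y ≤ halfRay n (j' + 1) →
        IntervalIntegrable (fun r => K j' (polar r y) * Complex.exp (y * Complex.I))
          MeasureTheory.volume 0 ρ := by
      intro j' hj' y h3 h4
      refine intervalIntegrable_of_continuousOn_of_bounded hρ hρ
        ((continuousOn_ray_of_analyticAt fun r h1 h2 => hKan j' hj' r y h1 h2 h3 h4).mul
          continuousOn_const) (M := C * (1 / (C⁻¹ / 2))) fun r h1 h2 => ?_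
      rw [norm_mul, Complex.norm_exp_ofReal_mul_I, mul_one]
      exact hKbd j' hj' r y h1 h2.le h3 h4
    rw [rayInt, rayInt, ← intervalIntegral.integral_sub
      (hint (j + 1) (by omega) _ le_rfl (halfRay_le_succ _ _))
      (hint j (by omega) _ (halfRay_le_succ _ _) le_rfl), expInt]
    refine intervalIntegral.integral_congr fun r _ => ?_
    simp only [hK, jumpOn]; ring

lemma differentiable_jumpBorel (H : HalfDiscData n G ρ C κ) (hκ : 1 < κ) :
    Differentiable ℂ (jumpBorel n G ρ) := by
  intro t
  have hC := H.C_pos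
  unfold jumpBorel
  refine DifferentiableAt.fun_sum fun j hj => ?_
  have hj := Finset.mem_range.1 hj
  obtain ⟨M, hM⟩ := exists_exp_rpow_bound (inv_pos.2 hC) hκ (T := ‖t‖ + 1) (by positivity)
  refine differentiableAt_expInt (M := C * M) (ε := 1) H.ρ_pos.le
    ((H.continuousOn_jumpOn hj).mul (continuousOn_inv_ray _ _)) (continuousOn_inv_ray _ _)
    one_pos fun r hr => ?_
  have hr0 := hr.1
  have h1 := hM r hr0
  simp only [Pi.mul_apply]
  rw [norm_mul, norm_inv_polar hr.1]
  have h2 : (t * (polar r (halfRay n (j + 1)))⁻¹).re ≤ ‖t‖ * r⁻¹ := by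
    refine (Complex.re_le_norm _).trans ?_
    rw [norm_mul, norm_inv_polar hr.1]
  calc _ ≤ C * Real.exp (-C⁻¹ / r ^ κ) * r⁻¹ * Real.exp (‖t‖ * r⁻¹ + 1 * r⁻¹) := by
        gcongr; exact H.norm_jumpOn_le hj hr.1 hr.2
    _ = C * (Real.exp (-C⁻¹ / r ^ κ) / r * Real.exp ((‖t‖ + 1) / r)) := by
        rw [show ‖t‖ * r⁻¹ + 1 * r⁻¹ = (‖t‖ + 1) / r by ring]; ring
    _ ≤ _ := by gcongr

/-- The two straight boundary pieces lie on the imaginary axis, where `1/z` is imaginary and only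
`Im t` affects the size of `e^{t/z}`; decay of order `1` thus handles a whole strip. The arc stays
away from `0`. -/
lemma differentiableAt_bdryBorel (H : HalfDiscData n G ρ C κ) {t : ℂ} (ht : |t.im| < C⁻¹) :
    DifferentiableAt ℂ (bdryBorel n G ρ) t := by
  have hC := H.C_pos
  have hρ := H.ρ_pos
  have hn := H.n_pos
  have hray : ∀ j < n, ∀ y, halfRay n j ≤ y → y ≤ halfRay n (j + 1) → Real.cos y = 0 →
      DifferentiableAt ℂ (expInt (fun r => G j (polar r y) * Complex.exp (y * Complex.I) *
        (polar r y)⁻¹) (fun r => (polar r y)⁻¹) 0 ρ) t := by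
    intro j hj y h3 h4 hcos
    set δ := C⁻¹ - |t.im| with hδ
    have hδ0 : 0 < δ := by linarith
    refine differentiableAt_expInt (M := C * (1 / (δ / 2))) (ε := δ / 2) hρ.le
      (((H.continuousOn_ray hj h3 h4).mul continuousOn_const).mul (continuousOn_inv_ray _ _))
      (continuousOn_inv_ray _ _) (by positivity) fun r hr => ?_
    simp only [Pi.mul_apply]
    rw [norm_mul, norm_mul, Complex.norm_exp_ofReal_mul_I, mul_one]
    refine le_trans ?_ (H.bound_mul hj (T := |t.im| + δ / 2) hr.1 hr.2 h3 h4
      (by positivity : 0 < δ / 2) (by linarith))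
    gcongr
    have hri := inv_pos.2 hr.1
    have hs : |(-Real.sin y / r)| ≤ r⁻¹ := by
      rw [abs_div, abs_neg, abs_of_pos hr.1, div_eq_mul_inv]
      have := Real.abs_sin_le_one y
      nlinarith
    rw [norm_inv_polar hr.1, Complex.mul_re, re_inv_polar, im_inv_polar, hcos, zero_div, mul_zero,
      zero_sub, add_mul]
    have : -(t.im * (-Real.sin y / r)) ≤ |t.im| * r⁻¹ :=
      calc _ ≤ |t.im * (-Real.sin y / r)| := neg_le_abs _
        _ = |t.im| * |(-Real.sin y / r)| := abs_mul _ _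
        _ ≤ _ := by gcongr
    linarith
  unfold bdryBorel
  refine (DifferentiableAt.add (DifferentiableAt.fun_sum fun j hj => ?_) ?_).sub ?_
  · have hj := Finset.mem_range.1 hj
    refine differentiableAt_expInt (M := C * Real.exp (-C⁻¹ / ρ) *
      Real.exp (‖t‖ * ρ⁻¹ + 1 * ρ⁻¹)) (ε := 1) (halfRay_le_succ n j)
      (((H.continuousOn_arc hj).mul
        ((continuous_polar_right ρ).mul continuous_const).continuousOn).mul
        (continuous_inv_arc hρ).continuousOn)
      (continuous_inv_arc hρ).continuousOn one_pos fun y hy => ?_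
    have h2 : (t * (polar ρ y)⁻¹).re ≤ ‖t‖ * ρ⁻¹ := by
      refine (Complex.re_le_norm _).trans ?_
      rw [norm_mul, norm_inv_polar hρ]
    simp only [Pi.mul_apply]
    rw [norm_mul, norm_mul, norm_mul, Complex.norm_I, mul_one, norm_inv_polar hρ,
      norm_polar_of_pos hρ, mul_inv_cancel_right₀ hρ.ne']
    gcongr
    exact H.bound j hj ρ y hρ le_rfl hy.1.le hy.2
  · refine hray 0 hn _ le_rfl (halfRay_le_succ n 0) ?_
    rw [halfRay_zero, Real.cos_neg, Real.cos_pi_div_two]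
  · have e : n - 1 + 1 = n := by omega
    refine hray (n - 1) (by omega) _ ?_ ?_ ?_
    · have := halfRay_le_succ n (n - 1)
      rwa [e] at this
    · rw [e]
    · rw [halfRay_self hn, Real.cos_pi_div_two]

/-- The cancellation known for small `t` extends by the identity theorem to the strip where both
transforms are holomorphic, and this strip contains the real axis. -/
lemma bdryBorel_eq (H : HalfDiscData n G ρ C κ) (hκ : 1 < κ) (t : ℝ) :
    jumpBorel n G ρ t = -bdryBorel n G ρ t := by
  have hC := H.C_pos
  set S : Set ℂ := {t : ℂ | |t.im| < C⁻¹} with hS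
  have hSo : IsOpen S := isOpen_lt (continuous_abs.comp Complex.continuous_im) continuous_const
  have hSc : IsPreconnected S := by
    have : S = Complex.imLm ⁻¹' (Set.Ioo (-C⁻¹) C⁻¹) := by
      ext t; simp [hS, abs_lt]
    rw [this]
    exact ((convex_Ioo _ _).linear_preimage Complex.imLm).isPreconnected
  have h1 : AnalyticOnNhd ℂ (jumpBorel n G ρ) S :=
    (H.differentiable_jumpBorel hκ).differentiableOn.analyticOnNhd hSo
  have h2 : AnalyticOnNhd ℂ (fun t => -bdryBorel n G ρ t) S :=
    DifferentiableOn.analyticOnNhd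
      (fun t ht => (H.differentiableAt_bdryBorel ht).neg.differentiableWithinAt) hSo
  have h0 : (0 : ℂ) ∈ S := by simp [hS, hC]
  refine h1.eqOn_of_preconnected_of_eventuallyEq h2 hSc h0 ?_ (by simp [hS, hC])
  filter_upwards [Metric.ball_mem_nhds (0 : ℂ) (by positivity : 0 < C⁻¹ / 2)] with t ht
  rw [Metric.mem_ball, dist_zero_right] at ht
  have := H.bdryBorel_add_jumpBorel_of_small ht.le
  linear_combination this

/-- Cauchy's formula for the half disc. -/
lemma sum_sectorInt (H : HalfDiscData n G ρ C κ) {i : ℕ} (hi : i < n) {r₀ y₀ : ℝ}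
    (hr₀ : 0 < r₀) (hr₀ρ : r₀ < ρ) (h1 : halfRay n i < y₀) (h2 : y₀ < halfRay n (i + 1)) :
    ∑ j ∈ Finset.range n, sectorInt (fun z => G j z / (z - polar r₀ y₀)) ρ (halfRay n j)
      (halfRay n (j + 1)) = 2 * Real.pi * Complex.I * G i (polar r₀ y₀) := by
  have hpi := Real.pi_pos
  have hn := H.n_pos
  have hC := H.C_pos
  -- The left half plane is added as sector `n`, carrying the function `0`, so that Cauchy's formula
  -- for the whole disc applies.
  set θ : ℕ → ℝ := fun j => if j ≤ n then halfRay n j else halfRay n 0 + 2 * Real.pi with hθ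
  set G' : ℕ → ℂ → ℂ := fun j => if j < n then G j else fun _ => 0 with hG'
  have e1 : ∀ j ≤ n, θ j = halfRay n j := fun j hj => by simp [hθ, hj]
  have e2 : θ (n + 1) = halfRay n 0 + 2 * Real.pi := by simp [hθ]
  have e3 : ∀ j < n, G' j = G j := fun j hj => by simp [hG', hj]
  have e4 : G' n = fun _ => 0 := by simp [hG']
  have := sum_sectorInt_div (n := n + 1) (G := G') (θ := θ) (ρ := ρ) (M := C) (fun j hj => by
      rcases Nat.lt_succ_iff_lt_or_eq.1 hj with hj | rfl
      · rw [e1 j hj.le, e1 (j + 1) hj]; exact halfRay_le_succ n j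
      · rw [e1 j le_rfl, e2, halfRay_self hn, halfRay_zero]; linarith)
    (by rw [e2, e1 0 (Nat.zero_le n)])
    (fun j hj r y h3 h4 h5 h6 => by
      rcases Nat.lt_succ_iff_lt_or_eq.1 hj with hj | rfl
      · rw [e1 j hj.le] at h5
        rw [e1 (j + 1) hj] at h6
        rw [e3 j hj]
        exact H.analytic j hj r y h3 h4 h5 h6
      · rw [e4]; exact analyticAt_const)
    (fun j hj r y h3 h4 h5 h6 => by
      rcases Nat.lt_succ_iff_lt_or_eq.1 hj with hj | rfl
      · rw [e1 j hj.le] at h5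
        rw [e1 (j + 1) hj] at h6
        rw [e3 j hj]
        refine (H.bound j hj r y h3 h4 h5 h6).trans ?_
        have : Real.exp (-C⁻¹ / r) ≤ 1 := by
          apply Real.exp_le_one_iff.2
          rw [neg_div]; have : 0 < C⁻¹ / r := by positivity
          linarith
        nlinarith
      · rw [e4]; simpa using hC.le)
    (i := i) (by omega) hr₀ hr₀ρ (y₀ := y₀) (by rw [e1 i hi.le]; exact h1)
    (by rw [e1 (i + 1) hi]; exact h2)
  rw [Finset.sum_range_succ, e3 i hi, e4] at this
  rw [← this]
  have hz : sectorInt (fun z => (fun _ : ℂ => (0 : ℂ)) z / (z - polar r₀ y₀)) ρ (θ n)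
      (θ (n + 1)) = 0 := by
    simp [sectorInt, rayInt, arcInt]
  rw [hz, add_zero]
  refine Finset.sum_congr rfl fun j hj => ?_
  have hj := Finset.mem_range.1 hj
  rw [e1 j hj.le, e1 (j + 1) hj, e3 j hj]

end HalfDiscData

/-! ### Taylor remainders and Laplace transforms of powers -/

/-- Since `N! i! ≤ (N + i)!`, the tail is dominated by `y ^ N / N!` times the full exponential
series. -/
lemma exp_sub_sum_le {y : ℝ} (hy : 0 ≤ y) (N : ℕ) :
    Real.exp y - ∑ m ∈ Finset.range N, y ^ m / m.factorial ≤ y ^ N / N.factorial * Real.exp y := by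
  have hs := Real.summable_pow_div_factorial y
  have h1 := hs.sum_add_tsum_nat_add N
  have h2 : Real.exp y = ∑' n : ℕ, y ^ n / n.factorial := by
    rw [Real.exp_eq_exp_ℝ, NormedSpace.exp_eq_tsum_div]
  have h3 : ∑' i : ℕ, y ^ (i + N) / (i + N).factorial ≤
      ∑' i : ℕ, y ^ N / N.factorial * (y ^ i / i.factorial) := by
    refine ((summable_nat_add_iff N).2 hs).tsum_le_tsum (fun i => ?_) (hs.mul_left _)
    rw [div_mul_div_comm, ← pow_add, add_comm i N]
    have : ((N.factorial : ℝ) * i.factorial) ≤ (N + i).factorial := by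
      exact_mod_cast Nat.le_of_dvd (Nat.factorial_pos _)
        (Nat.factorial_mul_factorial_dvd_factorial_add N i)
    gcongr
  rw [tsum_mul_left, ← h2] at h3
  linarith

lemma norm_cexp_sub_sum_le (x : ℂ) (N : ℕ) :
    ‖Complex.exp x - ∑ m ∈ Finset.range N, x ^ m / m.factorial‖ ≤
      ‖x‖ ^ N / N.factorial * Real.exp ‖x‖ :=
  (Complex.norm_exp_sub_sum_le_exp_norm_sub_sum x N).trans (exp_sub_sum_le (norm_nonneg x) N)

lemma integrableOn_exp_mul_pow {w : ℂ} (hw : 0 < w.re) (m : ℕ) :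
    MeasureTheory.IntegrableOn (fun t : ℝ => Complex.exp (-(w * t)) * (t : ℂ) ^ m) (Set.Ioi 0) := by
  have h0 : MeasureTheory.IntegrableOn (fun t : ℝ => t ^ (m : ℝ) * Real.exp (-(w.re * t)))
      (Set.Ioi 0) := by
    have hne := Real.integral_rpow_mul_exp_neg_mul_Ioi (a := m + 1) (r := w.re)
      (by positivity) hw
    rw [add_sub_cancel_right] at hne
    refine MeasureTheory.Integrable.of_integral_ne_zero ?_
    rw [hne]
    have := Real.Gamma_pos_of_pos (show (0 : ℝ) < m + 1 by positivity)
    positivity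
  refine h0.mono' (by fun_prop) ?_
  filter_upwards [MeasureTheory.ae_restrict_mem measurableSet_Ioi] with t ht
  have ht : 0 < t := ht
  rw [norm_mul, Complex.norm_exp, norm_pow, Complex.norm_real, Real.norm_eq_abs, abs_of_pos ht,
    Real.rpow_natCast, Complex.neg_re, Complex.re_mul_ofReal, mul_comm]

lemma integral_exp_mul_pow {w : ℂ} (hw : 0 < w.re) (m : ℕ) :
    ∫ t in Set.Ioi (0 : ℝ), Complex.exp (-(w * t)) * (t : ℂ) ^ m =
      m.factorial / w ^ (m + 1) := by
  have hw0 : w ≠ 0 := by rintro rfl; simp at hw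
  induction m with
  | zero =>
    have := integral_exp_mul_complex_Ioi (a := -w) (by simpa using hw) 0
    simp only [neg_mul] at this
    simp [this, neg_div_neg_eq]
  | succ m ih =>
    have hd : ∀ t : ℝ, HasDerivAt (fun t : ℝ => Complex.exp (-(w * t)) * (t : ℂ) ^ (m + 1))
        (-w * (Complex.exp (-(w * t)) * (t : ℂ) ^ (m + 1)) +
          (m + 1) * (Complex.exp (-(w * t)) * (t : ℂ) ^ m)) t := by
      intro t
      have h1 : HasDerivAt (fun z : ℂ => Complex.exp (-(w * z)) * z ^ (m + 1))
          (Complex.exp (-(w * t)) * (-w) * (t : ℂ) ^ (m + 1) +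
            Complex.exp (-(w * t)) * ((m + 1 : ℕ) * (t : ℂ) ^ m)) (t : ℂ) := by
        have h2 : HasDerivAt (fun z : ℂ => -(w * z)) (-w) (t : ℂ) := by
          simpa [neg_mul] using (hasDerivAt_id (t : ℂ)).const_mul (-w)
        exact h2.cexp.mul (by simpa using hasDerivAt_pow (m + 1) (t : ℂ))
      convert h1.comp_ofReal using 1
      push_cast; ring
    have ht : Tendsto (fun t : ℝ => Complex.exp (-(w * t)) * (t : ℂ) ^ (m + 1)) atTop (𝓝 0) := by
      rw [tendsto_zero_iff_norm_tendsto_zero]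
      refine (tendsto_rpow_mul_exp_neg_mul_atTop_nhds_zero (m + 1 : ℕ) w.re hw).congr' ?_
      filter_upwards [Filter.eventually_gt_atTop 0] with t ht
      rw [norm_mul, Complex.norm_exp, norm_pow, Complex.norm_real, Real.norm_eq_abs,
        abs_of_pos ht, Real.rpow_natCast, Complex.neg_re, Complex.re_mul_ofReal, mul_comm, neg_mul]
    have hI1 := (integrableOn_exp_mul_pow hw (m + 1)).const_mul (-w)
    have hI2 := (integrableOn_exp_mul_pow hw m).const_mul (m + 1 : ℂ)
    have key := MeasureTheory.integral_Ioi_of_hasDerivAt_of_tendsto'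
      (fun t _ => hd t) (hI1.add hI2) ht
    rw [MeasureTheory.integral_add hI1 hI2, MeasureTheory.integral_const_mul,
      MeasureTheory.integral_const_mul, ih] at key
    simp only [Complex.ofReal_zero, zero_pow (Nat.succ_ne_zero m), mul_zero, sub_zero] at key
    have : w * ∫ t in Set.Ioi (0 : ℝ), Complex.exp (-(w * t)) * (t : ℂ) ^ (m + 1) =
        (m + 1) * (m.factorial / w ^ (m + 1)) := by linear_combination -key
    rw [Nat.factorial_succ]
    push_cast
    field_simp
    field_simp at this
    linear_combination this

lemma norm_integral_exp_mul_le {w : ℂ} {R A : ℝ} {f : ℝ → ℂ} {N : ℕ} (hw : R < w.re)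
    (hf : ∀ t : ℝ, 0 < t → ‖f t‖ ≤ A * (t ^ N / N.factorial) * Real.exp (R * t)) :
    ‖∫ t in Set.Ioi (0 : ℝ), Complex.exp (-(w * t)) * f t‖ ≤ A / (w.re - R) ^ (N + 1) := by
  have hwR : 0 < w.re - R := by linarith
  have h1 := Real.integral_rpow_mul_exp_neg_mul_Ioi (a := N + 1) (r := w.re - R)
      (by positivity) hwR
  rw [add_sub_cancel_right, Real.Gamma_nat_eq_factorial] at h1
  have hint : MeasureTheory.IntegrableOn (fun t : ℝ => t ^ (N : ℝ) *
      Real.exp (-((w.re - R) * t))) (Set.Ioi 0) := by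
    refine MeasureTheory.Integrable.of_integral_ne_zero ?_
    rw [h1]
    positivity
  calc _ ≤ ∫ t in Set.Ioi (0 : ℝ), A / N.factorial *
        (t ^ (N : ℝ) * Real.exp (-((w.re - R) * t))) := by
        refine MeasureTheory.norm_integral_le_of_norm_le (hint.const_mul _) ?_
        filter_upwards [MeasureTheory.ae_restrict_mem measurableSet_Ioi] with t ht
        have ht : 0 < t := ht
        rw [norm_mul, Complex.norm_exp, Complex.neg_re, Complex.re_mul_ofReal, Real.rpow_natCast,
          show -((w.re - R) * t) = -(w.re * t) + R * t by ring, Real.exp_add]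
        calc _ ≤ Real.exp (-(w.re * t)) * (A * (t ^ N / N.factorial) * Real.exp (R * t)) := by
              gcongr; exact hf t ht
          _ = _ := by ring
    _ = _ := by
        rw [MeasureTheory.integral_const_mul, h1]
        have h2 : (1 / (w.re - R)) ^ ((N : ℝ) + 1) = 1 / (w.re - R) ^ (N + 1) := by
          rw [← Nat.cast_succ, Real.rpow_natCast, one_div_pow]
        rw [h2]
        have : (N.factorial : ℝ) ≠ 0 := by positivity
        field_simp

/-- From `N! ≤ m! N ^ (N - m)` and `N ^ (1 - s) ≤ t`: for such large `t` every lower term of a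
Gevrey Borel series is bounded by the term of index `N`. The case `m = 0` shows that the right side
is at least `1`. -/
lemma pow_div_factorial_mul_rpow_le {s t : ℝ} (hs : 0 < s) {N m : ℕ}
    (ht : 0 < t) (htN : (N : ℝ) ^ (1 - s) ≤ t) (hm : m ≤ N) :
    t ^ m / m.factorial * (m : ℝ) ^ (s * m) ≤ (N : ℝ) ^ (s * N) * (t ^ N / N.factorial) := by
  rcases Nat.eq_zero_or_pos N with rfl | hN
  · obtain rfl : m = 0 := by omega
    simp
  obtain ⟨d, rfl⟩ : ∃ d, N = m + d := ⟨N - m, by omega⟩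
  have hN0 : (0 : ℝ) < (m + d : ℕ) := by exact_mod_cast hN
  set n : ℝ := ((m + d : ℕ) : ℝ) with hn
  have h1 : ((m + d).factorial : ℝ) ≤ m.factorial * n ^ d := by
    have e := Nat.factorial_mul_descFactorial (n := m + d) (k := d) (by omega)
    rw [Nat.add_sub_cancel] at e
    rw [← e]; push_cast
    gcongr
    rw [hn]
    exact_mod_cast Nat.descFactorial_le_pow (m + d) d
  have h2 : (n ^ (1 - s)) ^ d ≤ t ^ d := by gcongr
  have h3 : (m : ℝ) ^ (s * m) ≤ n ^ (s * m) := by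
    apply Real.rpow_le_rpow (Nat.cast_nonneg m) _ (by positivity)
    rw [hn]; push_cast; linarith [(Nat.cast_nonneg d : (0 : ℝ) ≤ d)]
  have h4 : n ^ (s * m) * n ^ d = n ^ (s * n) * (n ^ (1 - s)) ^ d := by
    rw [← Real.rpow_natCast (n ^ (1 - s)), ← Real.rpow_mul hN0.le, ← Real.rpow_natCast n d,
      ← Real.rpow_add hN0, ← Real.rpow_add hN0]
    congr 1
    rw [hn]; push_cast; ring
  rw [div_mul_eq_mul_div, mul_div_assoc', div_le_div_iff₀ (by positivity) (by positivity)]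
  calc t ^ m * (m : ℝ) ^ (s * m) * (m + d).factorial
      ≤ t ^ m * n ^ (s * m) * (m.factorial * n ^ d) := by gcongr
    _ = t ^ m * m.factorial * (n ^ (s * m) * n ^ d) := by ring
    _ = t ^ m * m.factorial * (n ^ (s * n) * (n ^ (1 - s)) ^ d) := by rw [h4]
    _ ≤ t ^ m * m.factorial * (n ^ (s * n) * t ^ d) := by gcongr
    _ = _ := by rw [pow_add]; ring

/-- `v` is the Laplace transform of `f` at `w`. -/
def HasLaplace (w : ℂ) (f : ℂ → ℂ) (v : ℂ) : Prop :=
  MeasureTheory.IntegrableOn (fun t : ℝ => Complex.exp (-(w * t)) * f t) (Set.Ioi 0) ∧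
    ∫ t in Set.Ioi (0 : ℝ), Complex.exp (-(w * t)) * f t = v

lemma HasLaplace.add {w : ℂ} {f g : ℂ → ℂ} {u v : ℂ} (hf : HasLaplace w f u)
    (hg : HasLaplace w g v) : HasLaplace w (fun t => f t + g t) (u + v) := by
  constructor
  · refine (hf.1.add hg.1).congr (Filter.Eventually.of_forall fun t => ?_)
    simp only [Pi.add_apply, mul_add]
  · simp only [mul_add]
    rw [MeasureTheory.integral_add hf.1 hg.1, hf.2, hg.2]

lemma HasLaplace.sub {w : ℂ} {f g : ℂ → ℂ} {u v : ℂ} (hf : HasLaplace w f u)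
    (hg : HasLaplace w g v) : HasLaplace w (fun t => f t - g t) (u - v) := by
  constructor
  · refine (hf.1.sub hg.1).congr (Filter.Eventually.of_forall fun t => ?_)
    simp only [Pi.sub_apply, mul_sub]
  · simp only [mul_sub]
    rw [MeasureTheory.integral_sub hf.1 hg.1, hf.2, hg.2]

lemma HasLaplace.const_mul {w : ℂ} {f : ℂ → ℂ} {u : ℂ} (hf : HasLaplace w f u) (c : ℂ) :
    HasLaplace w (fun t => c * f t) (c * u) := by
  simp only [HasLaplace, mul_left_comm _ c]
  exact ⟨MeasureTheory.Integrable.const_mul hf.1 c,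
    by rw [MeasureTheory.integral_const_mul, hf.2]⟩

lemma HasLaplace.sum {w : ℂ} {ι : Type*} {f : ι → ℂ → ℂ} {v : ι → ℂ} {s : Finset ι}
    (h : ∀ j ∈ s, HasLaplace w (f j) (v j)) :
    HasLaplace w (fun t => ∑ j ∈ s, f j t) (∑ j ∈ s, v j) := by
  constructor
  · simp only [Finset.mul_sum]
    exact MeasureTheory.integrable_finsetSum _ fun j hj => (h j hj).1
  · simp only [Finset.mul_sum]
    rw [MeasureTheory.integral_finsetSum _ fun j hj => (h j hj).1]
    exact Finset.sum_congr rfl fun j hj => (h j hj).2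

lemma HasLaplace.congr {w : ℂ} {f g : ℂ → ℂ} {v : ℂ} (hf : HasLaplace w f v)
    (hfg : ∀ t : ℝ, f t = g t) : HasLaplace w g v := by
  simpa only [HasLaplace, hfg] using hf

lemma hasLaplace_expInt {D W : ℝ → ℂ} {a b M R : ℝ} (hab : a ≤ b)
    (hDc : ContinuousOn D (Set.Ioc a b)) (hWc : ContinuousOn W (Set.Ioc a b))
    (hD : ∀ s ∈ Set.Ioc a b, ‖D s‖ ≤ M) (hW : ∀ s ∈ Set.Ioc a b, (W s).re ≤ R) {w₀ : ℂ}
    (hw₀ : R < w₀.re) :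
    HasLaplace w₀ (expInt D W a b) (∫ s in a..b, D s / (w₀ - W s)) :=
  integral_exp_mul_expInt hab hDc hWc hD hW hw₀

/-- With `w₀ = 1/z₀` this turns the kernel `1/(w₀ - 1/γ)` coming from the Laplace transform into the
Cauchy kernel `1/(γ - z₀)`. -/
lemma mul_div_sub_inv {w₀ g γ : ℂ} (hw₀ : w₀ ≠ 0) (hγ : γ ≠ 0) :
    w₀ * (g * γ⁻¹ / (w₀ - γ⁻¹)) = g / (γ - w₀⁻¹) := by
  have h : w₀ - γ⁻¹ = (w₀ * γ⁻¹) * (γ - w₀⁻¹) := by field_simp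
  rw [h, ← mul_div_assoc, show w₀ * (g * γ⁻¹) = (w₀ * γ⁻¹) * g by ring]
  exact mul_div_mul_left _ _ (mul_ne_zero hw₀ (inv_ne_zero hγ))

/-! ### Representation of a function on the half disc by its jumps -/

namespace HalfDiscData

variable {n : ℕ} {G : ℕ → ℂ → ℂ} {ρ C κ : ℝ}

lemma halfRay_pred_le (H : HalfDiscData n G ρ C κ) :
    halfRay n (n - 1) ≤ halfRay n n := by
  have := halfRay_le_succ n (n - 1)
  rwa [Nat.sub_add_cancel H.n_pos] at this

lemma exp_neg_inv_div_le_one (H : HalfDiscData n G ρ C κ) {r : ℝ} (hr : 0 < r) :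
    Real.exp (-C⁻¹ / r) ≤ 1 := by
  have hC := H.C_pos
  apply Real.exp_le_one_iff.2
  rw [neg_div]
  have : 0 < C⁻¹ / r := by positivity
  linarith

lemma bound_bdry_arc (H : HalfDiscData n G ρ C κ) {j : ℕ} (hj : j < n) {y : ℝ}
    (hy : y ∈ Set.Ioc (halfRay n j) (halfRay n (j + 1))) :
    ‖G j (polar ρ y) * (polar ρ y * Complex.I) * (polar ρ y)⁻¹‖ ≤ C := by
  have hρ := H.ρ_pos
  rw [norm_mul, norm_mul, norm_mul, Complex.norm_I, mul_one, norm_inv_polar hρ,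
    norm_polar_of_pos hρ, mul_inv_cancel_right₀ hρ.ne']
  refine (H.bound j hj ρ y hρ le_rfl hy.1.le hy.2).trans ?_
  exact mul_le_of_le_one_right H.C_pos.le (H.exp_neg_inv_div_le_one hρ)

lemma bound_bdry_ray (H : HalfDiscData n G ρ C κ) {j : ℕ} (hj : j < n) {r y : ℝ}
    (hr : r ∈ Set.Ioc 0 ρ) (h3 : halfRay n j ≤ y) (h4 : y ≤ halfRay n (j + 1)) :
    ‖G j (polar r y) * Complex.exp (y * Complex.I) * (polar r y)⁻¹‖ ≤ C * (1 / C⁻¹) := by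
  have := H.bound_mul hj (T := 0) hr.1 hr.2 h3 h4 (inv_pos.2 H.C_pos) (by simp)
  rw [zero_mul, Real.exp_zero, mul_one] at this
  rw [norm_mul, norm_mul, Complex.norm_exp_ofReal_mul_I, mul_one]
  exact this

/-- Nothing of this kind is visible from the jumps. It comes from the boundary values: for real `t`,
`e^{t/z}` has modulus `1` on the imaginary axis and at most `e^{t/ρ}` on the arc. -/
lemma exists_norm_jumpBorel_le (H : HalfDiscData n G ρ C κ) (hκ : 1 < κ) :
    ∃ B, 0 ≤ B ∧ ∀ t : ℝ, 0 ≤ t → ‖jumpBorel n G ρ t‖ ≤ B * Real.exp (ρ⁻¹ * t) := by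
  have hρ := H.ρ_pos
  have hn := H.n_pos
  have hC := H.C_pos
  have hray : ∀ j < n, ∀ y, halfRay n j ≤ y → y ≤ halfRay n (j + 1) → Real.cos y = 0 →
      ∀ t : ℝ, 0 ≤ t →
      ‖expInt (fun r => G j (polar r y) * Complex.exp (y * Complex.I) * (polar r y)⁻¹)
        (fun r => (polar r y)⁻¹) 0 ρ t‖ ≤ (ρ - 0) * (C * (1 / C⁻¹)) * Real.exp (ρ⁻¹ * t) := by
    intro j hj y h3 h4 hcos t ht
    refine norm_expInt_le hρ.le (fun r hr => H.bound_bdry_ray hj hr h3 h4) (fun r hr => ?_) ht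
    rw [re_inv_polar, hcos, zero_div]; positivity
  refine ⟨∑ j ∈ Finset.range n, (halfRay n (j + 1) - halfRay n j) * C +
    (ρ - 0) * (C * (1 / C⁻¹)) + (ρ - 0) * (C * (1 / C⁻¹)), ?_, fun t ht => ?_⟩
  · rw [sub_zero]
    have : 0 ≤ ∑ j ∈ Finset.range n, (halfRay n (j + 1) - halfRay n j) * C :=
      Finset.sum_nonneg fun j _ => mul_nonneg (sub_nonneg.2 (halfRay_le_succ n j)) hC.le
    positivity
  rw [H.bdryBorel_eq hκ, norm_neg, bdryBorel, add_mul, add_mul, Finset.sum_mul]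
  refine (norm_sub_le _ _).trans (add_le_add ((norm_add_le _ _).trans (add_le_add
    ((norm_sum_le _ _).trans (Finset.sum_le_sum fun j hj => ?_)) ?_)) ?_)
  · have hj := Finset.mem_range.1 hj
    refine norm_expInt_le (halfRay_le_succ n j) (fun y hy => H.bound_bdry_arc hj hy)
      (fun y _ => ?_) ht
    rw [re_inv_polar, div_eq_mul_inv]
    exact mul_le_of_le_one_left (inv_nonneg.2 hρ.le) (Real.cos_le_one y)
  · refine hray 0 hn _ le_rfl (halfRay_le_succ n 0) ?_ t ht
    rw [halfRay_zero, Real.cos_neg, Real.cos_pi_div_two]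
  · refine hray (n - 1) (by omega) _ H.halfRay_pred_le ?_ ?_ t ht
    · rw [Nat.sub_add_cancel hn]
    · rw [halfRay_self hn, Real.cos_pi_div_two]

/-- The function in terms of its jumps alone. -/
lemma formula (H : HalfDiscData n G ρ C κ) (hκ : 1 < κ) {i : ℕ} (hi : i < n) {r₀ y₀ : ℝ}
    (hr₀ : 0 < r₀) (hr₀ρ : ρ⁻¹ < Real.cos y₀ / r₀) (h1 : halfRay n i < y₀)
    (h2 : y₀ < halfRay n (i + 1)) :
    ∃ v, HasLaplace (polar r₀ y₀)⁻¹ (jumpBorel n G ρ) v ∧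
      2 * Real.pi * Complex.I * G i (polar r₀ y₀) =
        ∑ j ∈ Finset.range (n - 1), (∫ r in (0 : ℝ)..ρ, jumpOn n G j r /
          (polar r (halfRay n (j + 1)) - polar r₀ y₀)) - (polar r₀ y₀)⁻¹ * v := by
  have hρ := H.ρ_pos
  have hn := H.n_pos
  have hC := H.C_pos
  set z₀ := polar r₀ y₀ with hz₀
  have hz₀0 : z₀ ≠ 0 := polar_ne_zero hr₀ _
  -- The point lies in the disc of diameter `ρ` tangent to the imaginary axis at `0`, exactly where
  -- the Laplace integral of a function of growth `e^{t/ρ}` converges.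
  have hre : ρ⁻¹ < (z₀⁻¹).re := by rw [hz₀, re_inv_polar]; exact hr₀ρ
  have hrρ : r₀ < ρ := by
    have : Real.cos y₀ / r₀ ≤ 1 / r₀ := by gcongr; exact Real.cos_le_one y₀
    have h3 := hr₀ρ.trans_le this
    rwa [← one_div, one_div_lt_one_div hρ hr₀] at h3
  have hray : ∀ j < n, ∀ y, halfRay n j ≤ y → y ≤ halfRay n (j + 1) → Real.cos y = 0 →
      HasLaplace z₀⁻¹ (expInt (fun r => G j (polar r y) * Complex.exp (y * Complex.I) *
        (polar r y)⁻¹) (fun r => (polar r y)⁻¹) 0 ρ)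
        (z₀ * rayInt (fun z => G j z / (z - z₀)) ρ y) := by
    intro j hj y h3 h4 hcos
    have := hasLaplace_expInt (M := C * (1 / C⁻¹)) (R := ρ⁻¹) (w₀ := z₀⁻¹) hρ.le
      (((H.continuousOn_ray hj h3 h4).mul continuousOn_const).mul (continuousOn_inv_ray _ _))
      (continuousOn_inv_ray ρ y) (D := fun r => G j (polar r y) * Complex.exp (y * Complex.I) *
        (polar r y)⁻¹) (fun r hr => H.bound_bdry_ray hj hr h3 h4) (fun r hr => by
        rw [re_inv_polar, hcos, zero_div]; positivity) hre
    convert this using 1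
    rw [rayInt, ← intervalIntegral.integral_const_mul]
    refine intervalIntegral.integral_congr_ae (Filter.Eventually.of_forall fun r hr => ?_)
    rw [Set.uIoc_of_le hρ.le] at hr
    have e := mul_div_sub_inv (g := G j (polar r y) * Complex.exp (y * Complex.I))
      (inv_ne_zero hz₀0) (polar_ne_zero hr.1 y)
    rw [inv_inv] at e
    rw [div_mul_eq_mul_div, ← e, mul_inv_cancel_left₀ hz₀0]
  have harc : ∀ j < n, HasLaplace z₀⁻¹ (expInt
      (fun y => G j (polar ρ y) * (polar ρ y * Complex.I) * (polar ρ y)⁻¹)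
      (fun y => (polar ρ y)⁻¹) (halfRay n j) (halfRay n (j + 1)))
      (z₀ * arcInt (fun z => G j z / (z - z₀)) ρ (halfRay n j) (halfRay n (j + 1))) := by
    intro j hj
    have := hasLaplace_expInt (M := C) (R := ρ⁻¹) (w₀ := z₀⁻¹) (halfRay_le_succ n j)
      (((H.continuousOn_arc hj).mul
        ((continuous_polar_right ρ).mul continuous_const).continuousOn).mul
        (continuous_inv_arc hρ).continuousOn) (continuous_inv_arc hρ).continuousOn
      (D := fun y => G j (polar ρ y) * (polar ρ y * Complex.I) * (polar ρ y)⁻¹)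
      (fun y hy => H.bound_bdry_arc hj hy) (fun y _ => by
        rw [re_inv_polar, div_eq_mul_inv]
        exact mul_le_of_le_one_left (inv_nonneg.2 hρ.le) (Real.cos_le_one y)) hre
    convert this using 1
    rw [arcInt, ← intervalIntegral.integral_const_mul]
    refine intervalIntegral.integral_congr fun y _ => ?_
    have e := mul_div_sub_inv (g := G j (polar ρ y) * (polar ρ y * Complex.I))
      (inv_ne_zero hz₀0) (polar_ne_zero hρ y)
    rw [inv_inv] at e
    rw [div_mul_eq_mul_div, ← e, mul_inv_cancel_left₀ hz₀0]
  have hb := ((HasLaplace.sum (s := Finset.range n)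
    fun j hj => harc j (Finset.mem_range.1 hj)).add
    (hray 0 hn _ le_rfl (halfRay_le_succ n 0)
      (by rw [halfRay_zero, Real.cos_neg, Real.cos_pi_div_two]))).sub
    (hray (n - 1) (by omega) (halfRay n n) H.halfRay_pred_le (by rw [Nat.sub_add_cancel hn])
      (by rw [halfRay_self hn, Real.cos_pi_div_two]))
  -- Up to the factor `z₀`, the Cauchy integrals over the boundary are the Laplace transform of the
  -- boundary data, which for real `t` is minus the transform of the jumps.
  have hj := (hb.const_mul (-1)).congr (g := jumpBorel n G ρ) fun t => by
    rw [H.bdryBorel_eq hκ, bdryBorel, neg_one_mul]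
  refine ⟨_, hj, ?_⟩
  have hdist : ∀ j ≤ n, ∀ r, 0 < r → polar r (halfRay n j) ≠ z₀ := by
    have hmono : ∀ {a b : ℕ}, a ≤ b → halfRay n a ≤ halfRay n b := fun h =>
      monotone_nat_of_le_succ (halfRay_le_succ n) h
    intro j hj r hr h
    have h3 := hmono (Nat.zero_le j)
    have h4 := hmono hj
    have h5 := hmono (Nat.zero_le i)
    have h6 := hmono (Nat.succ_le_of_lt hi)
    rw [Nat.succ_eq_add_one] at h6
    rw [halfRay_zero] at h3 h5
    rw [halfRay_self hn] at h4 h6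
    have hpi := Real.pi_pos
    have h7 := (polar_inj hr hr₀ h (by rw [abs_lt]; constructor <;> linarith)).2
    rcases le_or_gt j i with hji | hji
    · have := hmono hji; linarith
    · have := hmono (Nat.succ_le_of_lt hji); rw [Nat.succ_eq_add_one] at this; linarith
  rw [← H.sum_sectorInt hi hr₀ hrρ h1 h2, sum_sectorInt_eq' hn, ← Finset.mul_sum]
  have hjump : ∀ j ∈ Finset.range (n - 1),
      rayInt (fun z => G (j + 1) z / (z - z₀)) ρ (halfRay n (j + 1)) -
        rayInt (fun z => G j z / (z - z₀)) ρ (halfRay n (j + 1)) =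
      ∫ r in (0 : ℝ)..ρ, jumpOn n G j r / (polar r (halfRay n (j + 1)) - z₀) := by
    intro j hj
    have hj := Finset.mem_range.1 hj
    have hGb : ∀ j' < n, ∀ y, halfRay n j' ≤ y → y ≤ halfRay n (j' + 1) → ∀ r, 0 < r → r ≤ ρ →
        ‖G j' (polar r y)‖ ≤ C := fun j' hj' y h3 h4 r h5 h6 =>
      (H.bound j' hj' r y h5 h6 h3 h4).trans
        (mul_le_of_le_one_right hC.le (H.exp_neg_inv_div_le_one h5))
    rw [rayInt, rayInt, ← intervalIntegral.integral_sub
      (intervalIntegrable_ray_div_sub hρ hz₀0 (hdist (j + 1) (by omega))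
        (fun r h5 h6 => H.analytic (j + 1) (by omega) r _ h5 h6 le_rfl (halfRay_le_succ _ _))
        (hGb (j + 1) (by omega) _ le_rfl (halfRay_le_succ _ _)))
      (intervalIntegrable_ray_div_sub hρ hz₀0 (hdist (j + 1) (by omega))
        (fun r h5 h6 => H.analytic j (by omega) r _ h5 h6 (halfRay_le_succ _ _) le_rfl)
        (hGb j (by omega) _ (halfRay_le_succ _ _) le_rfl))]
    refine intervalIntegral.integral_congr fun r _ => ?_
    simp only [jumpOn]; ring
  rw [Finset.sum_congr rfl hjump]
  field_simp
  ring

end HalfDiscData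

/-! ### The relative Watson lemma on a half disc -/

lemma norm_expInt_sub_sum_le {D W : ℝ → ℂ} {a b t K : ℝ} {N : ℕ} (hab : a ≤ b) (ht : 0 ≤ t)
    (hDc : ContinuousOn D (Set.Ioc a b)) (hWc : ContinuousOn W (Set.Ioc a b))
    (B : ℕ → ℝ) (hB : ∀ m, ∀ s ∈ Set.Ioc a b, ‖D s‖ * ‖W s‖ ^ m ≤ B m)
    (hK : ∀ s ∈ Set.Ioc a b,
      ‖D s‖ * ((t * ‖W s‖) ^ N / N.factorial * Real.exp (t * ‖W s‖)) ≤ K) :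
    ‖expInt D W a b t - ∑ m ∈ Finset.range N, (t : ℂ) ^ m / m.factorial *
      ∫ s in a..b, D s * W s ^ m‖ ≤ (b - a) * K := by
  have hint : ∀ (g : ℝ → ℂ) (C : ℝ), ContinuousOn g (Set.Ioc a b) →
      (∀ s ∈ Set.Ioc a b, ‖g s‖ ≤ C) → IntervalIntegrable g MeasureTheory.volume a b := by
    intro g C h1 h2
    rw [intervalIntegrable_iff_integrableOn_Ioc_of_le hab]
    refine MeasureTheory.Integrable.of_bound (h1.aestronglyMeasurable measurableSet_Ioc) C ?_
    filter_upwards [MeasureTheory.ae_restrict_mem measurableSet_Ioc] with s hs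
    exact h2 s hs
  set E : ℝ → ℂ := fun s => D s * (Complex.exp (t * W s) -
    ∑ m ∈ Finset.range N, (t * W s) ^ m / m.factorial) with hE
  have hEle : ∀ s ∈ Set.Ioc a b, ‖E s‖ ≤ K := by
    intro s hs
    refine le_trans ?_ (hK s hs)
    rw [hE, norm_mul]
    gcongr
    have := norm_cexp_sub_sum_le (t * W s) N
    rwa [norm_mul, Complex.norm_real, Real.norm_eq_abs, abs_of_nonneg ht] at this
  have hEc : ContinuousOn E (Set.Ioc a b) := by
    refine hDc.mul (((continuousOn_const.mul hWc).cexp).sub ?_)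
    exact continuousOn_finsetSum _ fun m _ => ((continuousOn_const.mul hWc).pow m).div_const _
  have hEi := hint E K hEc hEle
  have hTi : ∀ m ∈ Finset.range N, IntervalIntegrable
      (fun s => (t : ℂ) ^ m / m.factorial * (D s * W s ^ m)) MeasureTheory.volume a b :=
    fun m _ => (hint _ (B m) (hDc.mul (hWc.pow m)) fun s hs => by
      rw [Pi.mul_apply, norm_mul, Pi.pow_apply, norm_pow]; exact hB m s hs).const_mul _
  have e : expInt D W a b t - ∑ m ∈ Finset.range N, (t : ℂ) ^ m / m.factorial *
      ∫ s in a..b, D s * W s ^ m = ∫ s in a..b, E s := by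
    simp only [← intervalIntegral.integral_const_mul]
    rw [← intervalIntegral.integral_finsetSum hTi, sub_eq_iff_eq_add,
      ← intervalIntegral.integral_add hEi, expInt]
    · refine intervalIntegral.integral_congr fun s _ => ?_
      simp only [hE]
      rw [mul_sub, Finset.mul_sum, sub_add, eq_comm, sub_eq_self, sub_eq_zero]
      exact Finset.sum_congr rfl fun m _ => by rw [mul_pow]; ring
    · have := IntervalIntegrable.sum _ hTi
      refine this.congr (fun s _ => ?_)
      simp
  rw [e]
  have := intervalIntegral.norm_integral_le_of_norm_le_const (a := a) (b := b) (C := K) (f := E)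
    fun s hs => hEle s (by rwa [Set.uIoc_of_le hab] at hs)
  rw [abs_of_nonneg (sub_nonneg.2 hab)] at this
  linarith

/-- Powers `m ^ (m/k)` replace the Gamma values because terms of different index have to be
compared. -/
lemma exists_exp_le_rpow_mul_pow {b k : ℝ} (hb : 0 < b) (hk : 0 < k) :
    ∃ B > 0, ∃ c > 0, ∀ (m : ℕ) (r : ℝ), 0 < r →
      Real.exp (-b / r ^ k) ≤ B * c ^ m * (m : ℝ) ^ (1 / k * m) * r ^ (m + 1) := by
  obtain ⟨B, hB, c, hc, h⟩ := exists_exp_le_Gamma_mul_pow hb hk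
  refine ⟨B * 2, by positivity, c * (2 * (1 / k)) ^ (1 / k), by positivity, fun m r hr =>
    (h m r hr).trans ?_⟩
  have := Gamma_one_add_mul_le (one_div_pos.2 hk) m
  calc _ ≤ B * c ^ m * (2 * ((2 * (1 / k)) ^ (1 / k)) ^ m * (m : ℝ) ^ (1 / k * m)) *
        r ^ (m + 1) := by gcongr
    _ = _ := by rw [mul_pow]; ring

/-- The Taylor coefficients of the Borel transform of the jumps, up to factorials. -/
noncomputable def jumpCoeff (n : ℕ) (G : ℕ → ℂ → ℂ) (ρ : ℝ) (m : ℕ) : ℂ :=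
  ∑ j ∈ Finset.range (n - 1), ∫ r in (0 : ℝ)..ρ, jumpOn n G j r /
    polar r (halfRay n (j + 1)) ^ (m + 1)

namespace HalfDiscData

variable {n : ℕ} {G : ℕ → ℂ → ℂ} {ρ C κ : ℝ}

lemma exists_norm_jumpOn_le (H : HalfDiscData n G ρ C κ) (hκ : 1 < κ) :
    ∃ B > 0, ∃ c > 0, ∀ j < n - 1, ∀ (m : ℕ) (r : ℝ), 0 < r → r ≤ ρ →
      ‖jumpOn n G j r‖ ≤ B * c ^ m * (m : ℝ) ^ (1 / κ * m) * r ^ (m + 1) := by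
  have hC := H.C_pos
  obtain ⟨B, hB, c, hc, h⟩ := exists_exp_le_rpow_mul_pow (inv_pos.2 hC) (by linarith : 0 < κ)
  refine ⟨C * B, by positivity, c, hc, fun j hj m r h1 h2 => (H.norm_jumpOn_le hj h1 h2).trans ?_⟩
  have := mul_le_mul_of_nonneg_left (h m r h1) hC.le
  linarith

lemma exists_norm_jumpCoeff_le (H : HalfDiscData n G ρ C κ) (hκ : 1 < κ) :
    ∃ B > 0, ∃ c > 0, ∀ m, ‖jumpCoeff n G ρ m‖ ≤ B * c ^ m * (m : ℝ) ^ (1 / κ * m) := by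
  have hρ := H.ρ_pos
  obtain ⟨B, hB, c, hc, h⟩ := H.exists_norm_jumpOn_le hκ
  have hn : (0 : ℝ) < n := by exact_mod_cast H.n_pos
  refine ⟨n * (B * ρ), by positivity, c, hc, fun m => ?_⟩
  have hterm : ∀ j ∈ Finset.range (n - 1), ‖∫ r in (0 : ℝ)..ρ, jumpOn n G j r /
      polar r (halfRay n (j + 1)) ^ (m + 1)‖ ≤ B * c ^ m * (m : ℝ) ^ (1 / κ * m) * ρ := by
    intro j hj
    have := intervalIntegral.norm_integral_le_of_norm_le_const (a := 0) (b := ρ)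
      (C := B * c ^ m * (m : ℝ) ^ (1 / κ * m)) (f := fun r => jumpOn n G j r /
      polar r (halfRay n (j + 1)) ^ (m + 1)) fun r hr => by
        rw [Set.uIoc_of_le hρ.le] at hr
        have hr0 := hr.1
        rw [norm_div, norm_pow, norm_polar_of_pos hr.1, div_le_iff₀ (by positivity)]
        exact h j (Finset.mem_range.1 hj) m r hr.1 hr.2
    rwa [sub_zero, abs_of_pos hρ] at this
  refine (norm_sum_le_of_le _ hterm).trans ?_
  rw [Finset.sum_const, Finset.card_range, nsmul_eq_mul]
  have : ((n - 1 : ℕ) : ℝ) ≤ n := by exact_mod_cast Nat.sub_le n 1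
  calc _ ≤ (n : ℝ) * (B * c ^ m * (m : ℝ) ^ (1 / κ * m) * ρ) := by gcongr
    _ = _ := by ring

/-- For small `t` Taylor's formula is applied under the integral: half of the decay of the jumps
controls the growth of `e^{t/r}`, the other half yields the Gevrey factor. -/
lemma norm_jumpBorel_sub_le_of_le (H : HalfDiscData n G ρ C κ) (hκ : 1 < κ) :
    ∃ A > 0, ∃ c > 0, ∀ (N : ℕ) (t : ℝ), 0 < t → t ≤ (N : ℝ) ^ (1 - 1 / κ) →
      ‖jumpBorel n G ρ t - ∑ m ∈ Finset.range N, (t : ℂ) ^ m / m.factorial * jumpCoeff n G ρ m‖ ≤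
        A * c ^ N * (N : ℝ) ^ (1 / κ * N) * (t ^ N / N.factorial) := by
  have hρ := H.ρ_pos
  have hC := H.C_pos
  have hκ0 : 0 < κ := by linarith
  have hκ1 : 0 < κ - 1 := by linarith
  have hn : (0 : ℝ) < n := by exact_mod_cast H.n_pos
  set b := C⁻¹ / 2 with hb
  have hb0 : 0 < b := by positivity
  obtain ⟨B₀, hB₀, c₀, hc₀, h₀⟩ := H.exists_norm_jumpOn_le hκ
  obtain ⟨B, hB, c, hc, h⟩ := exists_exp_le_rpow_mul_pow hb0 hκ0
  set d := (1 / b) ^ (1 / (κ - 1)) with hd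
  have hd0 : 0 < d := by positivity
  refine ⟨n * (ρ * (C * B)), by positivity, c * Real.exp d, by positivity, fun N t ht htN => ?_⟩
  -- The threshold on `t` is chosen so that the constant term of Young's inequality, `d t ^
  -- (κ/(κ-1))`, is at most `N d`; after exponentiation it costs only a geometric factor.
  have hyoung : ∀ r, 0 < r → t * r⁻¹ ≤ b / r ^ κ + N * d := by
    intro r hr
    have h1 := mul_le_mul_rpow_add hb0 hκ ht.le (inv_pos.2 hr)
    rw [Real.inv_rpow hr.le, ← div_eq_mul_inv b] at h1
    have h2 : t * (t / b) ^ (1 / (κ - 1)) ≤ N * d := by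
      rw [div_eq_mul_one_div t b, Real.mul_rpow ht.le (by positivity), ← mul_assoc]
      refine mul_le_mul_of_nonneg_right ?_ hd0.le
      have e1 : t * t ^ (1 / (κ - 1)) = t ^ (κ / (κ - 1)) := by
        rw [← Real.rpow_one_add' ht.le (by positivity)]
        congr 1; field_simp; ring
      have e2 : ((N : ℝ) ^ (1 - 1 / κ)) ^ (κ / (κ - 1)) = N := by
        rw [← Real.rpow_mul (Nat.cast_nonneg N),
          show (1 - 1 / κ) * (κ / (κ - 1)) = 1 by field_simp, Real.rpow_one]
      rw [e1, ← e2]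
      exact Real.rpow_le_rpow ht.le htN (by positivity)
    linarith
  have hterm : ∀ j ∈ Finset.range (n - 1), ‖expInt
      (fun r => jumpOn n G j r * (polar r (halfRay n (j + 1)))⁻¹)
      (fun r => (polar r (halfRay n (j + 1)))⁻¹) 0 ρ t - ∑ m ∈ Finset.range N,
        (t : ℂ) ^ m / m.factorial * ∫ r in (0 : ℝ)..ρ,
          jumpOn n G j r / polar r (halfRay n (j + 1)) ^ (m + 1)‖ ≤
      ρ * (C * B * (c * Real.exp d) ^ N * (N : ℝ) ^ (1 / κ * N) * (t ^ N / N.factorial)) := by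
    intro j hj
    have hj := Finset.mem_range.1 hj
    have := norm_expInt_sub_sum_le (t := t) (N := N) hρ.le ht.le
      ((H.continuousOn_jumpOn hj).mul (continuousOn_inv_ray ρ (halfRay n (j + 1))))
      (continuousOn_inv_ray ρ (halfRay n (j + 1)))
      (fun m => B₀ * c₀ ^ m * (m : ℝ) ^ (1 / κ * m))
      (K := C * B * (c * Real.exp d) ^ N * (N : ℝ) ^ (1 / κ * N) * (t ^ N / N.factorial))
      (fun m r hr => ?_) (fun r hr => ?_)
    · rw [sub_zero] at this
      refine le_of_eq_of_le ?_ this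
      congr 2
      refine Finset.sum_congr rfl fun m _ => ?_
      congr 1
      refine intervalIntegral.integral_congr fun r _ => ?_
      simp only [Pi.mul_apply]
      rw [pow_succ, div_eq_mul_inv, mul_inv, inv_pow]; ring
    · have hr0 := hr.1
      simp only [Pi.mul_apply]
      rw [norm_mul, norm_inv_polar hr.1, mul_assoc, ← pow_succ', inv_pow, ← div_eq_mul_inv,
        div_le_iff₀ (by positivity)]
      exact h₀ j hj m r hr.1 hr.2
    · have hr0 := hr.1
      simp only [Pi.mul_apply]
      rw [norm_mul, norm_inv_polar hr.1]
      have e1 : Real.exp (-C⁻¹ / r ^ κ) * Real.exp (t * r⁻¹) ≤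
          Real.exp (-b / r ^ κ) * Real.exp d ^ N := by
        rw [← Real.exp_nat_mul, ← Real.exp_add, ← Real.exp_add]
        apply Real.exp_le_exp.2
        have e : -C⁻¹ / r ^ κ = -b / r ^ κ - b / r ^ κ := by rw [hb]; ring
        rw [e]
        linarith [hyoung r hr.1]
      calc _ ≤ C * Real.exp (-C⁻¹ / r ^ κ) * r⁻¹ *
            ((t * r⁻¹) ^ N / N.factorial * Real.exp (t * r⁻¹)) := by
              gcongr; exact H.norm_jumpOn_le hj hr.1 hr.2
        _ = C * (Real.exp (-C⁻¹ / r ^ κ) * Real.exp (t * r⁻¹)) * r⁻¹ *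
            ((t * r⁻¹) ^ N / N.factorial) := by ring
        _ ≤ C * (Real.exp (-b / r ^ κ) * Real.exp d ^ N) * r⁻¹ *
            ((t * r⁻¹) ^ N / N.factorial) := by gcongr
        _ ≤ C * ((B * c ^ N * (N : ℝ) ^ (1 / κ * N) * r ^ (N + 1)) * Real.exp d ^ N) * r⁻¹ *
            ((t * r⁻¹) ^ N / N.factorial) := by gcongr; exact h N r hr.1
        _ = _ := by
          rw [mul_pow, mul_pow, inv_pow]
          field_simp
          ring
  have e : jumpBorel n G ρ t - ∑ m ∈ Finset.range N, (t : ℂ) ^ m / m.factorial *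
      jumpCoeff n G ρ m = ∑ j ∈ Finset.range (n - 1), (expInt
      (fun r => jumpOn n G j r * (polar r (halfRay n (j + 1)))⁻¹)
      (fun r => (polar r (halfRay n (j + 1)))⁻¹) 0 ρ t - ∑ m ∈ Finset.range N,
        (t : ℂ) ^ m / m.factorial * ∫ r in (0 : ℝ)..ρ,
          jumpOn n G j r / polar r (halfRay n (j + 1)) ^ (m + 1)) := by
    rw [Finset.sum_sub_distrib, Finset.sum_comm]
    simp only [jumpBorel, jumpCoeff, Finset.mul_sum]
  rw [e]
  refine (norm_sum_le_of_le _ hterm).trans ?_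
  rw [Finset.sum_const, Finset.card_range, nsmul_eq_mul]
  have : ((n - 1 : ℕ) : ℝ) ≤ n := by exact_mod_cast Nat.sub_le n 1
  calc _ ≤ (n : ℝ) * (ρ * (C * B * (c * Real.exp d) ^ N * (N : ℝ) ^ (1 / κ * N) *
        (t ^ N / N.factorial))) := by gcongr
    _ = _ := by ring

/-- For large `t` no cancellation is needed: the function is bounded by its exponential growth, and
each term of the Taylor polynomial by the term of index `N`. -/
lemma norm_jumpBorel_sub_le_of_ge (H : HalfDiscData n G ρ C κ) (hκ : 1 < κ) :
    ∃ A > 0, ∃ c > 0, ∀ (N : ℕ) (t : ℝ), 0 < t → (N : ℝ) ^ (1 - 1 / κ) ≤ t →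
      ‖jumpBorel n G ρ t - ∑ m ∈ Finset.range N, (t : ℂ) ^ m / m.factorial * jumpCoeff n G ρ m‖ ≤
        A * c ^ N * (N : ℝ) ^ (1 / κ * N) * (t ^ N / N.factorial) * Real.exp (ρ⁻¹ * t) := by
  have hρ := H.ρ_pos
  obtain ⟨B₀, hB₀, h₀⟩ := H.exists_norm_jumpBorel_le hκ
  obtain ⟨B, hB, c, hc, h⟩ := H.exists_norm_jumpCoeff_le hκ
  have hs : 0 < 1 / κ := by have : 0 < κ := by linarith
                            positivity
  refine ⟨B₀ + B, by positivity, 2 * max c 1, by positivity, fun N t ht htN => ?_⟩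
  have hc1 : 1 ≤ max c 1 := le_max_right _ _
  have hexp : 1 ≤ Real.exp (ρ⁻¹ * t) := Real.one_le_exp (by positivity)
  have key := fun m (hm : m ≤ N) => pow_div_factorial_mul_rpow_le hs ht htN hm
  set Q := (N : ℝ) ^ (1 / κ * N) * (t ^ N / N.factorial) with hQ
  have hQ1 : 1 ≤ Q := by simpa using key 0 (Nat.zero_le N)
  -- The number of terms is absorbed into the geometric factor.
  have hN2 : (N : ℝ) ≤ 2 ^ N := by exact_mod_cast Nat.lt_two_pow_self.le
  have h21 : (1 : ℝ) ≤ (2 * max c 1) ^ N := one_le_pow₀ (by linarith)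
  have hsum : ‖∑ m ∈ Finset.range N, (t : ℂ) ^ m / m.factorial * jumpCoeff n G ρ m‖ ≤
      B * (2 * max c 1) ^ N * Q := by
    have : ∀ m ∈ Finset.range N, ‖(t : ℂ) ^ m / m.factorial * jumpCoeff n G ρ m‖ ≤
        B * max c 1 ^ N * Q := by
      intro m hm
      have hm := (Finset.mem_range.1 hm).le
      rw [norm_mul, norm_div, norm_pow, Complex.norm_real, Real.norm_eq_abs, abs_of_pos ht,
        Complex.norm_natCast]
      have hcm : c ^ m ≤ max c 1 ^ N :=
        (pow_le_pow_left₀ hc.le (le_max_left c 1) m).trans (pow_le_pow_right₀ hc1 hm)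
      calc _ ≤ t ^ m / m.factorial * (B * c ^ m * (m : ℝ) ^ (1 / κ * m)) := by
            gcongr; exact h m
        _ = B * c ^ m * (t ^ m / m.factorial * (m : ℝ) ^ (1 / κ * m)) := by ring
        _ ≤ B * max c 1 ^ N * Q := by gcongr; exact key m hm
    refine (norm_sum_le_of_le _ this).trans ?_
    rw [Finset.sum_const, Finset.card_range, nsmul_eq_mul, mul_pow]
    calc _ ≤ 2 ^ N * (B * max c 1 ^ N * Q) := by gcongr
      _ = _ := by ring
  calc _ ≤ B₀ * Real.exp (ρ⁻¹ * t) + B * (2 * max c 1) ^ N * Q :=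
        (norm_sub_le _ _).trans (add_le_add (h₀ t ht.le) hsum)
    _ ≤ B₀ * ((2 * max c 1) ^ N * Q * Real.exp (ρ⁻¹ * t)) +
        B * ((2 * max c 1) ^ N * Q * Real.exp (ρ⁻¹ * t)) := by
        refine add_le_add (mul_le_mul_of_nonneg_left ?_ hB₀) ?_
        · exact le_mul_of_one_le_left (by positivity) (one_le_mul_of_one_le_of_one_le h21 hQ1)
        · rw [mul_assoc B]
          exact mul_le_mul_of_nonneg_left (le_mul_of_one_le_right (by positivity) hexp) hB.le
    _ = _ := by rw [hQ]; ring

lemma norm_jumpBorel_sub_le (H : HalfDiscData n G ρ C κ) (hκ : 1 < κ) :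
    ∃ A > 0, ∃ c > 0, ∀ (N : ℕ) (t : ℝ), 0 < t →
      ‖jumpBorel n G ρ t - ∑ m ∈ Finset.range N, (t : ℂ) ^ m / m.factorial * jumpCoeff n G ρ m‖ ≤
        A * c ^ N * (N : ℝ) ^ (1 / κ * N) * (t ^ N / N.factorial) * Real.exp (ρ⁻¹ * t) := by
  have hρ := H.ρ_pos
  obtain ⟨A₁, hA₁, c₁, hc₁, h₁⟩ := H.norm_jumpBorel_sub_le_of_le hκ
  obtain ⟨A₂, hA₂, c₂, hc₂, h₂⟩ := H.norm_jumpBorel_sub_le_of_ge hκ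
  refine ⟨max A₁ A₂, by positivity, max c₁ c₂, by positivity, fun N t ht => ?_⟩
  have hexp : 1 ≤ Real.exp (ρ⁻¹ * t) := Real.one_le_exp (by positivity)
  rcases le_total t ((N : ℝ) ^ (1 - 1 / κ)) with htN | htN
  · refine (h₁ N t ht htN).trans ((le_mul_of_one_le_right (by positivity) hexp).trans ?_)
    gcongr
    · exact le_max_left _ _
    · exact le_max_left _ _
  · refine (h₂ N t ht htN).trans ?_
    gcongr
    · exact le_max_right _ _
    · exact le_max_right _ _

/-- Decay of order `1` together with jumps of order `κ` give decay of order `κ`. -/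
theorem exists_norm_le (H : HalfDiscData n G ρ C κ) (hκ : 1 < κ) {i : ℕ} (hi : i < n) :
    ∃ A > 0, ∃ b > 0, ∃ ε > 0, ∀ r₀ y₀ : ℝ, 0 < r₀ → r₀ < ε →
      |y₀ - (-(Real.pi / 2) + (i + 1 / 2) * (Real.pi / n))| < Real.pi / (4 * n) →
      ‖G i (polar r₀ y₀)‖ ≤ A * Real.exp (-b / r₀ ^ κ) := by
  have hρ := H.ρ_pos
  have hC := H.C_pos
  have hpi := Real.pi_pos
  have hκ0 : 0 < κ := by linarith
  have hs : 0 < 1 / κ := by positivity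
  have hn : (0 : ℝ) < n := by exact_mod_cast H.n_pos
  have hn1 : (1 : ℝ) ≤ n := by exact_mod_cast H.n_pos
  obtain ⟨A, hA, c, hc, h⟩ := H.norm_jumpBorel_sub_le hκ
  obtain ⟨B, hB, d, hd, hJ⟩ := H.exists_norm_jumpOn_le hκ
  -- A quarter of the opening of a sector: a point this close to the middle direction makes an angle
  -- of at least `δ` with all the rays, including the imaginary axis.
  set δ := Real.pi / (4 * n) with hδ
  have hδ0 : 0 < δ := by positivity
  have hδle : δ ≤ Real.pi / 4 := by
    rw [hδ]; apply div_le_div_of_nonneg_left hpi.le (by positivity); linarith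
  have hπδ : Real.pi / n = 4 * δ := by rw [hδ]; field_simp
  set σ := Real.sin δ with hσ
  have hσ0 : 0 < σ := Real.sin_pos_of_pos_of_lt_pi hδ0 (by linarith)
  set c₀ := Real.sqrt (1 - Real.cos δ ^ 2) with hc₀
  have hc₀0 : 0 < c₀ := by
    rw [hc₀, ← Real.sin_sq]; exact Real.sqrt_pos.2 (by positivity)
  set A' := n * (ρ * (B / c₀)) + A * (2 / σ) with hA'
  set c' := max d (c * (2 / σ)) with hc'
  have hc'0 : 0 < c' := lt_max_of_lt_left hd
  refine ⟨A' * Real.exp 1, by positivity, (Real.exp 1 * c') ^ (-1 / (1 / κ)), by positivity,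
    ρ * σ / 2, by positivity, fun r₀ y₀ hr₀ hr₀ε hy₀ => ?_⟩
  have hi1 : (i : ℝ) + 1 ≤ n := by exact_mod_cast hi
  have hi0 : (0 : ℝ) ≤ i := Nat.cast_nonneg i
  rw [abs_lt, hπδ] at hy₀
  have hnδ : (n : ℝ) * (4 * δ) = Real.pi := by rw [← hπδ]; field_simp
  have hy1 : halfRay n i + δ < y₀ := by rw [halfRay, hπδ]; nlinarith [hy₀.1]
  have hy2 : y₀ < halfRay n (i + 1) - δ := by rw [halfRay, hπδ]; push_cast; nlinarith [hy₀.2]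
  have hy3 : -(Real.pi / 2) + δ < y₀ := by
    have : 0 ≤ (i : ℝ) * (4 * δ) := by positivity
    rw [halfRay, hπδ] at hy1; linarith
  have hy4 : y₀ < Real.pi / 2 - δ := by
    have : ((i : ℝ) + 1) * (4 * δ) ≤ n * (4 * δ) := by gcongr
    rw [halfRay, hπδ] at hy2; push_cast at hy2; linarith
  have hcos : σ ≤ Real.cos y₀ := by
    rw [hσ, ← Real.cos_pi_div_two_sub, ← Real.cos_abs y₀]
    apply Real.cos_le_cos_of_nonneg_of_le_pi (abs_nonneg _) (by linarith)
    rw [abs_le]; constructor <;> linarith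
  have hre : σ / r₀ ≤ Real.cos y₀ / r₀ := by gcongr
  -- The radius `ρ σ / 2` serves this purpose: `Re z₀⁻¹ ≥ σ / r₀` exceeds the growth rate `ρ⁻¹` by
  -- at least `σ / (2 r₀)`, so the Laplace remainder is of size `r₀ ^ (N + 1)`.
  have hgap : ρ⁻¹ ≤ σ / (2 * r₀) := by
    rw [inv_eq_one_div, div_le_div_iff₀ hρ (by positivity)]
    linarith
  have hσr : σ / r₀ = σ / (2 * r₀) + σ / (2 * r₀) := by field_simp; ring
  have hσr0 : 0 < σ / (2 * r₀) := by positivity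
  obtain ⟨v, hv, hG⟩ := H.formula hκ hi hr₀ (y₀ := y₀) (by linarith) (by linarith) (by linarith)
  set z₀ := polar r₀ y₀ with hz₀
  have hz₀0 : z₀ ≠ 0 := polar_ne_zero hr₀ _
  have hz₀n : ‖z₀‖ = r₀ := norm_polar_of_pos hr₀ _
  have hw : (z₀⁻¹).re = Real.cos y₀ / r₀ := re_inv_polar r₀ y₀
  have hw0 : 0 < (z₀⁻¹).re := by rw [hw]; exact div_pos (by linarith) hr₀
  have hdist : ∀ j < n - 1, ∀ r ∈ Set.Ioc (0 : ℝ) ρ,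
      c₀ * ‖polar r (halfRay n (j + 1))‖ ≤ ‖polar r (halfRay n (j + 1)) - z₀‖ := by
    intro j hj r hr
    rw [norm_polar_of_pos hr.1]
    refine mul_le_norm_polar_sub hr.1 hr₀ (cos_le_cos_of_abs_mem hδ0.le ?_ ?_)
    · have hmono : ∀ {a b : ℕ}, a ≤ b → halfRay n a ≤ halfRay n b := fun h =>
        monotone_nat_of_le_succ (halfRay_le_succ n) h
      rcases le_or_gt (j + 1) i with hji | hji
      · have := hmono hji
        rw [abs_of_nonpos (by linarith)]; linarith
      · have := hmono (Nat.succ_le_of_lt hji)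
        rw [Nat.succ_eq_add_one] at this
        rw [abs_of_nonneg (by linarith)]; linarith
    · have hj1 : (j : ℝ) + 1 ≤ n := by exact_mod_cast (by omega : j + 1 ≤ n)
      have : ((j : ℝ) + 1) * (4 * δ) ≤ n * (4 * δ) := by gcongr
      have : 0 ≤ ((j : ℝ) + 1) * (4 * δ) := by positivity
      rw [halfRay, hπδ]; push_cast
      rw [abs_le]; constructor <;> linarith
  have hbound : ∀ N : ℕ, ‖G i z₀‖ ≤ A' * c' ^ N * (N : ℝ) ^ (1 / κ * N) * r₀ ^ N := by
    intro N
    have hL := hv.sub (HasLaplace.sum (s := Finset.range N) fun m _ =>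
      (show HasLaplace z₀⁻¹ (fun t => jumpCoeff n G ρ m / m.factorial * t ^ m)
        (jumpCoeff n G ρ m / m.factorial * (m.factorial / z₀⁻¹ ^ (m + 1))) from
      HasLaplace.const_mul ⟨integrableOn_exp_mul_pow hw0 m, integral_exp_mul_pow hw0 m⟩ _))
    have h1 := norm_integral_exp_mul_le (w := z₀⁻¹) (R := ρ⁻¹)
      (A := A * c ^ N * (N : ℝ) ^ (1 / κ * N)) (N := N) (f := fun t => jumpBorel n G ρ t -
        ∑ m ∈ Finset.range N, jumpCoeff n G ρ m / m.factorial * (t : ℂ) ^ m)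
      (by rw [hw]; linarith) (fun t ht => by
        refine le_of_eq_of_le ?_ (h N t ht)
        congr 2
        exact Finset.sum_congr rfl fun m _ => by ring)
    rw [hL.2] at h1
    set V := v - ∑ m ∈ Finset.range N, jumpCoeff n G ρ m / m.factorial *
      (m.factorial / z₀⁻¹ ^ (m + 1)) with hV
    have h2 : ‖z₀⁻¹ * V‖ ≤ A * (2 / σ) * (c * (2 / σ)) ^ N * (N : ℝ) ^ (1 / κ * N) * r₀ ^ N := by
      rw [norm_mul, norm_inv, hz₀n]
      calc _ ≤ r₀⁻¹ * (A * c ^ N * (N : ℝ) ^ (1 / κ * N) / (σ / (2 * r₀)) ^ (N + 1)) := by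
            gcongr
            refine h1.trans ?_
            gcongr
            rw [hw]; linarith
        _ = _ := by
            rw [div_pow, mul_pow c, div_pow, div_div_eq_mul_div, mul_pow, pow_succ, pow_succ,
              pow_succ]
            field_simp
    have h3 : ∀ j ∈ Finset.range (n - 1), ‖(∫ r in (0 : ℝ)..ρ, jumpOn n G j r /
          (polar r (halfRay n (j + 1)) - z₀)) - ∑ m ∈ Finset.range N, z₀ ^ m *
          ∫ r in (0 : ℝ)..ρ, jumpOn n G j r / polar r (halfRay n (j + 1)) ^ (m + 1)‖ ≤
        (ρ - 0) * ((B * d ^ N * (N : ℝ) ^ (1 / κ * N)) / c₀) * r₀ ^ N := by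
      intro j hj
      have hj := Finset.mem_range.1 hj
      rw [← hz₀n]
      exact norm_integral_div_sub_sum_le (γ := fun r => polar r (halfRay n (j + 1))) hρ.le hc₀0
        (H.continuousOn_jumpOn hj) (continuous_polar_left _).continuousOn
        (fun r hr => polar_ne_zero hr.1 _) (hdist j hj)
        (fun m => B * d ^ m * (m : ℝ) ^ (1 / κ * m)) (fun m r hr => by
          rw [norm_polar_of_pos hr.1]; exact hJ j hj m r hr.1 hr.2) N
    -- The Laplace transform of `t ^ m / m!` at `1/z₀` is `z₀ ^ (m + 1)`. After multiplication by
    -- `1/z₀` the Taylor polynomial reproduces the expansion of the Cauchy integrals, so only the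
    -- two remainders are left.
    have e : 2 * Real.pi * Complex.I * G i z₀ = ∑ j ∈ Finset.range (n - 1),
        ((∫ r in (0 : ℝ)..ρ, jumpOn n G j r / (polar r (halfRay n (j + 1)) - z₀)) -
          ∑ m ∈ Finset.range N, z₀ ^ m *
          ∫ r in (0 : ℝ)..ρ, jumpOn n G j r / polar r (halfRay n (j + 1)) ^ (m + 1)) -
        z₀⁻¹ * V := by
      rw [hG, Finset.sum_sub_distrib, Finset.sum_comm, hV, mul_sub]
      have : ∑ m ∈ Finset.range N, ∑ j ∈ Finset.range (n - 1), z₀ ^ m *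
          ∫ r in (0 : ℝ)..ρ, jumpOn n G j r / polar r (halfRay n (j + 1)) ^ (m + 1) =
          z₀⁻¹ * ∑ m ∈ Finset.range N, jumpCoeff n G ρ m / m.factorial *
            (m.factorial / z₀⁻¹ ^ (m + 1)) := by
        rw [Finset.mul_sum]
        refine Finset.sum_congr rfl fun m _ => ?_
        rw [← Finset.mul_sum, ← jumpCoeff]
        have : (m.factorial : ℂ) ≠ 0 := by exact_mod_cast Nat.factorial_ne_zero m
        rw [inv_pow, div_inv_eq_mul, pow_succ]
        field_simp
      rw [this]; ring
    have h4 : ‖2 * Real.pi * Complex.I * G i z₀‖ ≤ n * ((ρ - 0) *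
        ((B * d ^ N * (N : ℝ) ^ (1 / κ * N)) / c₀) * r₀ ^ N) +
        A * (2 / σ) * (c * (2 / σ)) ^ N * (N : ℝ) ^ (1 / κ * N) * r₀ ^ N := by
      rw [e]
      refine (norm_sub_le _ _).trans (add_le_add ((norm_sum_le_of_le _ h3).trans ?_) h2)
      rw [Finset.sum_const, Finset.card_range, nsmul_eq_mul]
      have : ((n - 1 : ℕ) : ℝ) ≤ n := by exact_mod_cast Nat.sub_le n 1
      rw [sub_zero]
      gcongr
    have h5 : ‖G i z₀‖ ≤ ‖2 * Real.pi * Complex.I * G i z₀‖ := by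
      rw [norm_mul]
      refine le_mul_of_one_le_left (norm_nonneg _) ?_
      simp only [norm_mul, Complex.norm_I, Complex.norm_real, Real.norm_eq_abs, abs_of_pos hpi,
        Complex.norm_ofNat]
      linarith [Real.pi_gt_three]
    refine h5.trans (h4.trans ?_)
    calc _ = n * (ρ * (B / c₀)) * d ^ N * (N : ℝ) ^ (1 / κ * N) * r₀ ^ N +
          A * (2 / σ) * (c * (2 / σ)) ^ N * (N : ℝ) ^ (1 / κ * N) * r₀ ^ N := by ring
      _ ≤ n * (ρ * (B / c₀)) * c' ^ N * (N : ℝ) ^ (1 / κ * N) * r₀ ^ N +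
          A * (2 / σ) * c' ^ N * (N : ℝ) ^ (1 / κ * N) * r₀ ^ N := by
          gcongr
          · exact le_max_left _ _
          · exact le_max_right _ _
      _ = _ := by rw [hA']; ring
  have := le_exp_of_forall_le_pow (A := A') (by positivity) hc'0 hs hr₀ hbound
  rwa [one_div_one_div] at this

/-- A function without jumps vanishes. -/
theorem eq_zero (H : HalfDiscData n G ρ C 2) {i : ℕ} (hi : i < n)
    (hJ : ∀ j < n - 1, ∀ r, 0 < r → r ≤ ρ → G (j + 1) (polar r (halfRay n (j + 1))) =
      G j (polar r (halfRay n (j + 1)))) {r₀ y₀ : ℝ}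
    (hr₀ : 0 < r₀) (hr₀ρ : ρ⁻¹ < Real.cos y₀ / r₀) (h1 : halfRay n i < y₀)
    (h2 : y₀ < halfRay n (i + 1)) : G i (polar r₀ y₀) = 0 := by
  have hρ := H.ρ_pos
  -- Any exponent above `1` would do in place of `2`, as the jumps vanish; the formula in terms of
  -- the jumps then gives zero.
  obtain ⟨v, hv, hG⟩ := H.formula one_lt_two hi hr₀ hr₀ρ h1 h2
  have hJ0 : ∀ j ∈ Finset.range (n - 1), ∀ r ∈ Set.Ioc 0 ρ, jumpOn n G j r = 0 := by
    intro j hj r hr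
    rw [jumpOn, hJ j (Finset.mem_range.1 hj) r hr.1 hr.2, sub_self, zero_mul]
  have hint : ∀ (f : ℝ → ℂ), (∀ r ∈ Set.Ioc 0 ρ, f r = 0) → ∫ r in (0 : ℝ)..ρ, f r = 0 := by
    intro f hf
    rw [intervalIntegral.integral_of_le hρ.le]
    exact MeasureTheory.setIntegral_eq_zero_of_forall_eq_zero hf
  have hb : ∀ t, jumpBorel n G ρ t = 0 := fun t => by
    rw [jumpBorel]
    exact Finset.sum_eq_zero fun j hj => hint _ fun r hr => by simp only [hJ0 j hj r hr, zero_mul]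
  have hv0 : v = 0 := by
    rw [← hv.2]; simp [hb]
  rw [hv0, mul_zero, sub_zero, Finset.sum_eq_zero fun j hj => hint _ fun r hr => by
    rw [hJ0 j hj r hr, zero_div]] at hG
  simpa [Real.pi_ne_zero] using hG

end HalfDiscData

/-! ### The relative Watson lemma and Watson's lemma on an arc -/

lemma log_polar {r y : ℝ} (hr : 0 < r) (hy : |y| < Real.pi) :
    Complex.log (polar r y) = Real.log r + y * Complex.I := by
  have h : polar r y = Complex.exp (Real.log r + y * Complex.I) := by
    rw [Complex.exp_add, ← Complex.ofReal_exp, Real.exp_log hr, polar]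
  rw [abs_lt] at hy
  rw [h, Complex.log_exp] <;> simp <;> linarith

lemma polar_mem_slitPlane {r y : ℝ} (hr : 0 < r) (hy : |y| < Real.pi) :
    polar r y ∈ Complex.slitPlane := by
  rw [Complex.mem_slitPlane_iff_arg]
  refine ⟨?_, polar_ne_zero hr y⟩
  rw [← Complex.log_im, log_polar hr hy]
  simpa using ((le_abs_self y).trans_lt hy).ne

lemma polar_mul_polar (r s x y : ℝ) : polar r x * polar s y = polar (r * s) (x + y) := by
  simp only [polar]; push_cast; rw [add_mul, Complex.exp_add]; ring

lemma polar_cpow {r y : ℝ} (hr : 0 < r) (hy : |y| < Real.pi) (s : ℝ) :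
    polar r y ^ (s : ℂ) = polar (r ^ s) (s * y) := by
  rw [Complex.cpow_def_of_ne_zero (polar_ne_zero hr y), log_polar hr hy, polar,
    Real.rpow_def_of_pos hr, Complex.ofReal_exp, ← Complex.exp_add]
  congr 1; push_cast; ring

/-- The rotated root that maps the right half plane to a sector of opening `π / k` around the
direction `φ`. -/
noncomputable def sectorMap (k φ : ℝ) (u : ℂ) : ℂ := polar 1 φ * u ^ ((1 / k : ℝ) : ℂ)

lemma sectorMap_polar {k φ r y : ℝ} (hr : 0 < r) (hy : |y| < Real.pi) :
    sectorMap k φ (polar r y) = polar (r ^ (1 / k)) (φ + y / k) := by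
  rw [sectorMap, polar_cpow hr hy, polar_mul_polar, one_mul, one_div_mul_eq_div]

lemma analyticAt_sectorMap {k φ r y : ℝ} (hr : 0 < r) (hy : |y| < Real.pi) :
    AnalyticAt ℂ (sectorMap k φ) (polar r y) :=
  analyticAt_const.mul (analyticAt_id.cpow analyticAt_const (polar_mem_slitPlane hr hy))

lemma abs_lt_pi_of_halfRay {n j : ℕ} (hj : j < n) {y : ℝ} (h1 : halfRay n j ≤ y)
    (h2 : y ≤ halfRay n (j + 1)) : |y| < Real.pi := by
  have hmono : ∀ {a b : ℕ}, a ≤ b → halfRay n a ≤ halfRay n b := fun h =>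
    monotone_nat_of_le_succ (halfRay_le_succ n) h
  have h3 := hmono (Nat.zero_le j)
  have h4 := hmono (Nat.succ_le_of_lt hj)
  rw [halfRay_zero] at h3
  rw [Nat.succ_eq_add_one, halfRay_self (by omega)] at h4
  have := Real.pi_pos
  rw [abs_lt]; constructor <;> linarith

/-- The `k`-th root carries the half plane to a sector of opening `π/k`. Pulling back divides the
orders of flatness by `k`: `k` becomes `1` and `k'` becomes `k'/k`. -/
lemma exists_halfDiscData {k k' φ : ℝ} (hk : 0 < k) {n : ℕ} (hn : 0 < n) {g : ℕ → ℂ → ℂ}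
    (hg : ∀ j < n, ∀ y : ℝ, φ + halfRay n j / k ≤ y → y ≤ φ + halfRay n (j + 1) / k →
      ExpFlat k (g j) y)
    (hg' : ∀ j < n - 1, ExpFlat k' (fun z => g (j + 1) z - g j z)
      ((φ + halfRay n (j + 1) / k : ℝ) : Real.Angle)) :
    ∃ ρ C, HalfDiscData n (fun j u => g j (sectorMap k φ u)) ρ C (k' / k) := by
  have hbd : ∃ C, ∃ ρ > 0, ∀ j < n, ∀ r, 0 < r → r ≤ ρ → 0 < C ∧
      ∀ y, φ + halfRay n j / k ≤ y → y ≤ φ + halfRay n (j + 1) / k →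
      AnalyticAt ℂ (g j) (polar r y) ∧
        (0 < r → ‖g j (polar r y)‖ ≤ C * Real.exp (-C⁻¹ / r ^ k)) := by
    refine exists_uniform_finite (Q := fun j C r => 0 < C ∧
      ∀ y, φ + halfRay n j / k ≤ y → y ≤ φ + halfRay n (j + 1) / k →
      AnalyticAt ℂ (g j) (polar r y) ∧
        (0 < r → ‖g j (polar r y)‖ ≤ C * Real.exp (-C⁻¹ / r ^ k)))
      (fun j C C' r hC h => ⟨h.1.trans_le hC, fun y h1 h2 => ⟨(h.2 y h1 h2).1, fun hr =>
        ((h.2 y h1 h2).2 hr).trans (mul_exp_neg_inv_div_mono h.1 hC (by positivity))⟩⟩)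
      n fun j hj => ?_
    obtain ⟨C, ρ, hρ, h⟩ := exists_uniform_expFlat (hg j hj)
    have hle : φ + halfRay n j / k ≤ φ + halfRay n (j + 1) / k := by
      gcongr; exact halfRay_le_succ n j
    exact ⟨C, ρ, hρ, fun r h1 h2 => ⟨(h r _ h1 h2 le_rfl hle).1, fun y h3 h4 =>
      ⟨(h r y h1 h2 h3 h4).2.1, fun _ => (h r y h1 h2 h3 h4).2.2⟩⟩⟩
  have hjump : ∃ C, ∃ ρ > 0, ∀ j < n - 1, ∀ r, 0 < r → r ≤ ρ → 0 < C ∧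
      (0 < r → ‖g (j + 1) (polar r (φ + halfRay n (j + 1) / k)) -
        g j (polar r (φ + halfRay n (j + 1) / k))‖ ≤ C * Real.exp (-C⁻¹ / r ^ k')) := by
    refine exists_uniform_finite (Q := fun j C r => 0 < C ∧
      (0 < r → ‖g (j + 1) (polar r (φ + halfRay n (j + 1) / k)) -
        g j (polar r (φ + halfRay n (j + 1) / k))‖ ≤ C * Real.exp (-C⁻¹ / r ^ k')))
      (fun j C C' r hC h => ⟨h.1.trans_le hC, fun hr =>
        (h.2 hr).trans (mul_exp_neg_inv_div_mono h.1 hC (by positivity))⟩) (n - 1) fun j hj => ?_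
    obtain ⟨C, ρ, hρ, h⟩ := exists_uniform_expFlat (α := φ + halfRay n (j + 1) / k)
      (β := φ + halfRay n (j + 1) / k) (fun y h1 h2 => by
        rw [le_antisymm h2 h1]; exact hg' j hj)
    exact ⟨C, ρ, hρ, fun r h1 h2 => ⟨(h r _ h1 h2 le_rfl le_rfl).1,
      fun _ => (h r _ h1 h2 le_rfl le_rfl).2.2⟩⟩
  obtain ⟨C₁, ρ₁, hρ₁, h₁⟩ := hbd
  obtain ⟨C₂, ρ₂, hρ₂, h₂⟩ := hjump
  have hC₁ : 0 < C₁ := (h₁ 0 hn _ hρ₁ le_rfl).1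
  have hρ : 0 < min ρ₁ ρ₂ := lt_min hρ₁ hρ₂
  have hroot : ∀ r, 0 < r → r ≤ min ρ₁ ρ₂ ^ k →
      0 < r ^ (1 / k) ∧ r ^ (1 / k) ≤ ρ₁ ∧ r ^ (1 / k) ≤ ρ₂ := by
    intro r h1 h2
    have : r ^ (1 / k) ≤ min ρ₁ ρ₂ := by
      calc _ ≤ (min ρ₁ ρ₂ ^ k) ^ (1 / k) := by gcongr
        _ = _ := by rw [← Real.rpow_mul hρ.le, mul_one_div_cancel hk.ne', Real.rpow_one]
    exact ⟨by positivity, this.trans (min_le_left _ _), this.trans (min_le_right _ _)⟩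
  refine ⟨min ρ₁ ρ₂ ^ k, max C₁ C₂, hn, by positivity, lt_max_of_lt_left hC₁, ?_, ?_, ?_⟩
  · intro j hj r y h1 h2 h3 h4
    obtain ⟨h5, h6, -⟩ := hroot r h1 h2
    have hy := abs_lt_pi_of_halfRay hj h3 h4
    refine AnalyticAt.fun_comp ?_ (analyticAt_sectorMap h1 hy)
    rw [sectorMap_polar h1 hy]
    exact (((h₁ j hj _ h5 h6).2 _ (by gcongr) (by gcongr))).1
  · intro j hj r y h1 h2 h3 h4
    obtain ⟨h5, h6, -⟩ := hroot r h1 h2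
    rw [sectorMap_polar h1 (abs_lt_pi_of_halfRay hj h3 h4)]
    have := (((h₁ j hj _ h5 h6).2 (φ + y / k) (by gcongr) (by gcongr))).2 h5
    rw [← Real.rpow_mul h1.le, one_div_mul_cancel hk.ne', Real.rpow_one] at this
    exact this.trans (mul_exp_neg_inv_div_mono hC₁ (le_max_left _ _) h1.le)
  · intro j hj r h1 h2
    obtain ⟨h5, -, h6⟩ := hroot r h1 h2
    rw [sectorMap_polar h1 (abs_lt_pi_of_halfRay (by omega) (halfRay_le_succ n j) le_rfl)]
    have := (h₂ j hj _ h5 h6).2 h5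
    rw [← Real.rpow_mul h1.le, one_div_mul_eq_div] at this
    exact this.trans (mul_exp_neg_inv_div_mono (h₂ j hj _ h5 h6).1 (le_max_right _ _)
      (by positivity))

lemma eq_sectorMap_polar {k φ r y : ℝ} (hk : 0 < k) (hr : 0 < r)
    (hy : |k * (y - φ)| < Real.pi) :
    polar r y = sectorMap k φ (polar (r ^ k) (k * (y - φ))) := by
  rw [sectorMap_polar (by positivity) hy, ← Real.rpow_mul hr.le, mul_one_div_cancel hk.ne',
    Real.rpow_one, mul_div_cancel_left₀ _ hk.ne', add_sub_cancel]

lemma mem_closedArc_coe {φ k y : ℝ} (h : |y - φ| ≤ Real.pi / (2 * k)) :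
    (y : Real.Angle) ∈ closedArc φ k :=
  ⟨y - φ, h, by rw [← Real.Angle.coe_add]; congr 1; ring⟩

lemma exists_of_mem_closedArc_coe {φ k : ℝ} {η : Real.Angle} (h : η ∈ closedArc φ k) :
    ∃ y : ℝ, |y - φ| ≤ Real.pi / (2 * k) ∧ η = y := by
  obtain ⟨t, ht, rfl⟩ := h
  exact ⟨φ + t, by simpa using ht, by rw [Real.Angle.coe_add]⟩

lemma add_halfRay_div {k φ s : ℝ} (n j : ℕ) :
    φ + s + halfRay n j / k =
      φ - Real.pi / (2 * k) + s + j * (2 * (Real.pi / (2 * k)) / n) := by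
  rw [halfRay]
  rcases eq_or_ne k 0 with rfl | hk
  · simp
  rcases eq_or_ne n 0 with rfl | hn
  · simp; field_simp; ring
  have : (n : ℝ) ≠ 0 := by exact_mod_cast hn
  field_simp; ring

/-- **Relative Watson lemma**: a section of `𝒜^k/𝒜^{k'}` over a closed arc of opening `π/k`
vanishes. -/
theorem IsQuotSection.expFlat {k k' : ℝ} (hk : 0 < k) (hkk : k < k') {φ : Real.Angle}
    {q : Real.Angle → ℂ → ℂ} (hq : IsQuotSection k' (closedArc φ k) q)
    (hflat : ∀ η ∈ closedArc φ k, ExpFlat k (q η) η) {η : Real.Angle} (hη : η ∈ closedArc φ k) :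
    ExpFlat k' (q η) η := by
  induction φ using Real.Angle.induction_on with
  | _ φ =>
  obtain ⟨x, hx, rfl⟩ := exists_of_mem_closedArc_coe hη
  have hpi := Real.pi_pos
  set L := Real.pi / (2 * k) with hL
  have hL0 : 0 < L := by positivity
  -- A local representative is flat of order `k`, because `q` is and their difference is flatter
  -- still. By openness this persists slightly beyond the ends of the arc, where nothing is known
  -- about `q`; hence the guard on the second property.
  obtain ⟨n, i, s, a, hin, hs, hxi, ha⟩ := exists_partition hL0 hx
    (P := fun (g : ℂ → ℂ) (y : ℝ) => ExpFlat k g y ∧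
      (|y - φ| ≤ L → ExpFlat k' (fun z => q y z - g z) y)) (by
    intro y hy
    obtain ⟨U, hU, g, -, hg⟩ := hq y (mem_closedArc_coe hy)
    have h1 := (hflat y (mem_closedArc_coe hy)).sub
      ((hg y ⟨mem_of_mem_nhds hU, mem_closedArc_coe hy⟩).mono hkk.le)
    simp only [sub_sub_cancel] at h1
    refine ⟨g, ?_⟩
    have h2 : ∀ᶠ y' : ℝ in 𝓝 y, ExpFlat k g y' := by
      have := h1.eventually
      rwa [nhds_angle, Filter.eventually_map] at this
    filter_upwards [h2, Real.Angle.continuous_coe.continuousAt.preimage_mem_nhds hU] with y' h3 h4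
    exact ⟨h3, fun h5 => hg _ ⟨h4, mem_closedArc_coe h5⟩⟩)
  have hn : 0 < n := by omega
  have hn0 : (0 : ℝ) < n := by exact_mod_cast hn
  set w := 2 * L / n with hw
  have hLw : L / n = w / 2 := by rw [hw]; ring
  have hnw : n * w = 2 * L := by rw [hw]; field_simp
  have hw0 : 0 < w := by positivity
  rw [hLw, abs_le] at hs
  obtain ⟨ρ, C, hH⟩ := exists_halfDiscData (k' := k') (φ := φ + s) hk hn (g := a)
    (fun j hj y h1 h2 => by
      rw [add_halfRay_div] at h1 h2
      exact (ha j hj y h1 h2).1)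
    (fun j hj => by
      rw [add_halfRay_div]
      have hj1 : (j : ℝ) + 2 ≤ n := by exact_mod_cast (by omega : j + 2 ≤ n)
      have hj0 : (0 : ℝ) ≤ j := Nat.cast_nonneg j
      -- The shift is at most half a sector, so all interior rays stay in the closed arc and both
      -- adjacent representatives can be compared with `q` there.
      have hy : |φ - L + s + (j + 1 : ℕ) * w - φ| ≤ L := by
        push_cast
        rw [abs_le]; constructor <;> nlinarith
      have h1 := (ha j (by omega) (φ - L + s + (j + 1 : ℕ) * w) (by push_cast; linarith)
        le_rfl).2 hy
      have h2 := (ha (j + 1) (by omega) (φ - L + s + (j + 1 : ℕ) * w) le_rfl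
        (by push_cast; linarith)).2 hy
      have h3 := h1.sub h2
      simpa only [sub_sub_sub_cancel_left] using h3)
  obtain ⟨A, hA, b, hb, ε, hε, hest⟩ := hH.exists_norm_le (by rwa [lt_div_iff₀ hk, one_mul]) hin
  have hxm := ha i hin x (by rw [hxi]; nlinarith) (by rw [hxi]; push_cast; nlinarith)
  have hmid : k * (x - (φ + s)) = -(Real.pi / 2) + (i + 1 / 2) * (Real.pi / n) := by
    rw [hxi, hw, hL]; field_simp; ring
  have hga : ExpFlat k' (a i) x := by
    refine ⟨hxm.1.1, A, b, hA, hb, eventually_dirNhds_iff.2 ⟨min (ε ^ (1 / k))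
      (Real.pi / (4 * n) / k), by positivity, fun r y h1 h2 h3 => ?_⟩⟩
    have h4 : |k * (y - (φ + s)) - (-(Real.pi / 2) + (i + 1 / 2) * (Real.pi / n))| <
        Real.pi / (4 * n) := by
      rw [← hmid, ← mul_sub, sub_sub_sub_cancel_right, abs_mul, abs_of_pos hk, mul_comm,
        ← lt_div_iff₀ hk]
      exact h3.trans_le (min_le_right _ _)
    have hi1 : (i : ℝ) + 1 ≤ n := by exact_mod_cast hin
    have hq : Real.pi / (4 * n) = Real.pi / n / 4 := by rw [div_div, mul_comm (n : ℝ)]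
    have hpn : n * (Real.pi / n) = Real.pi := by field_simp
    have hpn0 : 0 < Real.pi / n := by positivity
    have h5 : |k * (y - (φ + s))| < Real.pi := by
      rw [hq, abs_lt] at h4
      have hi0 : (0 : ℝ) ≤ i := Nat.cast_nonneg i
      have : 0 ≤ i * (Real.pi / n) := by positivity
      have : ((i : ℝ) + 1) * (Real.pi / n) ≤ n * (Real.pi / n) := by gcongr
      rw [abs_lt]; constructor <;> linarith
    rw [norm_polar_of_pos h1, eq_sectorMap_polar hk h1 h5]
    have h6 : r ^ k < ε := by
      calc r ^ k < (ε ^ (1 / k)) ^ k := by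
            apply Real.rpow_lt_rpow h1.le (h2.trans_le (min_le_left _ _)) hk
        _ = ε := by rw [← Real.rpow_mul hε.le, one_div_mul_cancel hk.ne', Real.rpow_one]
    have := hest (r ^ k) (k * (y - (φ + s))) (by positivity) h6 h4
    rwa [← Real.rpow_mul h1.le, mul_div_cancel₀ _ hk.ne'] at this
  have := (hxm.2 hx).add hga
  simpa only [sub_add_cancel] using this

/-- **Watson's lemma**. -/
theorem eqNear_zero_of_expFlat {k : ℝ} (hk : 0 < k) {φ : Real.Angle} {f : ℂ → ℂ}
    (hflat : ∀ η ∈ closedArc φ k, ExpFlat k f η) : EqNear (closedArc φ k) f (fun _ => 0) := by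
  intro η hη
  induction φ using Real.Angle.induction_on with
  | _ φ =>
  obtain ⟨x, hx, rfl⟩ := exists_of_mem_closedArc_coe hη
  have hpi := Real.pi_pos
  set L := Real.pi / (2 * k) with hL
  have hL0 : 0 < L := by positivity
  obtain ⟨n, i, s, -, hin, hs, hxi, ha⟩ := exists_partition hL0 hx
    (P := fun (_ : Unit) (y : ℝ) => ExpFlat k f y) (by
    intro y hy
    refine ⟨(), ?_⟩
    have := (hflat y (mem_closedArc_coe hy)).eventually
    rwa [nhds_angle, Filter.eventually_map] at this)
  have hn : 0 < n := by omega
  have hn0 : (0 : ℝ) < n := by exact_mod_cast hn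
  -- The same function on all sectors has no jumps, so `k'` is arbitrary; `2 * k` gives the order
  -- ratio `2`.
  obtain ⟨ρ, C, hH⟩ := exists_halfDiscData (k' := 2 * k) (φ := φ + s) hk hn (g := fun _ => f)
    (fun j hj y h1 h2 => by
      rw [add_halfRay_div] at h1 h2
      exact ha j hj y h1 h2)
    (fun j hj => by simpa only [sub_self] using expFlat_zero _ _)
  rw [mul_div_cancel_right₀ _ hk.ne'] at hH
  have hρ := hH.ρ_pos
  have hmid : k * (x - (φ + s)) = -(Real.pi / 2) + (i + 1 / 2) * (Real.pi / n) := by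
    rw [hxi, hL]; field_simp; ring
  have hi1 : (i : ℝ) + 1 ≤ n := by exact_mod_cast hin
  have hi0 : (0 : ℝ) ≤ i := Nat.cast_nonneg i
  have hpn : n * (Real.pi / n) = Real.pi := by field_simp
  have hpn0 : 0 < Real.pi / n := by positivity
  have hi2 : 0 ≤ i * (Real.pi / n) := by positivity
  have hi3 : ((i : ℝ) + 1) * (Real.pi / n) ≤ n * (Real.pi / n) := by gcongr
  have hcos : 0 < Real.cos (k * (x - (φ + s))) := by
    apply Real.cos_pos_of_mem_Ioo
    rw [hmid]; constructor <;> linarith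
  have hev : ∀ᶠ y in 𝓝 x, Real.cos (k * (x - (φ + s))) / 2 < Real.cos (k * (y - (φ + s))) ∧
      halfRay n i < k * (y - (φ + s)) ∧ k * (y - (φ + s)) < halfRay n (i + 1) := by
    have hc : Continuous fun y => k * (y - (φ + s)) := by fun_prop
    have hc' : Continuous fun y => Real.cos (k * (y - (φ + s))) := by fun_prop
    refine (hc'.continuousAt.eventually_const_lt (half_lt_self hcos)).and
      ((hc.continuousAt.eventually_const_lt ?_).and (hc.continuousAt.eventually_lt_const ?_))
    · beta_reduce; rw [hmid, halfRay]; linarith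
    · beta_reduce; rw [hmid, halfRay]; push_cast; linarith
  obtain ⟨δ, hδ, hev⟩ := Metric.eventually_nhds_iff.1 hev
  set c := Real.cos (k * (x - (φ + s))) with hc
  refine eventually_dirNhds_iff.2 ⟨min ((ρ * (c / 2)) ^ (1 / k)) δ, by positivity,
    fun r y h1 h2 h3 => ?_⟩
  obtain ⟨h4, h5, h6⟩ := hev (y := y) (by rw [Real.dist_eq]; exact h3.trans_le (min_le_right _ _))
  have h7 := abs_lt_pi_of_halfRay hin h5.le h6.le
  rw [eq_sectorMap_polar hk h1 h7]
  have h8 : r ^ k < ρ * (c / 2) := by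
    calc r ^ k < ((ρ * (c / 2)) ^ (1 / k)) ^ k := by
          apply Real.rpow_lt_rpow h1.le (h2.trans_le (min_le_left _ _)) hk
      _ = _ := by rw [← Real.rpow_mul (by positivity), one_div_mul_cancel hk.ne', Real.rpow_one]
  refine hH.eq_zero hin (fun _ _ _ _ _ => rfl) (by positivity) ?_ h5 h6
  rw [inv_eq_one_div, div_lt_div_iff₀ hρ (by positivity), one_mul]
  nlinarith

/-! ### Sums of convergent power series -/

/-- Finite partial sums are bounded by products of partial geometric sums, one for each variable. -/
lemma summable_pow_degree {ι : Type*} [Fintype ι] {x : ℝ} (h0 : 0 ≤ x) (h1 : x < 1) :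
    Summable fun d : ι →₀ ℕ => x ^ d.degree := by
  classical
  refine summable_of_sum_le (c := ∏ _i : ι, (1 - x)⁻¹) (fun d => by positivity) fun s => ?_
  obtain ⟨M, hM⟩ : ∃ M, ∀ d ∈ s, d.degree < M :=
    ⟨s.sup Finsupp.degree + 1, fun d hd => Nat.lt_succ_of_le (Finset.le_sup hd)⟩
  calc ∑ d ∈ s, x ^ d.degree = ∑ p ∈ s.map Finsupp.equivFunOnFinite.toEmbedding,
        ∏ i, x ^ p i := by
        rw [Finset.sum_map]
        refine Finset.sum_congr rfl fun d _ => ?_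
        rw [Finset.prod_pow_eq_pow_sum, Finsupp.degree_eq_sum]; rfl
    _ ≤ ∑ p ∈ Fintype.piFinset fun _ : ι => Finset.range M, ∏ i, x ^ p i := by
        refine Finset.sum_le_sum_of_subset_of_nonneg (fun p hp => ?_) fun p _ _ => by positivity
        obtain ⟨d, hd, rfl⟩ := Finset.mem_map.1 hp
        rw [Fintype.mem_piFinset]
        exact fun i => Finset.mem_range.2 ((Finsupp.le_degree i d).trans_lt (hM d hd))
    _ = ∏ _i : ι, ∑ e ∈ Finset.range M, x ^ e := (Finset.prod_univ_sum _ _).symm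
    _ ≤ _ := by
        refine Finset.prod_le_prod (fun _ _ => Finset.sum_nonneg fun e _ => by positivity)
          fun _ _ => ?_
        rw [← tsum_geometric_of_lt_one h0 h1]
        exact (summable_geometric_of_lt_one h0 h1).sum_le_tsum _ fun e _ => by positivity

lemma norm_finsuppProd_le {ι : Type*} {v : ι → ℂ} {x : ℝ} (hv : ∀ i, ‖v i‖ ≤ x) (d : ι →₀ ℕ) :
    ‖d.prod fun i e => v i ^ e‖ ≤ x ^ d.degree := by
  rw [Finsupp.prod, norm_prod, Finsupp.degree_apply, ← Finset.prod_pow_eq_pow_sum]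
  refine Finset.prod_le_prod (fun i _ => norm_nonneg _) fun i _ => ?_
  rw [norm_pow]
  exact pow_le_pow_left₀ (norm_nonneg _) (hv i) _

lemma IsConvergent.exists_pos {ι : Type*} {F : MvPowerSeries ι ℂ} (hF : IsConvergent F) :
    ∃ A > 0, ∃ C > 0, ∀ d : ι →₀ ℕ, ‖MvPowerSeries.coeff d F‖ ≤ A * C ^ d.degree := by
  obtain ⟨A, C, h⟩ := hF
  refine ⟨|A| + 1, by positivity, |C| + 1, by positivity, fun d => (h d).trans ?_⟩
  calc _ ≤ |A * C ^ d.degree| := le_abs_self _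
    _ = |A| * |C| ^ d.degree := by rw [abs_mul, abs_pow]
    _ ≤ _ := by gcongr <;> linarith

/-- Properties of the sum of a convergent power series in a polydisc. -/
lemma IsConvergent.exists_polydisc {ι : Type*} [Fintype ι] {F : MvPowerSeries ι ℂ}
    (hF : IsConvergent F) :
    ∃ ρ > 0, (∀ N, ∃ c, 0 ≤ c ∧ ∀ s : Finset (ι →₀ ℕ), (∀ d, d ∈ s ↔ d.degree < N) →
        ∀ (v : ι → ℂ) (x : ℝ), x ≤ ρ → (∀ i, ‖v i‖ ≤ x) → 0 ≤ x →
          ‖seriesSum F v - ∑ d ∈ s, MvPowerSeries.coeff d F * d.prod fun i e => v i ^ e‖ ≤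
            c * x ^ N) ∧
      ∀ (v : ι → ℂ → ℂ) (U : Set ℂ), IsOpen U → (∀ i, DifferentiableOn ℂ (v i) U) →
        (∀ i, ∀ z ∈ U, ‖v i z‖ ≤ ρ) →
          DifferentiableOn ℂ (fun z => seriesSum F (fun i => v i z)) U := by
  obtain ⟨A, hA, C, hC, h⟩ := hF.exists_pos
  have hsum : Summable fun d : ι →₀ ℕ => (1 / 2 : ℝ) ^ d.degree :=
    summable_pow_degree (by norm_num) (by norm_num)
  have hterm : ∀ (v : ι → ℂ) (x : ℝ), (∀ i, ‖v i‖ ≤ x) → 0 ≤ x → ∀ d : ι →₀ ℕ,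
      ‖MvPowerSeries.coeff d F * d.prod fun i e => v i ^ e‖ ≤ A * (C * x) ^ d.degree := by
    intro v x hv hx d
    rw [norm_mul, mul_pow, ← mul_assoc]
    exact mul_le_mul (h d) (norm_finsuppProd_le hv d) (norm_nonneg _) (by positivity)
  have hterm' : ∀ (v : ι → ℂ), (∀ i, ‖v i‖ ≤ 1 / (2 * C)) → ∀ d : ι →₀ ℕ,
      ‖MvPowerSeries.coeff d F * d.prod fun i e => v i ^ e‖ ≤ A * (1 / 2) ^ d.degree := by
    intro v hv d
    have := hterm v _ hv (by positivity) d
    rwa [show C * (1 / (2 * C)) = 1 / 2 by field_simp] at this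
  -- Half of the radius of the known majorant leaves a spare factor `(1/2) ^ |d|` for summability.
  refine ⟨1 / (2 * C), by positivity, fun N => ⟨A * (2 * C) ^ N * ∑' d : ι →₀ ℕ,
    (1 / 2 : ℝ) ^ d.degree, by positivity, fun s hs v x hxρ hv hx => ?_⟩, ?_⟩
  · have hS : Summable fun d : ι →₀ ℕ =>
        MvPowerSeries.coeff d F * d.prod fun i e => v i ^ e :=
      Summable.of_norm_bounded (hsum.mul_left A) (hterm' v fun i => (hv i).trans hxρ)
    rw [seriesSum, ← hS.sum_add_tsum_compl (s := s), add_sub_cancel_left]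
    have hb : ∀ d : ((s : Set (ι →₀ ℕ))ᶜ : Set (ι →₀ ℕ)), ‖MvPowerSeries.coeff d.1 F *
        d.1.prod fun i e => v i ^ e‖ ≤ A * (2 * C) ^ N * x ^ N * (1 / 2) ^ d.1.degree := by
      intro d
      have hd : N ≤ d.1.degree := by
        by_contra hcon
        exact d.2 ((hs d.1).2 (by omega))
      have h2 : 2 * C * x ≤ 1 := by
        rw [le_div_iff₀ (by positivity)] at hxρ; linarith
      calc _ ≤ A * (C * x) ^ d.1.degree := hterm v x hv hx d.1
        _ = A * (2 * C * x) ^ d.1.degree * (1 / 2) ^ d.1.degree := by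
            rw [mul_assoc A, ← mul_pow]; congr 2; ring
        _ ≤ A * (2 * C * x) ^ N * (1 / 2) ^ d.1.degree := by
            have := pow_le_pow_of_le_one (by positivity) h2 hd
            gcongr
        _ = _ := by rw [mul_pow _ x]; ring
    have hsub : Summable fun d : ((s : Set (ι →₀ ℕ))ᶜ : Set (ι →₀ ℕ)) =>
        A * (2 * C) ^ N * x ^ N * (1 / 2 : ℝ) ^ d.1.degree :=
      (hsum.subtype _).mul_left _
    refine (tsum_of_norm_bounded hsub.hasSum hb).trans ?_
    rw [tsum_mul_left]
    have hle : ∑' d : ((s : Set (ι →₀ ℕ))ᶜ : Set (ι →₀ ℕ)), (1 / 2 : ℝ) ^ d.1.degree ≤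
        ∑' d : ι →₀ ℕ, (1 / 2 : ℝ) ^ d.degree :=
      hsum.tsum_subtype_le _ _ fun d => by positivity
    calc _ ≤ A * (2 * C) ^ N * x ^ N * ∑' d : ι →₀ ℕ, (1 / 2 : ℝ) ^ d.degree := by gcongr
      _ = _ := by ring
  · intro v U hU hv hvρ
    unfold seriesSum
    refine Complex.differentiableOn_tsum_of_summable_norm (hsum.mul_left A) (fun d => ?_) hU
      fun d z hz => hterm' _ (fun i => hvρ i z hz) d
    refine DifferentiableOn.const_mul ?_ _
    unfold Finsupp.prod
    exact DifferentiableOn.fun_finsetProd fun i _ => (hv i).pow _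

/-- Lipschitz continuity of the sum of a convergent power series. -/
lemma IsConvergent.exists_lipschitz {ι : Type*} [Fintype ι] {F : MvPowerSeries ι ℂ}
    (hF : IsConvergent F) :
    ∃ ρ > 0, ∃ K > 0, ∀ (v v' : ι → ℂ) (δ : ℝ), (∀ i, ‖v i‖ ≤ ρ) → (∀ i, ‖v' i‖ ≤ ρ) → 0 < δ →
      (∀ i, ‖v i - v' i‖ ≤ δ) → ‖seriesSum F v - seriesSum F v'‖ ≤ K * δ := by
  obtain ⟨ρ, hρ, h1, h2⟩ := hF.exists_polydisc
  obtain ⟨M, hM, hb⟩ := h1 0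
  have hbd : ∀ v : ι → ℂ, (∀ i, ‖v i‖ ≤ ρ) → ‖seriesSum F v‖ ≤ M := by
    intro v hv
    simpa using hb ∅ (by simp) v ρ le_rfl hv hρ.le
  refine ⟨ρ / 2, by positivity, (2 * M + 1) * 4 / ρ, by positivity, fun v v' δ hv hv' hδ hvv => ?_⟩
  -- For `δ` not small the bound on the function itself suffices.
  rcases le_or_gt (ρ / 4) δ with hδρ | hδρ
  · refine (norm_sub_le _ _).trans ((add_le_add (hbd v fun i => (hv i).trans (by linarith))
      (hbd v' fun i => (hv' i).trans (by linarith))).trans ?_)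
    rw [div_mul_eq_mul_div, le_div_iff₀ hρ]
    nlinarith
  -- Schwarz's lemma on the complex line through `v'` and `v`: the line stays in the larger polydisc
  -- for `|t| < R`, and the points correspond to `t = 0` and `t = 1`.
  set R := ρ / (2 * δ) with hR
  have hR1 : 1 < R := by rw [hR, lt_div_iff₀ (by positivity)]; linarith
  set w : ι → ℂ → ℂ := fun i t => v' i + t * (v i - v' i) with hw
  have hwρ : ∀ i, ∀ t ∈ Metric.ball (0 : ℂ) R, ‖w i t‖ ≤ ρ := by
    intro i t ht
    rw [Metric.mem_ball, dist_zero_right] at ht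
    calc ‖w i t‖ ≤ ‖v' i‖ + ‖t‖ * ‖v i - v' i‖ := by
          rw [← norm_mul]; exact norm_add_le _ _
      _ ≤ ρ / 2 + R * δ := by gcongr; exacts [hv' i, hvv i]
      _ = ρ := by rw [hR]; field_simp; ring
  have hd := h2 w (Metric.ball 0 R) Metric.isOpen_ball (fun i => by fun_prop) hwρ
  have hmaps : Set.MapsTo (fun t => seriesSum F fun i => w i t) (Metric.ball 0 R)
      (Metric.ball (seriesSum F fun i => w i 0) (2 * M + 1)) := by
    intro t ht
    rw [Metric.mem_ball, dist_eq_norm]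
    have h3 := hbd _ fun i => hwρ i t ht
    have h4 := hbd _ fun i => hwρ i 0 (Metric.mem_ball_self (by linarith))
    have := norm_sub_le (seriesSum F fun i => w i t) (seriesSum F fun i => w i 0)
    linarith
  have hs := Complex.dist_le_div_mul_dist_of_mapsTo_ball hd
    (hmaps.mono_right Metric.ball_subset_closedBall) (z := 1)
    (by rw [Metric.mem_ball, dist_zero_right, norm_one]; exact hR1)
  rw [dist_zero_right, norm_one, mul_one, dist_eq_norm] at hs
  simp only [hw, one_mul, add_sub_cancel, zero_mul, add_zero] at hs
  refine hs.trans ?_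
  rw [hR, div_div_eq_mul_div, div_mul_eq_mul_div]
  gcongr ?_ / _
  nlinarith

/-! ### The algebra of asymptotic expansions -/

lemma eval_trunc (F : PowerSeries ℂ) (N : ℕ) (z : ℂ) :
    (PowerSeries.trunc N F).eval z = ∑ n ∈ Finset.range N, PowerSeries.coeff n F * z ^ n :=
  PowerSeries.eval₂_trunc_eq_sum_range z (RingHom.id ℂ) N F

lemma exists_norm_eval_le (p : Polynomial ℂ) (N : ℕ) (hp : ∀ n < N, p.coeff n = 0) :
    ∃ c, ∀ z : ℂ, ‖z‖ ≤ 1 → ‖p.eval z‖ ≤ c * ‖z‖ ^ N := by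
  obtain ⟨q, rfl⟩ := Polynomial.X_pow_dvd_iff.2 hp
  obtain ⟨c, hc⟩ := (isCompact_closedBall (0 : ℂ) 1).exists_bound_of_continuousOn
    (f := fun z => q.eval z) q.continuous.continuousOn
  refine ⟨c, fun z hz => ?_⟩
  have := hc z (by simpa using hz)
  rw [Polynomial.eval_mul, Polynomial.eval_pow, Polynomial.eval_X, norm_mul, norm_pow, mul_comm]
  gcongr

lemma exists_norm_eval_sub_eval_le (p q : Polynomial ℂ) (N : ℕ)
    (h : ∀ n < N, p.coeff n = q.coeff n) :
    ∃ c, ∀ z : ℂ, ‖z‖ ≤ 1 → ‖p.eval z - q.eval z‖ ≤ c * ‖z‖ ^ N := by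
  obtain ⟨c, hc⟩ := exists_norm_eval_le (p - q) N fun n hn => by
    rw [Polynomial.coeff_sub, h n hn, sub_self]
  exact ⟨c, fun z hz => by simpa using hc z hz⟩

/-- The pairs of a function on `V` and an asymptotic expansion of it. -/
noncomputable def asympSubalgebra (V : Set ℂ) : Subalgebra ℂ ((ℂ → ℂ) × PowerSeries ℂ) where
  carrier := {x | ∀ N, ∃ c, ∀ z ∈ V, ‖z‖ ≤ 1 →
    ‖x.1 z - (PowerSeries.trunc N x.2).eval z‖ ≤ c * ‖z‖ ^ N}
  mul_mem' := by
    intro x y hx hy N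
    obtain ⟨c, hc⟩ := hx N
    obtain ⟨d, hd⟩ := hy N
    obtain ⟨c₀, hc₀⟩ := hx 0
    obtain ⟨d₀, hd₀⟩ := hy 0
    set p := PowerSeries.trunc N x.2 with hp
    set q := PowerSeries.trunc N y.2 with hq
    -- Truncation is not multiplicative, but the product of the truncations agrees with the
    -- truncation of the product below degree `N`.
    obtain ⟨e, he⟩ := exists_norm_eval_sub_eval_le (p * q) (PowerSeries.trunc N (x.2 * y.2)) N (by
      intro n hn
      rw [← PowerSeries.trunc_trunc_mul_trunc, PowerSeries.coeff_trunc, if_pos hn, ← hp, ← hq,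
        ← Polynomial.coe_mul, Polynomial.coeff_coe])
    obtain ⟨b, hb⟩ := (isCompact_closedBall (0 : ℂ) 1).exists_bound_of_continuousOn
      (f := fun z => p.eval z) p.continuous.continuousOn
    refine ⟨|c| * |d₀| + |b| * |d| + e, fun z hz hz1 => ?_⟩
    have h1 := hc z hz hz1
    have h2 := hd z hz hz1
    have h3 := hd₀ z hz hz1
    have h4 := he z hz1
    have h5 := hb z (by simpa using hz1)
    simp only [PowerSeries.trunc_zero', Polynomial.eval_zero, sub_zero, pow_zero, mul_one] at h3
    have e1 : (x * y).1 z - (PowerSeries.trunc N (x * y).2).eval z =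
        (x.1 z - p.eval z) * y.1 z + p.eval z * (y.1 z - q.eval z) +
          ((p * q).eval z - (PowerSeries.trunc N (x.2 * y.2)).eval z) := by
      simp only [Prod.fst_mul, Pi.mul_apply, Prod.snd_mul, Polynomial.eval_mul]; ring
    rw [e1]
    refine (norm_add_le _ _).trans ?_
    rw [add_mul]
    refine add_le_add ((norm_add_le _ _).trans ?_) h4
    rw [norm_mul, norm_mul, add_mul]
    refine add_le_add ?_ ?_
    · calc _ ≤ (|c| * ‖z‖ ^ N) * |d₀| := by
            gcongr
            · exact h1.trans (by gcongr; exact le_abs_self c)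
            · exact h3.trans (le_abs_self _)
        _ = _ := by ring
    · calc _ ≤ |b| * (|d| * ‖z‖ ^ N) := by
            gcongr
            · exact h5.trans (le_abs_self _)
            · exact h2.trans (by gcongr; exact le_abs_self d)
        _ = _ := by ring
  add_mem' := by
    intro x y hx hy N
    obtain ⟨c, hc⟩ := hx N
    obtain ⟨d, hd⟩ := hy N
    refine ⟨c + d, fun z hz hz1 => ?_⟩
    have e1 : (x + y).1 z - (PowerSeries.trunc N (x + y).2).eval z =
        (x.1 z - (PowerSeries.trunc N x.2).eval z) +
          (y.1 z - (PowerSeries.trunc N y.2).eval z) := by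
      simp only [Prod.fst_add, Pi.add_apply, Prod.snd_add, map_add, Polynomial.eval_add]; ring
    rw [e1, add_mul]
    exact (norm_add_le _ _).trans (add_le_add (hc z hz hz1) (hd z hz hz1))
  algebraMap_mem' := by
    intro a N
    obtain ⟨c, hc⟩ := exists_norm_eval_sub_eval_le (Polynomial.C a)
      (PowerSeries.trunc N (PowerSeries.C a)) N (by
      intro n hn
      rw [PowerSeries.coeff_trunc, if_pos hn, ← Polynomial.coe_C, Polynomial.coeff_coe])
    refine ⟨c, fun z _ hz1 => ?_⟩
    simpa using hc z hz1

lemma mem_asympSubalgebra_mono {V W : Set ℂ} (h : W ⊆ V) {x : (ℂ → ℂ) × PowerSeries ℂ}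
    (hx : x ∈ asympSubalgebra V) : x ∈ asympSubalgebra W := fun N => by
  obtain ⟨c, hc⟩ := hx N
  exact ⟨c, fun z hz => hc z (h hz)⟩

/-- The expansion may be checked one order at a time against any convenient pair. Polynomial
expressions in known pairs are available, as the pairs form an algebra. -/
lemma mem_asympSubalgebra_of_approx {V : Set ℂ} {f : ℂ → ℂ} {F : PowerSeries ℂ}
    (h : ∀ N, ∃ x ∈ asympSubalgebra V, (∃ c, ∀ z ∈ V, ‖z‖ ≤ 1 → ‖f z - x.1 z‖ ≤ c * ‖z‖ ^ N) ∧
      ∀ n < N, PowerSeries.coeff n x.2 = PowerSeries.coeff n F) :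
    (f, F) ∈ asympSubalgebra V := by
  intro N
  obtain ⟨x, hx, ⟨c, hc⟩, hn⟩ := h N
  obtain ⟨d, hd⟩ := hx N
  refine ⟨c + d, fun z hz hz1 => ?_⟩
  have e : PowerSeries.trunc N F = PowerSeries.trunc N x.2 := by
    ext n
    rw [PowerSeries.coeff_trunc, PowerSeries.coeff_trunc]
    split_ifs with h
    · rw [hn n h]
    · rfl
  rw [e, add_mul, ← sub_add_sub_cancel _ (x.1 z)]
  exact (norm_add_le _ _).trans (add_le_add (hc z hz hz1) (hd z hz hz1))

lemma coe_mem_asympSubalgebra (V : Set ℂ) (p : Polynomial ℂ) :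
    ((fun z => p.eval z, (p : PowerSeries ℂ)) : (ℂ → ℂ) × PowerSeries ℂ) ∈ asympSubalgebra V := by
  intro N
  obtain ⟨c, hc⟩ := exists_norm_eval_sub_eval_le p (PowerSeries.trunc N (p : PowerSeries ℂ)) N (by
    intro n hn
    rw [PowerSeries.coeff_trunc, if_pos hn, Polynomial.coeff_coe])
  exact ⟨c, fun z _ hz1 => hc z hz1⟩

lemma exists_norm_le_of_mem_asympSubalgebra {V : Set ℂ} {f : ℂ → ℂ} {F : PowerSeries ℂ}
    (h : (f, F) ∈ asympSubalgebra V) (hF : PowerSeries.constantCoeff F = 0) :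
    ∃ K, ∀ z ∈ V, ‖z‖ ≤ 1 → ‖f z‖ ≤ K * ‖z‖ := by
  obtain ⟨K, hK⟩ := h 1
  refine ⟨K, fun z hz hz1 => ?_⟩
  have := hK z hz hz1
  rwa [eval_trunc, Finset.sum_range_one, PowerSeries.coeff_zero_eq_constantCoeff_apply, hF,
    zero_mul, sub_zero, pow_one] at this

lemma hasAsymp_iff {f : ℂ → ℂ} {F : PowerSeries ℂ} {θ : Real.Angle} :
    HasAsymp f F θ ↔ AnalyticDir f θ ∧ ∃ V ∈ dirNhds θ, (f, F) ∈ asympSubalgebra V := by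
  refine and_congr_right fun _ => ⟨?_, ?_⟩
  · rintro ⟨c, hc⟩
    exact ⟨_, hc, fun N => ⟨c N, fun z hz _ => by rw [eval_trunc]; exact hz N⟩⟩
  · rintro ⟨V, hV, h⟩
    choose c hc using h
    refine ⟨c, ?_⟩
    filter_upwards [hV, eventually_dirNhds_small θ one_pos] with z hz hz1 N
    rw [← eval_trunc]
    exact hc N z hz hz1.2.le

lemma HasAsymp.exists_norm_le {f : ℂ → ℂ} {F : PowerSeries ℂ} {θ : Real.Angle}
    (h : HasAsymp f F θ) (hF : PowerSeries.constantCoeff F = 0) :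
    ∃ K > 0, ∀ᶠ z in dirNhds θ, ‖f z‖ ≤ K * ‖z‖ := by
  obtain ⟨-, V, hV, h⟩ := hasAsymp_iff.1 h
  obtain ⟨K, hK⟩ := exists_norm_le_of_mem_asympSubalgebra h hF
  refine ⟨|K| + 1, by positivity, ?_⟩
  filter_upwards [hV, eventually_dirNhds_small θ one_pos] with z hz hz1
  refine (hK z hz hz1.2.le).trans ?_
  gcongr
  linarith [le_abs_self K]

lemma HasAsymp.eventually_norm_lt {f : ℂ → ℂ} {F : PowerSeries ℂ} {θ : Real.Angle}
    (h : HasAsymp f F θ) (hF : PowerSeries.constantCoeff F = 0) {ε : ℝ} (hε : 0 < ε) :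
    ∀ᶠ z in dirNhds θ, ‖f z‖ < ε := by
  obtain ⟨K, hK, h⟩ := h.exists_norm_le hF
  filter_upwards [h, eventually_dirNhds_small θ (div_pos hε hK)] with z h1 h2
  rw [lt_div_iff₀ hK] at h2
  linarith [h2.2]

/-! ### Composition with a convergent series -/

lemma coeff_finsuppProd_eq_zero {ι : Type*} {Ψ : ι → PowerSeries ℂ}
    (hΨ : ∀ i, PowerSeries.constantCoeff (Ψ i) = 0) {d : ι →₀ ℕ} {n : ℕ} (h : n < d.degree) :
    PowerSeries.coeff n (d.prod fun i e => Ψ i ^ e) = 0 := by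
  have : (PowerSeries.X : PowerSeries ℂ) ^ d.degree ∣ d.prod fun i e => Ψ i ^ e := by
    rw [Finsupp.degree_apply, ← Finset.prod_pow_eq_pow_sum]
    exact Finset.prod_dvd_prod_of_dvd _ _ fun i _ =>
      pow_dvd_pow_of_dvd (PowerSeries.X_dvd_iff.2 (hΨ i)) _
  exact PowerSeries.X_pow_dvd_iff.1 this n h

/-- A monomial of degree `d` in series without constant term has order at least `d`, so only
finitely many monomials reach a given coefficient. -/
lemma coeff_subst_eq_sum {ι : Type*} [Fintype ι] {Ψ : ι → PowerSeries ℂ}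
    (hΨ : ∀ i, PowerSeries.constantCoeff (Ψ i) = 0) (F : MvPowerSeries ι ℂ) {N n : ℕ} (hn : n < N)
    {s : Finset (ι →₀ ℕ)} (hs : ∀ d, d ∈ s ↔ d.degree < N) :
    PowerSeries.coeff n (MvPowerSeries.subst Ψ F : PowerSeries ℂ) =
      ∑ d ∈ s, MvPowerSeries.coeff d F * PowerSeries.coeff n (d.prod fun i e => Ψ i ^ e) := by
  have h := MvPowerSeries.coeff_subst (MvPowerSeries.hasSubst_of_constantCoeff_zero hΨ) F
    (Finsupp.single () n)
  refine h.trans ?_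
  rw [finsum_eq_sum_of_support_subset (s := s)]
  · rfl
  · intro d hd
    rw [Finset.mem_coe, hs]
    by_contra hcon
    refine hd ?_
    have := coeff_finsuppProd_eq_zero hΨ (d := d) (n := n) (by omega)
    simp only [smul_eq_mul]
    exact mul_eq_zero_of_right _ this

lemma exists_finset_degree_lt (ι : Type*) [Finite ι] (N : ℕ) :
    ∃ s : Finset (ι →₀ ℕ), ∀ d, d ∈ s ↔ d.degree < N := by
  have : {d : ι →₀ ℕ | d.degree < N}.Finite :=
    (Finsupp.finite_of_degree_le N).subset fun d (hd : d.degree < N) => hd.le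
  exact ⟨this.toFinset, fun d => by simp⟩

lemma AnalyticDir.seriesSum {ι : Type*} [Fintype ι] {F : MvPowerSeries ι ℂ} (hF : IsConvergent F)
    {v : ι → ℂ → ℂ} {θ : Real.Angle} (hv : ∀ i, AnalyticDir (v i) θ)
    (hv0 : ∀ i, ∀ ε > 0, ∀ᶠ z in dirNhds θ, ‖v i z‖ < ε) :
    AnalyticDir (fun z => seriesSum F fun i => v i z) θ := by
  obtain ⟨ρ, hρ, -, h⟩ := hF.exists_polydisc
  filter_upwards [Filter.eventually_all.2 hv, Filter.eventually_all.2 fun i => hv0 i ρ hρ]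
    with z h1 h2
  have h3 : ∀ᶠ w in 𝓝 z, ∀ i, AnalyticAt ℂ (v i) w ∧ ‖v i w‖ < ρ :=
    Filter.eventually_all.2 fun i => (h1 i).eventually_analyticAt.and
      ((h1 i).continuousAt.norm.eventually_lt_const (h2 i))
  obtain ⟨U, hU, hUo, hz⟩ := eventually_nhds_iff.1 h3
  exact (h v U hUo (fun i w hw => (hU w hw i).1.differentiableAt.differentiableWithinAt)
    fun i w hw => (hU w hw i).2.le).analyticAt (hUo.mem_nhds hz)

lemma HasAsymp.seriesSum {ι : Type*} [Fintype ι] {F : MvPowerSeries ι ℂ} (hF : IsConvergent F)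
    {v : ι → ℂ → ℂ} {Ψ : ι → PowerSeries ℂ} {θ : Real.Angle} (hv : ∀ i, HasAsymp (v i) (Ψ i) θ)
    (hΨ : ∀ i, PowerSeries.constantCoeff (Ψ i) = 0) :
    HasAsymp (fun z => Multisum.seriesSum F fun i => v i z) (MvPowerSeries.subst Ψ F) θ := by
  refine hasAsymp_iff.2 ⟨AnalyticDir.seriesSum hF (fun i => (hv i).1) fun i ε hε =>
    (hv i).eventually_norm_lt (hΨ i) hε, ?_⟩
  obtain ⟨ρ, hρ, h, -⟩ := hF.exists_polydisc
  choose V hV hVv using fun i => (hasAsymp_iff.1 (hv i)).2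
  choose K hK using fun i => exists_norm_le_of_mem_asympSubalgebra (hVv i) (hΨ i)
  set K' := ∑ i, |K i| + 1 with hK'
  have hK'0 : 0 < K' := by positivity
  have hKK' : ∀ i, K i ≤ K' := fun i => (le_abs_self _).trans
    ((Finset.single_le_sum (fun i _ => abs_nonneg (K i)) (Finset.mem_univ i)).trans (by linarith))
  set W : Set ℂ := {z | (∀ i, z ∈ V i) ∧ ‖z‖ < ρ / K'} with hW
  refine ⟨W, ?_, mem_asympSubalgebra_of_approx fun N => ?_⟩
  · filter_upwards [Filter.eventually_all.2 hV, eventually_dirNhds_small θ (div_pos hρ hK'0)]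
      with z h1 h2 using ⟨h1, h2.2⟩
  obtain ⟨s, hs⟩ := exists_finset_degree_lt ι N
  obtain ⟨c, -, hc⟩ := h N
  -- The part of `F` of degree below `N`, evaluated in the algebra of pairs: one expression gives
  -- the approximating function and its series.
  set x : (ℂ → ℂ) × PowerSeries ℂ := ∑ d ∈ s, MvPowerSeries.coeff d F •
    d.prod fun i e => ((v i, Ψ i) : (ℂ → ℂ) × PowerSeries ℂ) ^ e with hx
  refine ⟨x, ?_, ⟨c * K' ^ N, fun z hz hz1 => ?_⟩, fun n hn => ?_⟩
  · exact Subalgebra.sum_mem _ fun d _ => Subalgebra.smul_mem _ (Subalgebra.prod_mem _ fun i _ =>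
      Subalgebra.pow_mem _ (mem_asympSubalgebra_mono (fun z hz => hz.1 i) (hVv i)) _) _
  · have e : x.1 z = ∑ d ∈ s, MvPowerSeries.coeff d F * d.prod fun i e => v i z ^ e := by
      change ((Pi.evalAlgHom ℂ (fun _ : ℂ => ℂ) z).comp
        (AlgHom.fst ℂ (ℂ → ℂ) (PowerSeries ℂ))) x = _
      simp only [hx, map_sum, map_smul, Finsupp.prod, map_prod, map_pow, smul_eq_mul]
      rfl
    rw [e, mul_assoc, ← mul_pow]
    have hz2 := hz.2
    rw [lt_div_iff₀ hK'0] at hz2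
    refine hc s hs _ (K' * ‖z‖) (by linarith) (fun i => ?_) (by positivity)
    exact (hK i z (hz.1 i) hz1).trans (by gcongr; exact hKK' i)
  · rw [coeff_subst_eq_sum hΨ F hn hs]
    change PowerSeries.coeff n ((AlgHom.snd ℂ (ℂ → ℂ) (PowerSeries ℂ)) x) = _
    simp only [hx, map_sum, map_smul, Finsupp.prod, map_prod, map_pow, smul_eq_mul]
    rfl

lemma ExpFlat.seriesSum_sub {ι : Type*} [Fintype ι] {F : MvPowerSeries ι ℂ} (hF : IsConvergent F)
    {v v' : ι → ℂ → ℂ} {Ψ Ψ' : ι → PowerSeries ℂ} {θ : Real.Angle} {k : ℝ}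
    (hv : ∀ i, HasAsymp (v i) (Ψ i) θ) (hv' : ∀ i, HasAsymp (v' i) (Ψ' i) θ)
    (hΨ : ∀ i, PowerSeries.constantCoeff (Ψ i) = 0)
    (hΨ' : ∀ i, PowerSeries.constantCoeff (Ψ' i) = 0)
    (h : ∀ i, ExpFlat k (fun z => v i z - v' i z) θ) :
    ExpFlat k (fun z => Multisum.seriesSum F (fun i => v i z) -
      Multisum.seriesSum F fun i => v' i z) θ := by
  obtain ⟨ρ, hρ, K, hK, hL⟩ := hF.exists_lipschitz
  -- The Lipschitz estimate uses a single bound for all coordinates, so the finitely many amplitudes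
  -- and rates are first made equal.
  have hcommon : ∀ s : Finset ι, ∃ A > 0, ∃ b > 0, ∀ i ∈ s, ∀ᶠ z in dirNhds θ,
      ‖v i z - v' i z‖ ≤ A * Real.exp (-b / ‖z‖ ^ k) := by
    classical
    intro s
    induction s using Finset.induction_on with
    | empty => exact ⟨1, one_pos, 1, one_pos, by simp⟩
    | insert i s _ ih =>
      obtain ⟨A, hA, b, hb, h1⟩ := ih
      obtain ⟨-, A', b', hA', hb', h2⟩ := h i
      refine ⟨max A A', lt_max_of_lt_left hA, min b b', lt_min hb hb', fun j hj => ?_⟩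
      rcases Finset.mem_insert.1 hj with rfl | hj
      · filter_upwards [h2] with z hz
        refine hz.trans ?_
        gcongr
        · exact le_max_right _ _
        · exact min_le_right _ _
      · filter_upwards [h1 j hj] with z hz
        refine hz.trans ?_
        gcongr
        · exact le_max_left _ _
        · exact min_le_left _ _
  obtain ⟨A, hA, b, hb, h1⟩ := hcommon Finset.univ
  refine ⟨(HasAsymp.seriesSum hF hv hΨ).1.sub (HasAsymp.seriesSum hF hv' hΨ').1, K * A, b,
    by positivity, hb, ?_⟩
  filter_upwards [Filter.eventually_all.2 fun i => h1 i (Finset.mem_univ i),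
    Filter.eventually_all.2 fun i => (hv i).eventually_norm_lt (hΨ i) hρ,
    Filter.eventually_all.2 fun i => (hv' i).eventually_norm_lt (hΨ' i) hρ] with z h2 h3 h4
  rw [mul_assoc]
  exact hL _ _ _ (fun i => (h3 i).le) (fun i => (h4 i).le) (by positivity) h2

section sumComp

variable {m n : ℕ} {F : MvPowerSeries (Option (Fin m × Fin n)) ℂ}
  {g g' : Fin m → Fin n → ℂ → ℂ} {G : Fin m → Fin n → PowerSeries ℂ} {θ : Real.Angle}

lemma hasAsymp_id (θ : Real.Angle) : HasAsymp (fun z => z) PowerSeries.X θ :=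
  hasAsymp_iff.2 ⟨Filter.Eventually.of_forall fun _ => analyticAt_id, Set.univ, Filter.univ_mem,
    by simpa using coe_mem_asympSubalgebra Set.univ Polynomial.X⟩

lemma hasAsymp_elim (hg : ∀ i j, HasAsymp (g i j) (G i j) θ) (o : Option (Fin m × Fin n)) :
    HasAsymp (fun z => o.elim z fun p => g p.1 p.2 z)
      (o.elim PowerSeries.X fun p => G p.1 p.2) θ := by
  rcases o with _ | ⟨i, j⟩
  · exact hasAsymp_id θ
  · exact hg i j

lemma constantCoeff_elim (hG : ∀ i j, PowerSeries.constantCoeff (G i j) = 0)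
    (o : Option (Fin m × Fin n)) :
    PowerSeries.constantCoeff (o.elim PowerSeries.X fun p => G p.1 p.2 : PowerSeries ℂ) = 0 := by
  rcases o with _ | ⟨i, j⟩
  · simp
  · exact hG i j

lemma HasAsymp.sumComp (hF : IsConvergent F) (hg : ∀ i j, HasAsymp (g i j) (G i j) θ)
    (hG : ∀ i j, PowerSeries.constantCoeff (G i j) = 0) :
    HasAsymp (sumComp F g) (formalComp F G) θ :=
  HasAsymp.seriesSum hF (hasAsymp_elim hg) (constantCoeff_elim hG)

lemma ExpFlat.sumComp_sub (hF : IsConvergent F) (hg : ∀ i j, HasAsymp (g i j) (G i j) θ)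
    (hg' : ∀ i j, HasAsymp (g' i j) (G i j) θ)
    (hG : ∀ i j, PowerSeries.constantCoeff (G i j) = 0) {k : ℝ}
    (h : ∀ i j, ExpFlat k (fun z => g i j z - g' i j z) θ) :
    ExpFlat k (fun z => sumComp F g z - sumComp F g' z) θ := by
  refine ExpFlat.seriesSum_sub hF (hasAsymp_elim hg) (hasAsymp_elim hg') (constantCoeff_elim hG)
    (constantCoeff_elim hG) fun o => ?_
  rcases o with _ | ⟨i, j⟩
  · simpa using expFlat_zero k θ
  · exact h i j

end sumComp

/-! ### Composition with a polynomial -/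

lemma tendsto_dirNhds {α : Type*} {l : Filter α} {u : α → ℂ} {ψ : Real.Angle}
    (h1 : Tendsto (fun a => ‖u a‖) l (𝓝[>] 0))
    (h2 : Tendsto (fun a => ((u a).arg : Real.Angle)) l (𝓝 ψ)) : Tendsto u l (dirNhds ψ) := by
  refine (Filter.tendsto_map.comp (h1.prodMk h2)).congr fun a => ?_
  simp only [Function.comp_apply]
  rw [Real.Angle.toCircle_coe, Circle.coe_exp, Complex.norm_mul_exp_arg_mul_I]

lemma tendsto_norm_dirNhds (θ : Real.Angle) :
    Tendsto (fun z : ℂ => ‖z‖) (dirNhds θ) (𝓝[>] 0) := by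
  refine tendsto_nhdsWithin_iff.2 ⟨?_, ?_⟩
  · rw [Metric.tendsto_nhds]
    intro ε hε
    filter_upwards [eventually_dirNhds_small θ hε] with z hz
    rw [dist_zero_right, norm_norm]; exact hz.2
  · filter_upwards [eventually_dirNhds_small θ one_pos] with z hz using hz.1

lemma tendsto_dirNhds_nhds (θ : Real.Angle) : Tendsto (fun z : ℂ => z) (dirNhds θ) (𝓝 0) :=
  tendsto_zero_iff_norm_tendsto_zero.2 ((tendsto_norm_dirNhds θ).mono_right nhdsWithin_le_nhds)

lemma tendsto_arg_dirNhds (θ : Real.Angle) :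
    Tendsto (fun z : ℂ => (z.arg : Real.Angle)) (dirNhds θ) (𝓝 θ) := by
  rw [dirNhds, Filter.tendsto_map'_iff]
  refine Filter.tendsto_snd.congr' ?_
  filter_upwards [Filter.tendsto_fst.eventually (self_mem_nhdsWithin :
    ∀ᶠ r in 𝓝[>] (0 : ℝ), r ∈ Set.Ioi 0)] with p hp
  simp only [Function.comp_apply]
  rw [Complex.arg_real_mul _ hp, Real.Angle.arg_toCircle]

lemma exists_eq_X_pow_mul {P : Polynomial ℂ} :
    ∃ Q : Polynomial ℂ, P = Polynomial.X ^ P.natTrailingDegree * Q ∧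
      Q.eval 0 = P.trailingCoeff := by
  obtain ⟨Q, hQ⟩ := Polynomial.X_pow_dvd_iff.2 fun n (hn : n < P.natTrailingDegree) =>
    Polynomial.coeff_eq_zero_of_lt_natTrailingDegree hn
  refine ⟨Q, hQ, ?_⟩
  have : P.trailingCoeff = (Polynomial.X ^ P.natTrailingDegree * Q).coeff P.natTrailingDegree := by
    rw [← hQ]; rfl
  rw [this, Polynomial.coeff_X_pow_mul', if_pos le_rfl, Nat.sub_self,
    Polynomial.coeff_zero_eq_eval_zero]

/-- The direction into which `P` maps the direction `θ`. -/
noncomputable def polyDir (P : Polynomial ℂ) (θ : Real.Angle) : Real.Angle :=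
  P.natTrailingDegree • θ + (Complex.arg P.trailingCoeff : Real.Angle)

lemma continuous_polyDir (P : Polynomial ℂ) : Continuous (polyDir P) :=
  (continuous_nsmul _).add continuous_const

lemma natTrailingDegree_pos {P : Polynomial ℂ} (hP : P ≠ 0) (hP0 : P.eval 0 = 0) :
    0 < P.natTrailingDegree := by
  rw [Nat.pos_iff_ne_zero]
  intro h
  have h1 : P.trailingCoeff ≠ 0 := Polynomial.trailingCoeff_nonzero_iff_nonzero.2 hP
  rw [Polynomial.trailingCoeff, h, Polynomial.coeff_zero_eq_eval_zero] at h1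
  exact h1 hP0

/-- Write `P = X ^ ν Q` with `Q(0) = c`. The argument is additive only modulo `2π`, so the
computation takes place on the circle. -/
lemma tendsto_eval_dirNhds {P : Polynomial ℂ} (hP : P ≠ 0) (hP0 : P.eval 0 = 0)
    (θ : Real.Angle) : Tendsto (fun z => P.eval z) (dirNhds θ) (dirNhds (polyDir P θ)) := by
  obtain ⟨Q, hQ, hQ0⟩ := exists_eq_X_pow_mul (P := P)
  set ν := P.natTrailingDegree with hν
  set c := P.trailingCoeff with hc
  have hc0 : c ≠ 0 := Polynomial.trailingCoeff_nonzero_iff_nonzero.2 hP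
  have hev : ∀ z, P.eval z = z ^ ν * Q.eval z := fun z => by
    conv_lhs => rw [hQ]
    rw [Polynomial.eval_mul, Polynomial.eval_pow, Polynomial.eval_X]
  have hQt : Tendsto (fun z => Q.eval z) (dirNhds θ) (𝓝 c) := by
    rw [← hQ0]; exact (Q.continuous.tendsto 0).comp (tendsto_dirNhds_nhds θ)
  have hQne : ∀ᶠ z in dirNhds θ, Q.eval z ≠ 0 := hQt.eventually_ne hc0
  refine tendsto_dirNhds (tendsto_nhdsWithin_iff.2 ⟨?_, ?_⟩) ?_
  · have : Tendsto (fun z => P.eval z) (dirNhds θ) (𝓝 0) := by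
      rw [← hP0]; exact (P.continuous.tendsto 0).comp (tendsto_dirNhds_nhds θ)
    simpa using this.norm
  · filter_upwards [hQne, eventually_dirNhds_small θ one_pos] with z h1 h2
    have hz : z ≠ 0 := norm_pos_iff.1 h2.1
    rw [Set.mem_Ioi, hev, norm_pos_iff]
    exact mul_ne_zero (pow_ne_zero _ hz) h1
  · have h1 : Tendsto (fun z => ν • (z.arg : Real.Angle) + ((Q.eval z).arg : Real.Angle))
        (dirNhds θ) (𝓝 (polyDir P θ)) :=
      (((continuous_nsmul ν).tendsto θ).comp (tendsto_arg_dirNhds θ)).add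
        ((Complex.continuousAt_arg_coe_angle hc0).tendsto.comp hQt)
    refine h1.congr' ?_
    filter_upwards [hQne, eventually_dirNhds_small θ one_pos] with z h2 h3
    have hz : z ≠ 0 := norm_pos_iff.1 h3.1
    rw [hev, Complex.arg_mul_coe_angle (pow_ne_zero _ hz) h2, Complex.arg_pow_coe_angle]

lemma AnalyticDir.comp_eval {P : Polynomial ℂ} (hP : P ≠ 0) (hP0 : P.eval 0 = 0)
    {θ : Real.Angle} {f : ℂ → ℂ} (hf : AnalyticDir f (polyDir P θ)) :
    AnalyticDir (fun z => f (P.eval z)) θ := by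
  filter_upwards [(tendsto_eval_dirNhds hP hP0 θ).eventually hf] with z hz
  exact AnalyticAt.fun_comp (f := fun z => P.eval z) hz (P.differentiable.analyticAt z)

lemma coeff_compPoly {P : Polynomial ℂ} (hP0 : P.eval 0 = 0) (H : PowerSeries ℂ) {N n : ℕ}
    (hn : n < N) : PowerSeries.coeff n (compPoly H P) =
      ∑ d ∈ Finset.range N, PowerSeries.coeff d H *
        PowerSeries.coeff n ((P : PowerSeries ℂ) ^ d) := by
  have h0 : PowerSeries.constantCoeff (P : PowerSeries ℂ) = 0 := by
    rw [← PowerSeries.coeff_zero_eq_constantCoeff_apply, Polynomial.coeff_coe,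
      Polynomial.coeff_zero_eq_eval_zero, hP0]
  rw [compPoly, PowerSeries.coeff_subst' (PowerSeries.HasSubst.of_constantCoeff_zero' h0),
    finsum_eq_sum_of_support_subset (s := Finset.range N)]
  · rfl
  · intro d hd
    rw [Finset.mem_coe, Finset.mem_range]
    by_contra hcon
    refine hd ?_
    have : PowerSeries.coeff n ((P : PowerSeries ℂ) ^ d) = 0 :=
      PowerSeries.X_pow_dvd_iff.1 (pow_dvd_pow_of_dvd (PowerSeries.X_dvd_iff.2 h0) d) n (by omega)
    simp only [this, smul_zero]

lemma constantCoeff_compPoly {P : Polynomial ℂ} (hP0 : P.eval 0 = 0) {H : PowerSeries ℂ}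
    (hH : PowerSeries.constantCoeff H = 0) : PowerSeries.constantCoeff (compPoly H P) = 0 := by
  rw [← PowerSeries.coeff_zero_eq_constantCoeff_apply, coeff_compPoly hP0 H zero_lt_one,
    Finset.sum_range_one, PowerSeries.coeff_zero_eq_constantCoeff_apply, hH, zero_mul]

lemma HasAsymp.comp_eval {P : Polynomial ℂ} (hP : P ≠ 0) (hP0 : P.eval 0 = 0)
    {θ : Real.Angle} {f : ℂ → ℂ} {H : PowerSeries ℂ} (hf : HasAsymp f H (polyDir P θ)) :
    HasAsymp (fun z => f (P.eval z)) (compPoly H P) θ := by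
  refine hasAsymp_iff.2 ⟨hf.1.comp_eval hP hP0, ?_⟩
  obtain ⟨V, hV, h⟩ := (hasAsymp_iff.1 hf).2
  have ht := tendsto_eval_dirNhds hP hP0 θ
  obtain ⟨K, hK⟩ := exists_norm_eval_le P 1 fun n hn => by
    rw [Nat.lt_one_iff.1 hn, Polynomial.coeff_zero_eq_eval_zero, hP0]
  refine ⟨{z | P.eval z ∈ V ∧ ‖P.eval z‖ ≤ 1}, ?_, mem_asympSubalgebra_of_approx fun N => ?_⟩
  · filter_upwards [ht.eventually hV,
      ht.eventually (eventually_dirNhds_small (polyDir P θ) one_pos)] with z h1 h2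
      using ⟨h1, h2.2.le⟩
  obtain ⟨c, hc⟩ := h N
  -- The comparison pair is the polynomial `(trunc N H) ∘ P`; since `P(z) = O(z)`, the remainder of
  -- order `N` of `f` stays `O(z ^ N)`.
  refine ⟨_, coe_mem_asympSubalgebra _ ((PowerSeries.trunc N H).comp P), ⟨|c| * |K| ^ N,
    fun z hz hz1 => ?_⟩, fun n hn => ?_⟩
  · dsimp only
    rw [Polynomial.eval_comp, mul_assoc, ← mul_pow]
    refine (hc _ hz.1 hz.2).trans ?_
    have := hK z hz1
    rw [pow_one] at this
    gcongr
    · exact le_abs_self c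
    · exact this.trans (by gcongr; exact le_abs_self K)
  · rw [coeff_compPoly hP0 H hn, Polynomial.coeff_coe, Polynomial.comp,
      PowerSeries.eval₂_trunc_eq_sum_range, Polynomial.finsetSum_coeff]
    refine Finset.sum_congr rfl fun d _ => ?_
    rw [Polynomial.coeff_C_mul, ← Polynomial.coe_pow, Polynomial.coeff_coe]

/-- From `|P(z)| ≤ M' |z| ^ ν` one gets `b / |P(z)| ^ l ≥ b' / |z| ^ (ν l)`. -/
lemma ExpFlat.comp_eval {P : Polynomial ℂ} (hP : P ≠ 0) (hP0 : P.eval 0 = 0)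
    {θ : Real.Angle} {f : ℂ → ℂ} {l : ℝ} (hl : 0 < l) (hf : ExpFlat l f (polyDir P θ)) :
    ExpFlat (P.natTrailingDegree * l) (fun z => f (P.eval z)) θ := by
  obtain ⟨h0, A, b, hA, hb, h⟩ := hf
  have ht := tendsto_eval_dirNhds hP hP0 θ
  obtain ⟨M, hM⟩ := exists_norm_eval_le P P.natTrailingDegree fun n hn =>
    Polynomial.coeff_eq_zero_of_lt_natTrailingDegree hn
  set ν := P.natTrailingDegree with hν
  set M' := |M| + 1 with hM'
  have hM'0 : 0 < M' := by positivity
  refine ⟨h0.comp_eval hP hP0, A, b / M' ^ l, hA, by positivity, ?_⟩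
  filter_upwards [ht.eventually h, eventually_dirNhds_small θ one_pos,
    ht.eventually (eventually_dirNhds_small (polyDir P θ) one_pos)] with z h1 h2 h3
  refine h1.trans ?_
  have hz := h2.1
  have hPz := h3.1
  have hle : ‖P.eval z‖ ≤ M' * ‖z‖ ^ ν := (hM z h2.2.le).trans (by
    gcongr; linarith [le_abs_self M])
  have hpow : ‖P.eval z‖ ^ l ≤ M' ^ l * ‖z‖ ^ (ν * l) := by
    calc _ ≤ (M' * ‖z‖ ^ ν) ^ l := by gcongr
      _ = _ := by
        rw [Real.mul_rpow hM'0.le (by positivity), ← Real.rpow_natCast ‖z‖ ν,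
          ← Real.rpow_mul hz.le]
  have : b / M' ^ l / ‖z‖ ^ (ν * l) ≤ b / ‖P.eval z‖ ^ l := by
    rw [div_div]
    gcongr
  refine mul_le_mul_of_nonneg_left (Real.exp_le_exp.2 ?_) hA.le
  rw [neg_div, neg_div]
  linarith

/-! ### Germs of the sums of `H` and of `H ∘ P` in all directions -/

lemma closedArc_mono {k k' : ℝ} (hk : 0 < k) (hkk : k ≤ k') (θ : Real.Angle) :
    closedArc θ k' ⊆ closedArc θ k := by
  rintro _ ⟨t, ht, rfl⟩
  refine ⟨t, ht.trans ?_, rfl⟩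
  have := Real.pi_pos
  gcongr

lemma mem_closedArc_comm {k : ℝ} {θ η : Real.Angle} (h : η ∈ closedArc θ k) :
    θ ∈ closedArc η k := by
  obtain ⟨t, ht, rfl⟩ := h
  exact ⟨-t, by rwa [abs_neg], by rw [Real.Angle.coe_neg]; abel⟩

lemma infinite_closedArc {k : ℝ} (hk : 0 < k) (θ : Real.Angle) : (closedArc θ k).Infinite := by
  have hpi := Real.pi_pos
  set δ := min Real.pi (Real.pi / (2 * k)) with hδ
  have hδ0 : 0 < δ := by positivity
  refine Set.infinite_of_injOn_mapsTo (s := Set.Ioo (0 : ℝ) δ)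
    (f := fun t : ℝ => θ + (t : Real.Angle)) ?_ ?_ (Set.Ioo_infinite hδ0)
  · intro s hs t ht hst
    have h1 : (s : Real.Angle) = t := add_left_cancel hst
    rw [← Real.Angle.toReal_coe_eq_self_iff.2 ⟨by linarith [hs.1],
        (hs.2.trans_le (min_le_left _ _)).le⟩, h1,
      Real.Angle.toReal_coe_eq_self_iff.2 ⟨by linarith [ht.1],
        (ht.2.trans_le (min_le_left _ _)).le⟩]
  · intro t ht
    exact ⟨t, by rw [abs_of_pos ht.1]; exact (ht.2.trans_le (min_le_right _ _)).le, rfl⟩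

/-- Even in a singular direction `η` there is such a germ: the closed arc around `η` is infinite, so
it contains the centre of a sum whose arc in turn contains `η`. -/
lemma IsSummable.exists_hasGevreyAsymp {l : ℝ} (hl : 0 < l) {H : PowerSeries ℂ}
    (hH : IsSummable l H) (η : Real.Angle) : ∃ f, HasGevreyAsymp (1 / l) f H η := by
  obtain ⟨θ, h1, h2⟩ := ((infinite_closedArc hl η).sdiff hH).nonempty
  obtain ⟨-, f, hf⟩ := not_not.1 h2
  exact ⟨f, hf η (mem_closedArc_comm h1)⟩

/-- The difference is Gevrey with zero expansion, hence flat. -/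
lemma HasGevreyAsymp.expFlat_sub {k : ℝ} (hk : 0 < k) {f g : ℂ → ℂ} {F : PowerSeries ℂ}
    {θ : Real.Angle} (hf : HasGevreyAsymp (1 / k) f F θ) (hg : HasGevreyAsymp (1 / k) g F θ) :
    ExpFlat k (fun z => f z - g z) θ := by
  have := hf.sub (by positivity) hg
  rw [sub_self] at this
  exact this.expFlat hk

/-- A family of germs, one in each direction, that represents `F` modulo exponentially flat
functions of order `k`. -/
structure IsQuotSum (k : ℝ) (F : PowerSeries ℂ) (Q : Real.Angle → ℂ → ℂ) : Prop where
  hasAsymp : ∀ η, HasAsymp (Q η) F η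
  eventually : ∀ θ, ∀ᶠ η in 𝓝 θ, ExpFlat k (fun z => Q η z - Q θ z) η

lemma IsQuotSum.isQuotSection {k : ℝ} {F : PowerSeries ℂ} {Q : Real.Angle → ℂ → ℂ}
    (hQ : IsQuotSum k F Q) : IsQuotSection k Set.univ Q := fun θ _ =>
  ⟨_, (hQ.eventually θ).and (hQ.hasAsymp θ).eventually, Q θ, fun _ hη => ⟨F, hη.2⟩,
    fun _ hη => hη.1.1⟩

lemma IsQuotSum.hasGevreyAsymp {k : ℝ} (hk : 0 < k) {F : PowerSeries ℂ} {Q : Real.Angle → ℂ → ℂ}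
    (hQ : IsQuotSum k F Q) (η : Real.Angle) : HasGevreyAsymp (1 / k) (Q η) F η :=
  hQ.isQuotSection.hasGevreyAsymp hk (hQ.hasAsymp η)

/-- The Gevrey order of `f ∘ P` is not estimated directly. The pulled back germs form a section
modulo flat germs of order `ν l`, so Ramis–Sibuya gives their Gevrey bounds, and any other `f ∘ P`
differs from them by a flat germ. -/
lemma exists_isQuotSum_compPoly {l : ℝ} (hl : 0 < l) {H : PowerSeries ℂ} (hH : IsSummable l H)
    {P : Polynomial ℂ} (hP : P ≠ 0) (hP0 : P.eval 0 = 0) :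
    ∃ Q, IsQuotSum (P.natTrailingDegree * l) (compPoly H P) Q ∧
      ∀ (f : ℂ → ℂ) (η : Real.Angle), HasGevreyAsymp (1 / l) f H (polyDir P η) →
        HasGevreyAsymp (1 / (P.natTrailingDegree * l)) (fun z => f (P.eval z)) (compPoly H P) η := by
  choose q hq using hH.exists_hasGevreyAsymp hl
  have hν : (0 : ℝ) < P.natTrailingDegree := by exact_mod_cast natTrailingDegree_pos hP hP0
  have hQ : IsQuotSum (P.natTrailingDegree * l) (compPoly H P)
      (fun η z => q (polyDir P η) (P.eval z)) := by
    refine ⟨fun η => (hq _).hasAsymp.comp_eval hP hP0, fun θ => ?_⟩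
    filter_upwards [(continuous_polyDir P).continuousAt.eventually (hq (polyDir P θ)).eventually]
      with η hη
    exact ((hq (polyDir P η)).expFlat_sub hl hη).comp_eval hP hP0 hl
  refine ⟨_, hQ, fun f η hf => ?_⟩
  have h1 := ((hf.expFlat_sub hl (hq (polyDir P η))).comp_eval hP hP0 hl).hasGevreyAsymp
    (by positivity)
  have h2 := h1.add (by positivity) (hQ.hasGevreyAsymp (by positivity) η)
  rw [zero_add] at h2
  simpa only [sub_add_cancel] using h2

lemma polyDir_mem_closedArc {P : Polynomial ℂ} (hP : P ≠ 0) (hP0 : P.eval 0 = 0) {l : ℝ}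
    (hl : 0 < l) {φ η : Real.Angle} (h : η ∈ closedArc φ (P.natTrailingDegree * l)) :
    polyDir P η ∈ closedArc (polyDir P φ) l := by
  obtain ⟨t, ht, rfl⟩ := h
  have hν : (0 : ℝ) < P.natTrailingDegree := by exact_mod_cast natTrailingDegree_pos hP hP0
  refine ⟨P.natTrailingDegree * t, ?_, ?_⟩
  · rw [abs_mul, abs_of_pos hν]
    calc _ ≤ (P.natTrailingDegree : ℝ) * (Real.pi / (2 * (P.natTrailingDegree * l))) := by gcongr
      _ = _ := by field_simp
  · rw [polyDir, polyDir, nsmul_add, ← nsmul_eq_mul, Real.Angle.coe_nsmul]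
    abel

lemma SummableInDir.compPoly {l : ℝ} (hl : 0 < l) {H : PowerSeries ℂ} (hH : IsSummable l H)
    {P : Polynomial ℂ} (hP : P ≠ 0) (hP0 : P.eval 0 = 0) {φ : Real.Angle}
    (h : SummableInDir l H (polyDir P φ)) :
    ∃ f, IsSumInDir (P.natTrailingDegree * l) (compPoly H P) φ f := by
  obtain ⟨Q, -, hQ⟩ := exists_isQuotSum_compPoly hl hH hP hP0
  obtain ⟨-, f, hf⟩ := h
  exact ⟨fun z => f (P.eval z), fun η hη =>
    hQ f η (hf _ (polyDir_mem_closedArc hP hP0 hl hη))⟩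

/-! ### The multisum of a composition -/

lemma IsQuotSection.sub {k : ℝ} {X : Set Real.Angle} {q q' : Real.Angle → ℂ → ℂ}
    (hq : IsQuotSection k X q) (hq' : IsQuotSection k X q') :
    IsQuotSection k X fun θ z => q θ z - q' θ z := by
  intro θ hθ
  obtain ⟨U, hU, g, hg, h⟩ := hq θ hθ
  obtain ⟨U', hU', g', hg', h'⟩ := hq' θ hθ
  refine ⟨U ∩ U', Filter.inter_mem hU hU', fun z => g z - g' z, fun η hη => ?_, fun η hη => ?_⟩
  · obtain ⟨F, hF⟩ := hg η hη.1
    obtain ⟨F', hF'⟩ := hg' η hη.2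
    exact ⟨F - F', hF.sub hF'⟩
  · refine ((h η ⟨hη.1.1, hη.2⟩).sub (h' η ⟨hη.1.2, hη.2⟩)).congr
      (Filter.Eventually.of_forall fun z => ?_)
    ring

/-- The last component of the `k`-sum in a direction is unique. -/
theorem IsMultisumInDir.eqNear {N : ℕ} {k : Fin (N + 1) → ℝ} (hk0 : ∀ t, 0 < k t)
    (hk : StrictMono k) {Φ : PowerSeries ℂ} {φ : Real.Angle} {f f' : ℂ → ℂ}
    (hf : IsMultisumInDir k Φ φ f) (hf' : IsMultisumInDir k Φ φ f') :
    EqNear (closedArc φ (k (Fin.last N))) f f' := by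
  obtain ⟨q, hq⟩ := hf
  obtain ⟨q', hq'⟩ := hf'
  -- Induction on the level. Ramis–Sibuya starts it; at each step the compatibility conditions make
  -- the next difference flat of the old order on the old arc, and the relative Watson lemma raises
  -- the order.
  have key : ∀ t, ∀ η ∈ closedArc φ (k t), ExpFlat (k t) (fun z => q t η z - q' t η z) η := by
    intro t
    induction t using Fin.induction with
    | zero =>
      intro η _
      exact (hq.zero_section.hasGevreyAsymp (hk0 0) (hq.zero_taylor η)).expFlat_sub (hk0 0)
        (hq'.zero_section.hasGevreyAsymp (hk0 0) (hq'.zero_taylor η))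
    | succ i ih =>
      intro η hη
      have hlt : k i.castSucc < k i.succ := hk Fin.castSucc_lt_succ
      refine ((hq.mid_section i).sub (hq'.mid_section i)).expFlat (hk0 _) hlt (fun η hη => ?_)
        (closedArc_mono (hk0 _) hlt.le φ hη)
      refine (((ih η hη).sub (hq.mid_compat i η hη)).add (hq'.mid_compat i η hη)).congr
        (Filter.Eventually.of_forall fun z => ?_)
      ring
  intro η hη
  have hflat : ∀ η ∈ closedArc φ (k (Fin.last N)),
      ExpFlat (k (Fin.last N)) (fun z => f z - f' z) η := by
    intro η hη
    refine (((key _ η hη).sub (hq.last_compat η hη)).add (hq'.last_compat η hη)).congr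
      (Filter.Eventually.of_forall fun z => ?_)
    ring
  filter_upwards [eqNear_zero_of_expFlat (hk0 _) hflat η hη] with z hz
  exact sub_eq_zero.1 hz

section levels

variable {m n : ℕ} {F : MvPowerSeries (Option (Fin m × Fin n)) ℂ} {κ : Fin n → ℝ}
  {G : Fin m → Fin n → PowerSeries ℂ} {Q : Fin m → Fin n → Real.Angle → ℂ → ℂ}
  {h : Fin m → Fin n → ℂ → ℂ} {φ : Real.Angle} {T T' : ℝ} {X : Set Real.Angle}

/-- The composition with the sums `h i j` of the levels below `T` and with the germs `Q i j` of
the other levels. -/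
noncomputable def levelComp (F : MvPowerSeries (Option (Fin m × Fin n)) ℂ) (κ : Fin n → ℝ)
    (h : Fin m → Fin n → ℂ → ℂ) (Q : Fin m → Fin n → Real.Angle → ℂ → ℂ) (T : ℝ)
    (η : Real.Angle) : ℂ → ℂ :=
  sumComp F fun i j => if κ j < T then h i j else Q i j η

lemma hasAsymp_ite {θ η : Real.Angle}
    (hh : ∀ i j, κ j < T → HasAsymp (h i j) (G i j) η)
    (hθ : ∀ i j, HasAsymp (Q i j θ) (G i j) η) (i : Fin m) (j : Fin n) :
    HasAsymp (if κ j < T then h i j else Q i j θ) (G i j) η := by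
  split_ifs with hj
  · exact hh i j hj
  · exact hθ i j

lemma hasAsymp_levelComp (hF : IsConvergent F) (hG : ∀ i j, PowerSeries.constantCoeff (G i j) = 0)
    (hQ : ∀ i j, IsQuotSum (κ j) (G i j) (Q i j)) {η : Real.Angle}
    (hh : ∀ i j, κ j < T → HasAsymp (h i j) (G i j) η) :
    HasAsymp (levelComp F κ h Q T η) (formalComp F G) η :=
  HasAsymp.sumComp hF (hasAsymp_ite hh fun i j => (hQ i j).hasAsymp η) hG

/-- Near `θ`, freeze the germs at `θ`. Only levels `κ j ≥ T` are affected, and there the change is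
flat of order at least `T`. -/
lemma isQuotSection_levelComp (hF : IsConvergent F)
    (hG : ∀ i j, PowerSeries.constantCoeff (G i j) = 0)
    (hQ : ∀ i j, IsQuotSum (κ j) (G i j) (Q i j))
    (hh : ∀ i j, κ j < T → ∀ η ∈ X, HasAsymp (h i j) (G i j) η) :
    IsQuotSection T X (levelComp F κ h Q T) := by
  intro θ hθ
  have hev : ∀ᶠ η in 𝓝 θ, ∀ i j, (κ j < T → HasAsymp (h i j) (G i j) η) ∧
      HasAsymp (Q i j θ) (G i j) η ∧ ExpFlat (κ j) (fun z => Q i j η z - Q i j θ z) η := by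
    refine Filter.eventually_all.2 fun i => Filter.eventually_all.2 fun j => Filter.Eventually.and ?_
      (((hQ i j).hasAsymp θ).eventually.and ((hQ i j).eventually θ))
    by_cases hj : κ j < T
    · simpa [hj] using (hh i j hj θ hθ).eventually
    · simp [hj]
  refine ⟨_, hev, sumComp F fun i j => if κ j < T then h i j else Q i j θ, fun η hη =>
    ⟨formalComp F G, HasAsymp.sumComp hF
      (hasAsymp_ite (fun i j => (hη i j).1) fun i j => (hη i j).2.1) hG⟩, fun η hη => ?_⟩
  refine ExpFlat.sumComp_sub hF
    (hasAsymp_ite (fun i j => (hη.1 i j).1) fun i j => (hQ i j).hasAsymp η)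
    (hasAsymp_ite (fun i j => (hη.1 i j).1) fun i j => (hη.1 i j).2.1) hG fun i j => ?_
  split_ifs with hj
  · simpa only [sub_self] using expFlat_zero T η
  · exact (hη.1 i j).2.2.mono (not_lt.1 hj)

/-- Only the entries with `T ≤ κ j < T'` change from a germ to a sum; both have the same Gevrey
expansion, so the change is flat of order `κ j ≥ T`. -/
lemma expFlat_levelComp_sub (hF : IsConvergent F)
    (hG : ∀ i j, PowerSeries.constantCoeff (G i j) = 0) (hκ : ∀ j, 0 < κ j)
    (hQ : ∀ i j, IsQuotSum (κ j) (G i j) (Q i j)) (hT : T ≤ T') {η : Real.Angle}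
    (hh : ∀ i j, κ j < T' → HasGevreyAsymp (1 / κ j) (h i j) (G i j) η) :
    ExpFlat T (fun z => levelComp F κ h Q T η z - levelComp F κ h Q T' η z) η := by
  refine ExpFlat.sumComp_sub hF
    (hasAsymp_ite (fun i j hj => (hh i j (hj.trans_le hT)).hasAsymp)
      fun i j => (hQ i j).hasAsymp η)
    (hasAsymp_ite (fun i j hj => (hh i j hj).hasAsymp) fun i j => (hQ i j).hasAsymp η) hG
    fun i j => ?_
  by_cases hj : κ j < T
  · simpa only [if_pos hj, if_pos (hj.trans_le hT), sub_self] using expFlat_zero T η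
  by_cases hj' : κ j < T'
  · simp only [if_neg hj, if_pos hj']
    exact (((hQ i j).hasGevreyAsymp (hκ j) η).expFlat_sub (hκ j) (hh i j hj')).mono (not_lt.1 hj)
  · simpa only [if_neg hj, if_neg hj', sub_self] using expFlat_zero T η

/-- The `k`-sum of a composition in terms of the sums of its ingredients. -/
theorem isMultisumInDir_sumComp (hF : IsConvergent F)
    (hG : ∀ i j, PowerSeries.constantCoeff (G i j) = 0) (hκ : ∀ j, 0 < κ j)
    (hQ : ∀ i j, IsQuotSum (κ j) (G i j) (Q i j)) {N : ℕ} {k : Fin (N + 1) → ℝ}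
    (hk : StrictMono k) (hkκ : Set.range k = Set.range κ)
    (hh : ∀ i j, IsSumInDir (κ j) (G i j) φ (h i j)) :
    IsMultisumInDir k (formalComp F G) φ (sumComp F h) := by
  have hκk : ∀ j, ∃ t, k t = κ j := fun j => by
    have : κ j ∈ Set.range k := by rw [hkκ]; exact ⟨j, rfl⟩
    exact this
  have harc : ∀ i j t, κ j ≤ k t → ∀ η ∈ closedArc φ (k t),
      HasGevreyAsymp (1 / κ j) (h i j) (G i j) η := fun i j t hj η hη =>
    hh i j η (closedArc_mono (hκ j) hj φ hη)
  have hsucc : ∀ (i : Fin N) j, κ j < k i.succ → κ j ≤ k i.castSucc := by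
    intro i j hj
    obtain ⟨t, ht⟩ := hκk j
    rw [← ht] at hj ⊢
    exact hk.monotone (Fin.le_castSucc_iff.2 (hk.lt_iff_lt.1 hj))
  -- The threshold in `levelComp` is strict; adding `1` puts it above the top level, so that all
  -- entries become sums.
  have hlast : ∀ j, κ j < k (Fin.last N) + 1 := by
    intro j
    obtain ⟨t, ht⟩ := hκk j
    rw [← ht]
    have := hk.monotone (Fin.le_last t)
    linarith
  have hlast' : ∀ j, κ j ≤ k (Fin.last N) := by
    intro j
    obtain ⟨t, ht⟩ := hκk j
    rw [← ht]
    exact hk.monotone (Fin.le_last t)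
  have htop : ∀ η, levelComp F κ h Q (k (Fin.last N) + 1) η = sumComp F h := by
    intro η
    simp only [levelComp, hlast, if_true]
  have hzero : ∀ j, ¬ κ j < k 0 := by
    intro j
    obtain ⟨t, ht⟩ := hκk j
    rw [← ht, not_lt]
    exact hk.monotone (Fin.zero_le t)
  -- With threshold `k t`, levels up to the preceding one are already summed, and their sums exist
  -- on the preceding, larger arc. For `t = 0` all entries are still germs, which is why this
  -- component lives on the whole circle.
  refine ⟨fun t => levelComp F κ h Q (k t), ?_, ?_, ?_, ?_, ?_, ?_⟩
  · exact isQuotSection_levelComp hF hG hQ fun i j hj => absurd hj (hzero j)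
  · exact fun η => hasAsymp_levelComp hF hG hQ fun i j hj => absurd hj (hzero j)
  · exact fun i => isQuotSection_levelComp hF hG hQ fun i' j hj η hη =>
      (harc i' j _ (hsucc i j hj) η hη).hasAsymp
  · exact fun i η hη => expFlat_levelComp_sub hF hG hκ hQ (hk.monotone Fin.castSucc_lt_succ.le)
      fun i' j hj => harc i' j _ (hsucc i j hj) η hη
  · exact fun η hη => ⟨formalComp F G, HasAsymp.sumComp hF
      (fun i j => (harc i j _ (hlast' j) η hη).hasAsymp) hG⟩
  · intro η hη
    have := expFlat_levelComp_sub hF hG hκ hQ (T := k (Fin.last N)) (T' := k (Fin.last N) + 1)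
      (by linarith) (η := η) (fun i j _ => harc i j _ (hlast' j) η hη)
    simpa only [htop] using this

/-- Ramis–Sibuya applied to the composition with germs only. The zero functions are placeholders: no
level lies below `T`. -/
lemma isGevrey_formalComp (hF : IsConvergent F)
    (hG : ∀ i j, PowerSeries.constantCoeff (G i j) = 0)
    (hQ : ∀ i j, IsQuotSum (κ j) (G i j) (Q i j)) (hT : 0 < T) (hTκ : ∀ j, T ≤ κ j) :
    IsGevrey (1 / T) (formalComp F G) := by
  have h1 : IsQuotSection T Set.univ (levelComp F κ (fun _ _ _ => 0) Q T) :=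
    isQuotSection_levelComp hF hG hQ fun i j hj => absurd hj (not_lt.2 (hTκ j))
  exact (h1.hasGevreyAsymp hT (η := 0) (hasAsymp_levelComp hF hG hQ
    fun i j hj => absurd hj (not_lt.2 (hTκ j)))).isGevrey

end levels

/-! ### Gluing the sums over an arc -/

lemma closedArc_eq_image (θ : Real.Angle) (k : ℝ) : closedArc θ k =
    (fun η => θ + η) '' ((fun t : ℝ => (t : Real.Angle)) ''
      Set.Icc (-(Real.pi / (2 * k))) (Real.pi / (2 * k))) := by
  ext η
  simp only [closedArc, Set.mem_ofPred_eq, Set.mem_image, Set.mem_Icc, ← abs_le,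
    exists_exists_and_eq_and]
  exact exists_congr fun t => and_congr_right fun _ => eq_comm

lemma isCompact_coe_Icc (a b : ℝ) :
    IsCompact ((fun t : ℝ => (t : Real.Angle)) '' Set.Icc a b) :=
  isCompact_Icc.image Real.Angle.continuous_coe

lemma isClosed_closedArc (θ : Real.Angle) (k : ℝ) : IsClosed (closedArc θ k) := by
  rw [closedArc_eq_image]
  exact ((isCompact_coe_Icc _ _).image (continuous_const.add continuous_id)).isClosed

lemma isOpen_openArc (θ : Real.Angle) (k : ℝ) : IsOpen (openArc θ k) := by
  have : openArc θ k = (fun η => θ + η) '' ((fun t : ℝ => (t : Real.Angle)) ''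
      Set.Ioo (-(Real.pi / (2 * k))) (Real.pi / (2 * k))) := by
    ext η
    simp only [openArc, Set.mem_ofPred_eq, Set.mem_image, Set.mem_Ioo, ← abs_lt,
      exists_exists_and_eq_and]
    exact exists_congr fun t => and_congr_right fun _ => eq_comm
  rw [this]
  exact (Homeomorph.addLeft θ).isOpenMap _ (QuotientAddGroup.isOpenMap_coe _ isOpen_Ioo)

lemma openArc_subset_closedArc (θ : Real.Angle) (k : ℝ) : openArc θ k ⊆ closedArc θ k :=
  fun _ ⟨t, ht, h⟩ => ⟨t, ht.le, h⟩

/-- A tube argument: the arc is a translate of a fixed compact set, so an open condition on it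
survives a small translation. -/
lemma eventually_forall_closedArc {p : Real.Angle → Prop} {θ : Real.Angle} {k : ℝ}
    (h : ∀ η ∈ closedArc θ k, ∀ᶠ η' in 𝓝 η, p η') :
    ∀ᶠ θ' in 𝓝 θ, ∀ η ∈ closedArc θ' k, p η := by
  simp only [closedArc_eq_image] at h ⊢
  have := (isCompact_coe_Icc (-(Real.pi / (2 * k)))
    (Real.pi / (2 * k))).eventually_forall_of_forall_eventually (x₀ := θ) (P := fun θ' η => p (θ' + η)) fun η hη =>
      (continuous_add.tendsto (θ, η)).eventually (h (θ + η) ⟨η, hη, rfl⟩)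
  filter_upwards [this] with θ' hθ'
  rintro _ ⟨η, hη, rfl⟩
  exact hθ' η hη

/-- The `k`-sum in a direction is unique. -/
lemma IsSumInDir.eqNear {k : ℝ} (hk : 0 < k) {F : PowerSeries ℂ} {θ : Real.Angle} {f g : ℂ → ℂ}
    (hf : IsSumInDir k F θ f) (hg : IsSumInDir k F θ g) : EqNear (closedArc θ k) f g := by
  intro η hη
  filter_upwards [eqNear_zero_of_expFlat hk
    (fun η hη => (hf η hη).expFlat_sub hk (hg η hη)) η hη] with z hz
  exact sub_eq_zero.1 hz

lemma IsSumInDir.eventually {k : ℝ} {F : PowerSeries ℂ} {θ : Real.Angle} {f : ℂ → ℂ}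
    (hf : IsSumInDir k F θ f) : ∀ᶠ θ' in 𝓝 θ, IsSumInDir k F θ' f :=
  eventually_forall_closedArc fun η hη => (hf η hη).eventually

section glue

variable {k D : ℝ} {ξ : Real.Angle} {F : PowerSeries ℂ} {f : ℝ → ℂ → ℂ}

/-- The parameters between `p` and `p'` also have `η` in their arcs. By uniqueness the sums agree
for neighbouring parameters, and connectedness carries the agreement from `p` to `p'`. -/
lemma eventually_eq_of_mem_closedArc (hk : 1 ≤ k) (hD : |D| ≤ Real.pi)
    (hf : ∀ p ∈ Set.Ioo (0 : ℝ) 1, IsSumInDir k F (ξ + (p * D : ℝ)) (f p)) {p p' : ℝ}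
    (hp : p ∈ Set.Ioo (0 : ℝ) 1) (hp' : p' ∈ Set.Ioo (0 : ℝ) 1) {η : Real.Angle}
    (h : η ∈ closedArc (ξ + (p * D : ℝ)) k) (h' : η ∈ closedArc (ξ + (p' * D : ℝ)) k) :
    ∀ᶠ z in dirNhds η, f p z = f p' z := by
  have hpi := Real.pi_pos
  have hk0 : 0 < k := by linarith
  obtain ⟨t, ht, rfl⟩ := h
  obtain ⟨t', ht', he⟩ := h'
  have hL : Real.pi / (2 * k) ≤ Real.pi / 2 := by gcongr; linarith
  -- The two lifts of `η` differ by less than `2π`, since the arc of centres has length at most `π`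
  -- and, by `k ≥ 1`, each closed arc as well. So the arcs cannot meet the wrong way round the
  -- circle.
  have heq : p * D + t = p' * D + t' := by
    rw [add_assoc, add_assoc, ← Real.Angle.coe_add, ← Real.Angle.coe_add] at he
    obtain ⟨n, hn⟩ := Real.Angle.angle_eq_iff_two_pi_dvd_sub.1 (add_left_cancel he)
    have h1 : |(p - p') * D| < 2 * Real.pi - 2 * (Real.pi / 2) := by
      rw [abs_mul]
      have : |p - p'| < 1 := by rw [abs_lt]; constructor <;> linarith [hp.1, hp.2, hp'.1, hp'.2]
      nlinarith [abs_nonneg D, abs_nonneg (p - p')]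
    have h2 : |2 * Real.pi * (n : ℝ)| < 2 * Real.pi := by
      rw [← hn, show p * D + t - (p' * D + t') = (p - p') * D + (t - t') by ring]
      refine (abs_add_le _ _).trans_lt ?_
      have := abs_sub t t'
      linarith
    rw [abs_mul, abs_of_pos (by positivity : 0 < 2 * Real.pi)] at h2
    have h3 : |(n : ℝ)| < 1 := by
      by_contra hcon
      push Not at hcon
      nlinarith
    have h4 : n = 0 := by rw [← Int.abs_lt_one_iff]; exact_mod_cast h3
    rw [h4] at hn
    simp only [Int.cast_zero, mul_zero] at hn
    linarith
  set η := ξ + ((p * D : ℝ) : Real.Angle) + (t : Real.Angle) with hη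
  have hmem : ∀ s ∈ Set.uIcc p p', s ∈ Set.Ioo (0 : ℝ) 1 ∧ η ∈ closedArc (ξ + (s * D : ℝ)) k := by
    intro s hs
    refine ⟨Set.ordConnected_Ioo.uIcc_subset hp hp' hs, p * D + t - s * D, ?_, ?_⟩
    · obtain ⟨a, b, ha, hb, hab, rfl⟩ : s ∈ segment ℝ p p' := by rwa [segment_eq_uIcc]
      have e : p * D + t - (a • p + b • p') * D = a * t + b * t' := by
        simp only [smul_eq_mul]
        have e1 : p * D + t = a * (p * D + t) + b * (p' * D + t') := by
          rw [← heq, ← add_mul, hab, one_mul]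
        linarith
      rw [e]
      calc _ ≤ |a * t| + |b * t'| := abs_add_le _ _
        _ = a * |t| + b * |t'| := by rw [abs_mul, abs_mul, abs_of_nonneg ha, abs_of_nonneg hb]
        _ ≤ a * (Real.pi / (2 * k)) + b * (Real.pi / (2 * k)) := by gcongr
        _ = _ := by rw [← add_mul, hab, one_mul]
    · rw [hη, add_assoc, add_assoc, ← Real.Angle.coe_add, ← Real.Angle.coe_add]
      congr 2; ring
  have hpre : IsPreconnected (Set.uIcc p p') := isPreconnected_uIcc
  refine hpre.induction₂' (fun s s' => ∀ᶠ z in dirNhds η, f s z = f s' z) (fun s hs => ?_)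
    (fun x y z _ _ _ h1 h2 => by filter_upwards [h1, h2] with w a b using a.trans b)
    Set.left_mem_uIcc Set.right_mem_uIcc
  have hc : Continuous fun s : ℝ => ξ + ((s * D : ℝ) : Real.Angle) :=
    continuous_const.add (Real.Angle.continuous_coe.comp (continuous_id.mul continuous_const))
  have hev := hc.continuousAt.eventually (hf s (hmem s hs).1).eventually
  filter_upwards [nhdsWithin_le_nhds hev, self_mem_nhdsWithin] with s' h1 h2
  have h3 := h1.eqNear hk0 (hf s' (hmem s' h2).1) η (hmem s' h2).2
  exact ⟨h3, h3.mono fun z hz => hz.symm⟩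

/-- The glued function selects, by the argument of `z`, the first of a countable dense family of
sums whose open arc contains that direction. Near a given `η` only finitely many indices occur.
Closed arcs missing `η` are avoided nearby, so every sum that occurs is valid at `η` and agrees with
the given one. -/
lemma exists_glue (hk : 1 ≤ k) (hD : |D| ≤ Real.pi)
    (hf : ∀ p ∈ Set.Ioo (0 : ℝ) 1, IsSumInDir k F (ξ + (p * D : ℝ)) (f p)) :
    ∃ h : ℂ → ℂ, ∀ p ∈ Set.Ioo (0 : ℝ) 1, ∀ η ∈ openArc (ξ + (p * D : ℝ)) k,
      ∀ᶠ z in dirNhds η, h z = f p z := by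
  have : Nonempty (Set.Ioo (0 : ℝ) 1) := ⟨⟨1 / 2, by norm_num⟩⟩
  set τ := TopologicalSpace.denseSeq (Set.Ioo (0 : ℝ) 1) with hτ
  set A : ℕ → Set Real.Angle := fun i => openArc (ξ + (((τ i : ℝ) * D : ℝ) : Real.Angle)) k with hA
  set ind : Real.Angle → ℕ := fun η => sInf {i | η ∈ A i} with hind
  refine ⟨fun z => f (τ (ind z.arg)) z, fun p hp η hη => ?_⟩
  -- some direction of the dense sequence is near `η`
  obtain ⟨i₀, hi₀⟩ : ∃ i, η ∈ A i := by
    obtain ⟨t, ht, rfl⟩ := hη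
    have hc : Continuous fun s : Set.Ioo (0 : ℝ) 1 => |(p - s) * D + t| := by fun_prop
    obtain ⟨i, hi⟩ := (TopologicalSpace.denseRange_denseSeq (Set.Ioo (0 : ℝ) 1)).exists_mem_open
      (show IsOpen {s : Set.Ioo (0 : ℝ) 1 | |(p - s) * D + t| < Real.pi / (2 * k)} from
        isOpen_lt hc continuous_const) ⟨⟨p, hp⟩, by simpa using ht⟩
    refine ⟨i, (p - τ i) * D + t, hi, ?_⟩
    rw [add_assoc, add_assoc, ← Real.Angle.coe_add, ← Real.Angle.coe_add]
    congr 2; ring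
  have hiη : η ∈ closedArc (ξ + (((τ i₀ : ℝ) * D : ℝ) : Real.Angle)) k :=
    openArc_subset_closedArc _ _ hi₀
  -- near `η` only finitely many directions are used, and they are all admissible at `η`
  have hev : ∀ᶠ η' in 𝓝 η, η' ∈ A i₀ ∧ ∀ i ∈ Finset.range (i₀ + 1),
      η' ∈ closedArc (ξ + (((τ i : ℝ) * D : ℝ) : Real.Angle)) k →
        η ∈ closedArc (ξ + (((τ i : ℝ) * D : ℝ) : Real.Angle)) k := by
    refine Filter.Eventually.and ((isOpen_openArc _ _).mem_nhds hi₀) ((Finset.eventually_all _).2 fun i _ => ?_)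
    by_cases hmem : η ∈ closedArc (ξ + (((τ i : ℝ) * D : ℝ) : Real.Angle)) k
    · exact Filter.Eventually.of_forall fun _ _ => hmem
    · filter_upwards [(isClosed_closedArc _ _).isOpen_compl.mem_nhds hmem] with η' h1 h2
      exact absurd h2 h1
  have hagree : ∀ᶠ z in dirNhds η, ∀ i ∈ Finset.range (i₀ + 1),
      η ∈ closedArc (ξ + (((τ i : ℝ) * D : ℝ) : Real.Angle)) k → f (τ i) z = f p z := by
    refine (Finset.eventually_all _).2 fun i _ => ?_
    by_cases hmem : η ∈ closedArc (ξ + (((τ i : ℝ) * D : ℝ) : Real.Angle)) k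
    · filter_upwards [eventually_eq_of_mem_closedArc hk hD hf (τ i).2 hp hmem
        (openArc_subset_closedArc _ _ hη)] with z hz _ using hz
    · exact Filter.Eventually.of_forall fun _ h => absurd h hmem
  filter_upwards [hagree, (tendsto_arg_dirNhds η).eventually hev] with z h1 h2
  have hle : ind z.arg ≤ i₀ := Nat.sInf_le h2.1
  have hin : (z.arg : Real.Angle) ∈ A (ind z.arg) := Nat.sInf_mem (s := {i | _ ∈ A i}) ⟨i₀, h2.1⟩
  have hr := Finset.mem_range.2 (Nat.lt_succ_of_le hle)
  exact h1 _ hr (h2.2 _ hr (openArc_subset_closedArc _ _ hin))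

end glue

/-- Moving the centre slightly towards the point, by `δ t`, shrinks its displacement to `(1 - δ) t`,
which is strictly inside. There is room since the centre is interior to a nondegenerate arc. -/
lemma closedArc_subset_arcBetweenThick {ξ ζ φ : Real.Angle} (hφ : φ ∈ arcBetween ξ ζ) (hξ : ξ ≠ ζ)
    {k : ℝ} (hk : 0 < k) : closedArc φ k ⊆ arcBetweenThick ξ ζ k := by
  obtain ⟨p, hp0, hp1, rfl⟩ := hφ
  rintro _ ⟨t, ht, rfl⟩
  set D := (ζ - ξ).toReal with hD
  have hD0 : D ≠ 0 := by
    rw [hD, Ne, Real.Angle.toReal_eq_zero_iff, sub_eq_zero]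
    exact fun h => hξ h.symm
  obtain ⟨s, hs0, hs1, hs⟩ : ∃ s, 0 < s ∧ s < 1 ∧ |t - (s - p) * D| < Real.pi / (2 * k) := by
    have hpi := Real.pi_pos
    have hc : ContinuousAt (fun δ : ℝ => p + δ * t / D) 0 := by fun_prop
    have hev : ∀ᶠ δ in 𝓝[>] (0 : ℝ), (0 < p + δ * t / D ∧ p + δ * t / D < 1) ∧ δ < 1 :=
      nhdsWithin_le_nhds (((hc.eventually_const_lt (by simpa using hp0)).and
        (hc.eventually_lt_const (by simpa using hp1))).and (eventually_lt_nhds one_pos))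
    obtain ⟨δ, ⟨⟨h1, h2⟩, h3⟩, h4 : 0 < δ⟩ := (hev.and self_mem_nhdsWithin).exists
    refine ⟨_, h1, h2, ?_⟩
    rw [show t - (p + δ * t / D - p) * D = (1 - δ) * t by field_simp; ring, abs_mul,
      abs_of_pos (by linarith)]
    have hL : 0 < Real.pi / (2 * k) := by positivity
    nlinarith [abs_nonneg t]
  refine Set.mem_biUnion (x := ξ + ((s * D : ℝ) : Real.Angle)) ⟨s, hs0, hs1, rfl⟩
    ⟨t - (s - p) * D, hs, ?_⟩
  rw [add_assoc, add_assoc, ← Real.Angle.coe_add, ← Real.Angle.coe_add]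
  congr 2; ring

/-- Sums in all directions of an arc define a sum on the arc. -/
theorem exists_isSumOn {k : ℝ} (hk : 1 ≤ k) {F : PowerSeries ℂ} {ξ ζ : Real.Angle} (hξ : ξ ≠ ζ)
    (h : ∀ φ ∈ arcBetween ξ ζ, ∃ f, IsSumInDir k F φ f) : ∃ f, IsSumOn k F ξ ζ f := by
  set D := (ζ - ξ).toReal with hD
  have hD' : |D| ≤ Real.pi := Real.Angle.abs_toReal_le_pi _
  have h' : ∀ p : ℝ, ∃ f, p ∈ Set.Ioo (0 : ℝ) 1 →
      IsSumInDir k F (ξ + ((p * D : ℝ) : Real.Angle)) f := by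
    intro p
    by_cases hp : p ∈ Set.Ioo (0 : ℝ) 1
    · obtain ⟨f, hf⟩ := h _ ⟨p, hp.1, hp.2, rfl⟩
      exact ⟨f, fun _ => hf⟩
    · exact ⟨0, fun hp' => absurd hp' hp⟩
  choose f hf using h'
  obtain ⟨g, hg⟩ := exists_glue hk hD' hf
  have hgF : ∀ η ∈ arcBetweenThick ξ ζ k, HasGevreyAsymp (1 / k) g F η := by
    intro η hη
    obtain ⟨_, ⟨p, hp0, hp1, rfl⟩, hη⟩ := Set.mem_iUnion₂.1 hη
    exact (hf p ⟨hp0, hp1⟩ η (openArc_subset_closedArc _ _ hη)).congr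
      ((hg p ⟨hp0, hp1⟩ η hη).mono fun z hz => hz.symm)
  exact ⟨g, fun η hη => ⟨F, hgF η hη⟩, fun φ hφ η hη =>
    hgF η (closedArc_subset_arcBetweenThick hφ hξ (by linarith) hη)⟩

/-! ### The exceptional directions -/

/-- Multiplication by `ν` on the circle has fibres of at most `ν` points. -/
lemma finite_setOf_polyDir_mem {P : Polynomial ℂ} (hP : P ≠ 0) (hP0 : P.eval 0 = 0)
    {S : Set Real.Angle} (hS : S.Finite) : {θ | polyDir P θ ∈ S}.Finite := by
  refine hS.preimage' fun b _ => ?_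
  rcases Set.eq_empty_or_nonempty (polyDir P ⁻¹' {b}) with h | ⟨θ₀, h₀⟩
  · rw [h]; exact Set.finite_empty
  · refine (Set.finite_range fun i : Fin P.natTrailingDegree =>
      θ₀ + (i : ℕ) • ((2 * Real.pi / P.natTrailingDegree : ℝ) : Real.Angle)).subset fun θ hθ => ?_
    have h1 : P.natTrailingDegree • θ = P.natTrailingDegree • θ₀ := by
      have h2 : polyDir P θ = polyDir P θ₀ := by
        rw [Set.mem_preimage, Set.mem_singleton_iff] at h₀ hθ
        rw [h₀, hθ]
      exact add_right_cancel h2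
    obtain ⟨i, hi⟩ := (Real.Angle.nsmul_eq_iff (natTrailingDegree_pos hP hP0).ne').1 h1
    exact ⟨i, hi.symm⟩

lemma finite_pulledSingularDirs {m n : ℕ} {l : ℝ} {H : Fin m → PowerSeries ℂ}
    (hH : ∀ i, IsSummable l (H i)) {P : Fin n → Polynomial ℂ} (hP : ∀ j, P j ≠ 0)
    (hP0 : ∀ j, (P j).eval 0 = 0) : (pulledSingularDirs l H P).Finite := by
  have : pulledSingularDirs l H P = ⋃ i, ⋃ j, {θ | polyDir (P j) θ ∈ singularDirs l (H i)} := by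
    ext θ; simp [pulledSingularDirs, polyDir]
  rw [this]
  exact Set.finite_iUnion fun i => Set.finite_iUnion fun j =>
    finite_setOf_polyDir_mem (hP j) (hP0 j) (hH i)

/-- The infimum is positive, so the arc is nondegenerate. It is at most `π/2`, so the signed length
of the arc is the one prescribed by `σ`, and minimality keeps `S` out of the open arc. -/
lemma nextDir_spec {S : Set Real.Angle} (hS : S.Finite) (σ : ℤˣ) (θ : Real.Angle) :
    θ ≠ nextDir S σ θ ∧ ∀ φ ∈ arcBetween θ (nextDir S σ θ), φ ∉ S := by
  have hpi := Real.pi_pos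
  set T : Set ℝ := {t : ℝ | 0 < t ∧
    (t = Real.pi / 2 ∨ θ + ((((σ : ℤ) : ℝ) * t : ℝ) : Real.Angle) ∈ S)} with hT
  set s : ℝ := ((σ : ℤ) : ℝ) with hs
  have hs1 : |s| = 1 := by
    rcases Int.units_eq_one_or σ with h | h <;> simp [hs, h]
  set d := sInf T with hd
  have hTb : BddBelow T := ⟨0, fun t ht => ht.1.le⟩
  have hT2 : Real.pi / 2 ∈ T := ⟨by positivity, Or.inl rfl⟩
  have hd2 : d ≤ Real.pi / 2 := csInf_le hTb hT2
  have hinj : ∀ t, 0 < t → t < Real.pi → θ + ((s * t : ℝ) : Real.Angle) ≠ θ := by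
    intro t h0 h1 h
    rw [add_eq_left] at h
    have h3 : |s * t| = t := by rw [abs_mul, hs1, one_mul, abs_of_pos h0]
    have h4 : (((s * t : ℝ) : Real.Angle)).toReal = s * t :=
      Real.Angle.toReal_coe_eq_self_iff.2 ⟨by linarith [neg_abs_le (s * t)],
        by linarith [le_abs_self (s * t)]⟩
    rw [h, Real.Angle.toReal_zero] at h4
    rw [← h4, abs_zero] at h3
    linarith
  -- `S` without `θ` is finite, hence closed, so it misses a neighbourhood of `θ`; and a parameter
  -- in `(0, π/2)` cannot lead back to `θ` itself.
  have hd0 : 0 < d := by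
    have hc : Continuous fun t : ℝ => θ + ((s * t : ℝ) : Real.Angle) :=
      continuous_const.add (Real.Angle.continuous_coe.comp (continuous_const.mul continuous_id))
    have hmem : ∀ᶠ t in 𝓝 (0 : ℝ), θ + ((s * t : ℝ) : Real.Angle) ∈ (S \ {θ})ᶜ := by
      refine hc.continuousAt.preimage_mem_nhds
        (IsOpen.mem_nhds (hS.subset Set.sdiff_subset).isClosed.isOpen_compl ?_)
      simp
    obtain ⟨ε, hε, hmem⟩ := Metric.eventually_nhds_iff.1 hmem
    refine (lt_min hε (by positivity : 0 < Real.pi / 2)).trans_le (le_csInf ⟨_, hT2⟩ fun t ht => ?_)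
    by_contra hcon
    rw [not_le, lt_min_iff] at hcon
    have h1 := hmem (y := t) (by rw [dist_zero_right, Real.norm_eq_abs, abs_of_pos ht.1]; exact hcon.1)
    rcases ht.2 with h2 | h2
    · exact hcon.2.ne h2
    · exact h1 ⟨h2, hinj t ht.1 (by linarith [hcon.2])⟩
  have hnext : nextDir S σ θ = θ + ((s * d : ℝ) : Real.Angle) := rfl
  have hsd : |s * d| = d := by rw [abs_mul, hs1, one_mul, abs_of_pos hd0]
  have hreal : (nextDir S σ θ - θ).toReal = s * d := by
    rw [hnext, add_sub_cancel_left]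
    exact Real.Angle.toReal_coe_eq_self_iff.2 ⟨by linarith [neg_abs_le (s * d)],
      by linarith [le_abs_self (s * d)]⟩
  refine ⟨fun h => hinj d hd0 (by linarith) (by rw [← hnext]; exact h.symm), ?_⟩
  rintro φ ⟨t, ht0, ht1, rfl⟩ hφ
  rw [hreal, show t * (s * d) = s * (t * d) by ring] at hφ
  have h1 : d ≤ t * d := csInf_le hTb ⟨by positivity, Or.inr hφ⟩
  nlinarith

lemma IsMultisumInDir.congr {N : ℕ} {k : Fin (N + 1) → ℝ} {Φ : PowerSeries ℂ} {φ : Real.Angle}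
    {f g : ℂ → ℂ} (hf : IsMultisumInDir k Φ φ f)
    (h : EqNear (closedArc φ (k (Fin.last N))) f g) : IsMultisumInDir k Φ φ g := by
  obtain ⟨q, hq⟩ := hf
  refine ⟨q, hq.zero_section, hq.zero_taylor, hq.mid_section, hq.mid_compat, fun θ hθ => ?_,
    fun θ hθ => ?_⟩
  · obtain ⟨F, hF⟩ := hq.last_section θ hθ
    exact ⟨F, hF.congr (h θ hθ)⟩
  · exact (hq.last_compat θ hθ).congr ((h θ hθ).mono fun z hz => by rw [hz])

end Multisum

/-! ### Multisummability of the composed series -/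

theorem mainTheorem5 {m n N : ℕ}
    (F : MvPowerSeries (Option (Fin m × Fin n)) ℂ) (hF : Multisum.IsConvergent F)
    (l : ℝ) (hl : 1 ≤ l)
    (H : Fin m → PowerSeries ℂ) (hH : ∀ i, Multisum.IsSummable l (H i))
    (hH0 : ∀ i, PowerSeries.constantCoeff (H i) = 0)
    (P : Fin n → Polynomial ℂ) (hP : ∀ j, P j ≠ 0) (hP0 : ∀ j, (P j).eval 0 = 0)
    (k : Fin (N + 1) → ℝ) (hk : StrictMono k)
    (hkP : Set.range k = Set.range (fun j => ((P j).natTrailingDegree : ℝ) * l)) :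
    (∀ (θ : Real.Angle) (σ : ℤˣ),
      (∀ φ ∈ Multisum.arcBetween θ
          (Multisum.nextDir (Multisum.pulledSingularDirs l H P) σ θ),
        Multisum.MultisummableInDir k
          (Multisum.formalComp F (fun i j => Multisum.compPoly (H i) (P j))) φ) ∧
      (∀ i j, ∃ h : ℂ → ℂ,
        Multisum.IsSumOn (((P j).natTrailingDegree : ℝ) * l) (Multisum.compPoly (H i) (P j))
          θ (Multisum.nextDir (Multisum.pulledSingularDirs l H P) σ θ) h) ∧
      ∀ h : Fin m → Fin n → ℂ → ℂ,
        (∀ i j, Multisum.IsSumOn (((P j).natTrailingDegree : ℝ) * l)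
          (Multisum.compPoly (H i) (P j))
          θ (Multisum.nextDir (Multisum.pulledSingularDirs l H P) σ θ) (h i j)) →
        ∀ g : ℂ → ℂ,
          Multisum.IsMultisumOn k
              (Multisum.formalComp F (fun i j => Multisum.compPoly (H i) (P j)))
              θ (Multisum.nextDir (Multisum.pulledSingularDirs l H P) σ θ) g ↔
            Multisum.EqNear
              (Multisum.arcBetweenThick θ
                (Multisum.nextDir (Multisum.pulledSingularDirs l H P) σ θ) (k (Fin.last N)))
              g (Multisum.sumComp F h)) ∧
    Multisum.IsMultisummable k
      (Multisum.formalComp F (fun i j => Multisum.compPoly (H i) (P j))) ∧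
    Multisum.multiSingularDirs k
      (Multisum.formalComp F (fun i j => Multisum.compPoly (H i) (P j)))
        ⊆ Multisum.pulledSingularDirs l H P := by
  have hl0 : 0 < l := by linarith
  have hν : ∀ j, (1 : ℝ) ≤ (P j).natTrailingDegree := fun j => by
    exact_mod_cast Multisum.natTrailingDegree_pos (hP j) (hP0 j)
  have hκ1 : ∀ j, 1 ≤ ((P j).natTrailingDegree : ℝ) * l := fun j => by nlinarith [hν j]
  have hκ0 : ∀ j, 0 < ((P j).natTrailingDegree : ℝ) * l := fun j => by linarith [hκ1 j]
  have hkκ : ∀ t, ∃ j, ((P j).natTrailingDegree : ℝ) * l = k t := fun t => by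
    have : k t ∈ Set.range k := ⟨t, rfl⟩
    rwa [hkP] at this
  have hκk : ∀ j, ∃ t, k t = ((P j).natTrailingDegree : ℝ) * l := fun j => by
    have : ((P j).natTrailingDegree : ℝ) * l ∈ Set.range k := by rw [hkP]; exact ⟨j, rfl⟩
    exact this
  have hk0 : ∀ t, 0 < k t := fun t => by
    obtain ⟨j, hj⟩ := hkκ t
    rw [← hj]; exact hκ0 j
  have hkmin : ∀ j, k 0 ≤ ((P j).natTrailingDegree : ℝ) * l := fun j => by
    obtain ⟨t, ht⟩ := hκk j
    rw [← ht]; exact hk.monotone (Fin.zero_le t)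
  have hkmax : ∀ j, ((P j).natTrailingDegree : ℝ) * l ≤ k (Fin.last N) := fun j => by
    obtain ⟨t, ht⟩ := hκk j
    rw [← ht]; exact hk.monotone (Fin.le_last t)
  have hG : ∀ i j, PowerSeries.constantCoeff (Multisum.compPoly (H i) (P j)) = 0 := fun i j =>
    Multisum.constantCoeff_compPoly (hP0 j) (hH0 i)
  -- The sections over the whole circle depend only on the series, not on the direction of
  -- summation; all directions use the same ones.
  choose Q hQ _ using fun i j =>
    Multisum.exists_isQuotSum_compPoly hl0 (hH i) (hP j) (hP0 j)
  set S := Multisum.pulledSingularDirs l H P with hS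
  have hSfin : S.Finite := Multisum.finite_pulledSingularDirs hH hP hP0
  -- Outside `S` every `P_j` maps the direction to a nonsingular direction of every `H_i`.
  have hsum : ∀ φ ∉ S, ∀ i j, ∃ f, Multisum.IsSumInDir (((P j).natTrailingDegree : ℝ) * l)
      (Multisum.compPoly (H i) (P j)) φ f := fun φ hφ i j =>
    Multisum.SummableInDir.compPoly hl0 (hH i) (hP j) (hP0 j)
      (by by_contra hcon; exact hφ ⟨i, j, hcon⟩)
  have hmulti : ∀ (φ : Real.Angle) (h : Fin m → Fin n → ℂ → ℂ),
      (∀ i j, Multisum.IsSumInDir (((P j).natTrailingDegree : ℝ) * l)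
        (Multisum.compPoly (H i) (P j)) φ (h i j)) →
      Multisum.IsMultisumInDir k
        (Multisum.formalComp F (fun i j => Multisum.compPoly (H i) (P j))) φ
        (Multisum.sumComp F h) := fun φ h hh =>
    Multisum.isMultisumInDir_sumComp hF hG hκ0 hQ hk hkP hh
  have hdir : ∀ φ ∉ S, Multisum.MultisummableInDir k
      (Multisum.formalComp F (fun i j => Multisum.compPoly (H i) (P j))) φ := by
    intro φ hφ
    choose h hh using hsum φ hφ
    exact ⟨Multisum.isGevrey_formalComp hF hG hQ (hk0 0) hkmin, _, hmulti φ h hh⟩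
  have hsub : Multisum.multiSingularDirs k
      (Multisum.formalComp F (fun i j => Multisum.compPoly (H i) (P j))) ⊆ S := by
    intro φ hφ
    by_contra hcon
    exact hφ (hdir φ hcon)
  refine ⟨fun θ σ => ?_, hSfin.subset hsub, hsub⟩
  obtain ⟨hne, havoid⟩ := Multisum.nextDir_spec hSfin σ θ
  set ζ := Multisum.nextDir S σ θ with hζ
  refine ⟨fun φ hφ => hdir φ (havoid φ hφ), fun i j => Multisum.exists_isSumOn (hκ1 j) hne
    fun φ hφ => hsum φ (havoid φ hφ) i j, fun h hh g => ⟨fun hg η hη => ?_, fun hg => ⟨?_, ?_⟩⟩⟩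
  -- On each arc with centre `φ` the composition of the sums is one multisum and `g` another;
  -- uniqueness in that direction gives equality of germs.
  · obtain ⟨φ, hφ, hηφ⟩ := Set.mem_iUnion₂.1 hη
    exact (hg.2 φ hφ).eqNear hk0 hk (hmulti φ h fun i j => (hh i j).2 φ hφ) η
      (Multisum.openArc_subset_closedArc _ _ hηφ)
  -- Conversely, a function with the germ of the composition inherits its expansion here and, in the
  -- last case, its property of being a multisum in each direction.
  · intro η hη
    obtain ⟨φ, hφ, hηφ⟩ := Set.mem_iUnion₂.1 hη
    have hsc : Multisum.HasAsymp (Multisum.sumComp F h)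
        (Multisum.formalComp F (fun i j => Multisum.compPoly (H i) (P j))) η :=
      Multisum.HasAsymp.sumComp hF (fun i j => ((hh i j).2 φ hφ η (Multisum.closedArc_mono (hκ0 j)
        (hkmax j) φ (Multisum.openArc_subset_closedArc _ _ hηφ))).hasAsymp) hG
    exact ⟨_, hsc.congr ((hg η hη).mono fun z hz => hz.symm)⟩
  · intro φ hφ
    refine (hmulti φ h fun i j => (hh i j).2 φ hφ).congr fun η hη => ?_
    exact (hg η (Multisum.closedArc_subset_arcBetweenThick hφ hne (hk0 _) hη)).mono
      fun z hz => hz.symm
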